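/- All graphs are finite, undirected and loopless, and may have parallel edges. For $X \subseteq V(G)$ let $d(X)$ be the number of edges of $G$ with exactly one end in $X$; $G$ is $3$-edge-connected if $d(X) \ge 3$ whenever $X$ and $V(G)\setminus X$ are both non-empty. Splitting off a pair of distinct edges $xy, yz$ with $x \ne z$ means deleting them and adding a new edge $xz$. Let $D_3$ be the complete graph $K_4$ with two of its vertices $y_0, y_1$ declared to be roots. A graph $G$ with two distinct root vertices $x_0, x_1$ has a rooted immersion of $D_3$ if some sequence of splits and deletions (of edges and vertices) transforms $G$ into a graph isomorphic to $K_4$ by an isomorphism that sends $x_0$ to $y_0$ and $x_1$ to $y_1$. A doubled cycle is a graph obtained from a cycle by adding a second copy of each edge. For disjoint $X, Y \subseteq V(G)$, a segmentation of $G$ of width $3$ relative to $(X,Y)$ is a sequence of nested sets $S_1 \subset S_2 \subset \dots \subset S_k \subseteq V(G)$, $k \ge 1$, with $S_1 = X$, $V(G) \setminus S_k = Y$, $|S_{i+1}\setminus S_i| = 1$ for $1 \le i \le k-1$, and $d(S_i) = 3$ for $1 \le i \le k$. **Corollary.** Let $G$ be a $3$-edge-connected graph with $|V(G)| \ge 4$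 and with two distinct root vertices $x_0, x_1$. Then $G$ has no rooted immersion of $D_3$ if and only if at least one of the following holds: 1. $G$ is a doubled cycle; 2. there are disjoint sets $X_0, X_1 \subseteq V(G)$ such that $G$ has a segmentation of width $3$ relative to $(X_0, X_1)$ and, for each $i \in \{0,1\}$, if $|X_i| \ge 3$ then $X_i$ contains neither $x_0$ nor $x_1$. -/

import Mathlib

open scoped Graph

namespace Graph

/-- The set `δ(X)` of edges of `G` having exactly one end in `X`. -/
def cut {α β : Type*} (G : Graph α β) (X : Set α) : Set β :=
  {e | ∃ x y, G.IsLink e x y ∧ x ∈ X ∧ y ∉ X}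

/-- `d(X) = |δ(X)|` (used for graphs with finitely many edges). -/
noncomputable def cutSize {α β : Type*} (G : Graph α β) (X : Set α) : ℕ :=
  (G.cut X).ncard

/-- `G` is `k`-edge-connected: `d(X) ≥ k` whenever `X` and `V(G) \ X` are both non-empty. -/
def EdgeConnected {α β : Type*} (G : Graph α β) (k : ℕ) : Prop :=
  ∀ X ⊆ V(G), X.Nonempty → (V(G) \ X).Nonempty → k ≤ G.cutSize X

/-- An isomorphism of multigraphs: bijections between the vertices and between the edges that
preserve the ends of every edge. -/
structure Iso {α β α' β' : Type*} (G : Graph α β) (H : Graph α' β') where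
  vertexEquiv : V(G) ≃ V(H)
  edgeEquiv : E(G) ≃ E(H)
  isLink_iff : ∀ (e : E(G)) (x y : V(G)),
    G.IsLink e x y ↔ H.IsLink (edgeEquiv e) (vertexEquiv x) (vertexEquiv y)

/-- `G'` is obtained from `G` by splitting off a pair of distinct edges `e = xy`, `f = yz` at `y`,
where `x ≠ z`: the edges `e` and `f` are deleted and a new edge `g = xz` is added.
The name `g` of the new edge is arbitrary, except that it is not the name of one of the remaining
edges (it may be `e` or `f`). -/
def IsSplitting {α β : Type*} (G G' : Graph α β) : Prop :=
  ∃ (x y z : α) (e f g : β),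
    e ≠ f ∧ x ≠ z ∧ G.IsLink e x y ∧ G.IsLink f y z ∧ g ∉ E(G) \ {e, f} ∧
    V(G') = V(G) ∧
    ∀ h u v, G'.IsLink h u v ↔
      (G.IsLink h u v ∧ h ≠ e ∧ h ≠ f) ∨ (h = g ∧ s(u, v) = s(x, z))

/-- A single operation: a deletion of edges and vertices (passing to a subgraph), or a split. -/
def ImmersionStep {α β : Type*} (G G' : Graph α β) : Prop :=
  G' ≤ G ∨ G.IsSplitting G'

/-- `(G; x₁, …, xₖ)` contains `(H; y₁, …, yₖ)` as a rooted immersion: a sequence of splits and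
deletions transforms `G` into a graph that is isomorphic to `H` by an isomorphism sending each
`xᵢ` to `yᵢ`. -/
def HasRootedImmersion {α β α' β' : Type*} {k : ℕ} (G : Graph α β) (x : Fin k → α)
    (H : Graph α' β') (y : Fin k → α') : Prop :=
  ∃ G' : Graph α β, Relation.ReflTransGen ImmersionStep G G' ∧
    ∃ φ : Iso G' H, ∀ i, ∃ hi : x i ∈ V(G'), (φ.vertexEquiv ⟨x i, hi⟩ : α') = y i

/-- The graph `D₃`, that is `K₄`; its roots are the vertices `0` and `1`. -/
def D₃ : Graph (Fin 4) (Sym2 (Fin 4)) :=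
  ofSimpleGraph (⊤ : SimpleGraph (Fin 4))

/-- The graph obtained from `G` by adding a second copy of each edge. -/
def double {α β : Type*} (G : Graph α β) : Graph α (β × Bool) where
  vertexSet := V(G)
  IsLink e x y := G.IsLink e.1 x y
  isLink_symm _ _ := ⟨fun _ _ h => h.symm⟩
  eq_or_eq_of_isLink_of_isLink _ _ _ _ _ h h' := h.left_eq_or_eq h'
  left_mem_of_isLink _ _ _ h := h.left_mem

/-- A doubled cycle is obtained from a cycle by adding a second copy of each edge. -/
def IsDoubledCycle {α β : Type*} (G : Graph α β) : Prop :=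
  ∃ n : ℕ, 3 ≤ n ∧ Nonempty (Iso G (ofSimpleGraph (SimpleGraph.cycleGraph n)).double)

/-- The nested sets `S 0 ⊂ S 1 ⊂ ⋯ ⊂ S l` form a segmentation of `G` relative to `(X, Y)`. -/
structure IsSegmentation {α β : Type*} (G : Graph α β) (X Y : Set α) (l : ℕ) (S : ℕ → Set α) :
    Prop where
  left_subset : X ⊆ V(G)
  right_subset : Y ⊆ V(G)
  disjoint : Disjoint X Y
  subset_vertexSet : ∀ i ≤ l, S i ⊆ V(G)
  first_eq : S 0 = X
  compl_last_eq : V(G) \ S l = Y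
  ssubset : ∀ i < l, S i ⊂ S (i + 1)
  ncard_sdiff : ∀ i < l, (S (i + 1) \ S i).ncard = 1

/-- `G` has a segmentation of width `w` relative to `(X, Y)`. -/
def HasSegmentation {α β : Type*} (G : Graph α β) (w : ℕ) (X Y : Set α) : Prop :=
  ∃ (l : ℕ) (S : ℕ → Set α), G.IsSegmentation X Y l S ∧ ∀ i ≤ l, G.cutSize (S i) = w

end Graph

/-! Exclusion. Splitting and deleting never enlarge a cut, and in `K₄` a set containing `k` of the
four branch vertices has `k * (4 - k)` leaving edges. So a cut of size three never separates the
branch vertices two and two. Along a segmentation the number of branch vertices inside starts at no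
more than one (this uses the condition on the roots), grows by at most one per step and cannot be
two, yet at the other end all but at most one branch vertex must be inside. In a doubled cycle, two
arcs `P`, `Q`, each cutting the branch vertices two and two, must keep all four of their leaving
edges; then the parity of `d (P \ Q)` is invariant. It is even at the start, but `K₄` requires
three.

Existence. Graphs are replaced by multisets of unordered pairs, and `out_of_ec` shows by induction
on the number of edges plus vertices that a rooted `K₄`, a doubled cycle or a segmentation exists.
Given a non-trivial cut of size three, one side is contracted to a vertex. By `reach_con` this can
be done by splitting and deleting, and a segmentation of the contracted graph is expanded again
(`exists_half_chain`). If the cut separates the roots, both sides are treated in this way and the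
two chains are glued.

Otherwise all non-trivial cuts have at least four edges. Four vertices are handled by a case
analysis on multiplicities (`K4set_or_Dbl_of_card_four`). For at least five vertices a minimal
counterexample `Ctx` is refuted. Contractions give `Ctx.d_lt`: a vertex has smaller degree than the
boundary of any set around it that has at least two vertices, misses at least three and contains no
other root. Deleting an edge between vertices of large degree (`Ctx.of_high_edge`) and suppressing a
cubic vertex next to a vertex of large degree (`Ctx.of_cubic`) show that all vertices except the
roots are cubic. Finally two adjacent cubic vertices that are not roots are suppressed together. The
sets of the resulting segmentation contain both roots or neither, and the end sets contain none; but
a chain gains one vertex at a time, a contradiction (`Ctx.false`). -/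

noncomputable section

namespace EdgeMultiset

open scoped Classical

variable {α : Type*} {M N R : Multiset (Sym2 α)} {X Y S V : Finset α} {x y z a b s : α}

/-! ### Weights of multisets of edges -/

/-- The total weight of the edges of `M`. -/
def wt (M : Multiset (Sym2 α)) (φ : Sym2 α → ℕ) : ℕ := (M.map φ).sum

@[simp] lemma wt_cons (e : Sym2 α) (M : Multiset (Sym2 α)) (φ : Sym2 α → ℕ) :
    wt (e ::ₘ M) φ = φ e + wt M φ := by simp [wt]

@[simp] lemma wt_singleton (e : Sym2 α) (φ : Sym2 α → ℕ) : wt {e} φ = φ e := by simp [wt]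

@[simp] lemma wt_zero (φ : Sym2 α → ℕ) : wt 0 φ = 0 := by simp [wt]

lemma wt_add_left (M N : Multiset (Sym2 α)) (φ : Sym2 α → ℕ) :
    wt (M + N) φ = wt M φ + wt N φ := by simp [wt]

lemma wt_add (M : Multiset (Sym2 α)) (φ ψ : Sym2 α → ℕ) :
    wt M (fun e => φ e + ψ e) = wt M φ + wt M ψ := by simp [wt]

lemma wt_mul (M : Multiset (Sym2 α)) (k : ℕ) (φ : Sym2 α → ℕ) :
    wt M (fun e => k * φ e) = k * wt M φ := by simp [wt, Multiset.sum_map_mul_left]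

lemma wt_congr {φ ψ : Sym2 α → ℕ} (h : ∀ e ∈ M, φ e = ψ e) : wt M φ = wt M ψ := by
  simp only [wt]; rw [Multiset.map_congr rfl h]

lemma wt_le {φ ψ : Sym2 α → ℕ} (h : ∀ e ∈ M, φ e ≤ ψ e) : wt M φ ≤ wt M ψ :=
  Multiset.sum_map_le_sum_map _ _ h

lemma wt_map (M : Multiset (Sym2 α)) (f : Sym2 α → Sym2 α) (φ : Sym2 α → ℕ) :
    wt (M.map f) φ = wt M (fun e => φ (f e)) := by simp [wt]

lemma wt_eq_zero_iff {φ : Sym2 α → ℕ} : wt M φ = 0 ↔ ∀ e ∈ M, φ e = 0 := by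
  simp [wt, Multiset.sum_eq_zero_iff]

lemma wt_mono (h : M ≤ N) (φ : Sym2 α → ℕ) : wt M φ ≤ wt N φ := by
  obtain ⟨R, rfl⟩ := Multiset.le_iff_exists_add.1 h
  rw [wt_add_left]; omega

/-- The non-loop edges of `M`. -/
def nl (M : Multiset (Sym2 α)) : Multiset (Sym2 α) := M.filter (fun e => ¬ e.IsDiag)

lemma wt_nl {φ : Sym2 α → ℕ} (h : ∀ x, φ s(x, x) = 0) : wt (nl M) φ = wt M φ := by
  induction M using Multiset.induction with
  | empty => simp [nl]
  | cons e M ih =>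
    rw [wt_cons, ← ih, nl, nl, Multiset.filter_cons, wt_add_left]
    induction e with | _ p q
    by_cases hpq : p = q
    · subst hpq; simp [h]
    · simp [hpq]

/-- The indicator of the edges having exactly one end in `X`. -/
def cr (X : Finset α) (e : Sym2 α) : ℕ := if (∃ x ∈ e, x ∈ X) ∧ ∃ y ∈ e, y ∉ X then 1 else 0

@[simp] lemma cr_mk (X : Finset α) (x y : α) :
    cr X s(x, y) = if x ∈ X ↔ y ∈ X then 0 else 1 := by
  unfold cr
  by_cases hx : x ∈ X <;> by_cases hy : y ∈ X <;> simp [hx, hy]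

/-- The indicator of the edges joining the disjoint sets `A` and `B`. -/
def bt (A B : Finset α) (e : Sym2 α) : ℕ :=
  if ∃ x y, e = s(x, y) ∧ x ∈ A ∧ y ∈ B then 1 else 0

@[simp] lemma bt_mk (A B : Finset α) (x y : α) :
    bt A B s(x, y) = if (x ∈ A ∧ y ∈ B) ∨ (y ∈ A ∧ x ∈ B) then 1 else 0 := by
  unfold bt; congr 1; simp only [Sym2.eq_iff, eq_iff_iff]; grind

/-- The number of edges leaving `X`. -/
def d (M : Multiset (Sym2 α)) (X : Finset α) : ℕ := wt M (cr X)

/-- The number of edges between `A` and `B`. -/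
def btw (M : Multiset (Sym2 α)) (A B : Finset α) : ℕ := wt M (bt A B)

/-- The number of edges with ends `x` and `y`. -/
def mu (M : Multiset (Sym2 α)) (x y : α) : ℕ := wt M (fun e => if e = s(x, y) then 1 else 0)

lemma mu_comm (M : Multiset (Sym2 α)) (x y : α) : mu M x y = mu M y x := by
  simp [mu, Sym2.eq_swap]

lemma mu_eq_count (M : Multiset (Sym2 α)) (x y : α) : mu M x y = M.count s(x, y) := by
  induction M using Multiset.induction with
  | empty => simp [mu]
  | cons e M ih =>
    rw [Multiset.count_cons, ← ih, mu, mu, wt_cons]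
    simp [eq_comm, add_comm]

lemma mu_pos_iff : 0 < mu M x y ↔ s(x, y) ∈ M := by
  rw [mu_eq_count, Multiset.count_pos]

@[simp] lemma d_cons (e : Sym2 α) : d (e ::ₘ M) X = cr X e + d M X := by simp [d]
@[simp] lemma mu_cons (e : Sym2 α) :
    mu (e ::ₘ M) x y = (if e = s(x, y) then 1 else 0) + mu M x y := by simp [mu]

lemma d_mono (h : M ≤ N) (X : Finset α) : d M X ≤ d N X := wt_mono h _

lemma d_nl : d (nl M) X = d M X := wt_nl (by simp)

lemma d_union (h : Disjoint X Y) : d M (X ∪ Y) + 2 * btw M X Y = d M X + d M Y := by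
  unfold d btw
  rw [← wt_mul, ← wt_add, ← wt_add]
  refine wt_congr fun e _ => ?_
  induction e with | _ p q
  rw [Finset.disjoint_left] at h
  simp only [cr_mk, bt_mk, Finset.mem_union]
  have hp := @h p; have hq := @h q
  grind

lemma d_insert (h : x ∉ X) : d M (insert x X) + 2 * btw M {x} X = d M {x} + d M X := by
  rw [← d_union (by simpa using h)]; rfl

lemma btw_singleton (h : x ≠ y) : btw M {x} {y} = mu M x y := by
  refine wt_congr fun e _ => ?_
  induction e with | _ p q
  simp only [bt_mk, Finset.mem_singleton, Sym2.eq_iff]; grind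

lemma d_pair (h : x ≠ y) : d M {x, y} + 2 * mu M x y = d M {x} + d M {y} := by
  rw [← btw_singleton h]; exact d_insert (by simpa using h)

lemma btw_union_right (h : Disjoint X Y) (A : Finset α) (hX : Disjoint A X)
    (hY : Disjoint A Y) :
    btw M A (X ∪ Y) = btw M A X + btw M A Y := by
  unfold btw
  rw [← wt_add]
  refine wt_congr fun e _ => ?_
  induction e with | _ p q
  rw [Finset.disjoint_left] at h hX hY
  simp only [bt_mk, Finset.mem_union]
  have hp := @h p; have hq := @h q
  have hp := @hX p; have hq := @hX q
  have hp := @hY p; have hq := @hY q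
  grind

/-- The non-loop edges of `M` have their ends in `V`. -/
def Sup (M : Multiset (Sym2 α)) (V : Finset α) : Prop :=
  ∀ x y, s(x, y) ∈ M → x ≠ y → x ∈ V ∧ y ∈ V

lemma Sup.mono (h : Sup M V) (hN : N ≤ M) : Sup N V :=
  fun x y hxy => h x y (Multiset.mem_of_le hN hxy)

lemma Sup.d_compl (h : Sup M V) (X : Finset α) : d M (V \ X) = d M X := by
  refine wt_congr fun e he => ?_
  induction e with | _ p q
  simp only [cr_mk, Finset.mem_sdiff]
  by_cases hpq : p = q
  · subst hpq; simp
  · have := h p q he hpq; grind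

lemma Sup.d_self (h : Sup M V) : d M V = 0 := by
  rw [← h.d_compl, Finset.sdiff_self, d, wt_eq_zero_iff]
  intro e _
  induction e with | _ p q
  simp

lemma Sup.btw_compl (h : Sup M V) (X : Finset α) : btw M X (V \ X) = d M X := by
  refine wt_congr fun e he => ?_
  induction e with | _ p q
  simp only [cr_mk, bt_mk, Finset.mem_sdiff]
  by_cases hpq : p = q
  · subst hpq; grind
  · have := h p q he hpq; grind

lemma mu_add_mu_add_mu_le {w : α} (hxy : x ≠ y) (hxz : x ≠ z) (hxw : x ≠ w)
    (hyz : y ≠ z) (hyw : y ≠ w) (hzw : z ≠ w) :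
    mu M x y + mu M x z + mu M x w ≤ d M {x} := by
  unfold mu d
  rw [← wt_add, ← wt_add]
  refine wt_le fun e _ => ?_
  induction e with | _ p q
  simp only [cr_mk, Finset.mem_singleton, Sym2.eq_iff]
  grind

lemma mu_add_mu_le (hxy : x ≠ y) (hxz : x ≠ z) (hyz : y ≠ z) :
    mu M x y + mu M x z ≤ d M {x} := by
  unfold mu d
  rw [← wt_add]
  refine wt_le fun e _ => ?_
  induction e with | _ p q
  simp only [cr_mk, Finset.mem_singleton, Sym2.eq_iff]
  grind

/-! ### Splitting and deleting -/

/-- One step: deleting edges (loops may come and go freely), or splitting off a pair of edges. -/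
inductive Step : Multiset (Sym2 α) → Multiset (Sym2 α) → Prop
  | del {M M' : Multiset (Sym2 α)} : nl M' ≤ nl M → Step M M'
  -- No distinctness is required: up to loops, a degenerate split is a deletion.
  | split (R : Multiset (Sym2 α)) (x y z : α) :
      Step (s(x, y) ::ₘ s(y, z) ::ₘ R) (s(x, z) ::ₘ R)

/-- Reachability by a sequence of steps. -/
def Reach : Multiset (Sym2 α) → Multiset (Sym2 α) → Prop := Relation.ReflTransGen Step

lemma Reach.refl (M : Multiset (Sym2 α)) : Reach M M := Relation.ReflTransGen.refl

lemma Reach.trans (h : Reach M N) (h' : Reach N R) : Reach M R := Relation.ReflTransGen.trans h h'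

lemma Reach.of_nl_le (h : nl N ≤ nl M) : Reach M N := Relation.ReflTransGen.single (.del h)

lemma Reach.of_le (h : N ≤ M) : Reach M N := .of_nl_le (Multiset.filter_le_filter _ h)

lemma Reach.split (R : Multiset (Sym2 α)) (x y z : α) :
    Reach (s(x, y) ::ₘ s(y, z) ::ₘ R) (s(x, z) ::ₘ R) := Relation.ReflTransGen.single (.split R x y z)

/-- `M` has an immersion of `K₄` with the four elements of `T` as branch vertices. -/
def K4set (M : Multiset (Sym2 α)) (T : Finset α) : Prop :=
  T.card = 4 ∧ ∃ M', Reach M M' ∧ ∀ x ∈ T, ∀ y ∈ T, x ≠ y → s(x, y) ∈ M'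

/-- `M` has an immersion of `K₄` with `a` and `b` among the branch vertices. -/
def K4r (M : Multiset (Sym2 α)) (a b : α) : Prop := ∃ T, a ∈ T ∧ b ∈ T ∧ K4set M T

lemma K4set.of_reach (h : Reach M N) {T : Finset α} (hT : K4set N T) : K4set M T := by
  obtain ⟨h4, M', h1, h2⟩ := hT
  exact ⟨h4, M', h.trans h1, h2⟩

lemma K4r.of_reach (h : Reach M N) (hN : K4r N a b) : K4r M a b := by
  obtain ⟨T, ha, hb, hT⟩ := hN
  exact ⟨T, ha, hb, hT.of_reach h⟩

end EdgeMultiset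

end

noncomputable section

namespace EdgeMultiset

open scoped Classical

variable {α : Type*} {M N R : Multiset (Sym2 α)} {X Y S V : Finset α} {x y z a b s : α}

/-! ### Contraction -/

lemma nl_cons (e : Sym2 α) : nl (e ::ₘ M) = if e.IsDiag then nl M else e ::ₘ nl M := by
  unfold nl; split_ifs with h <;> simp [h]

lemma nl_map_eq {g : Sym2 α → Sym2 α} (h : ∀ e ∈ M, ¬ e.IsDiag → g e = e)
    (h' : ∀ e ∈ M, e.IsDiag → (g e).IsDiag) : nl (M.map g) = nl M := by
  induction M using Multiset.induction with
  | empty => simp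
  | cons e M ih =>
    have ih := ih (fun e he => h e (Multiset.mem_cons_of_mem he))
      (fun e he => h' e (Multiset.mem_cons_of_mem he))
    rw [Multiset.map_cons, nl_cons, nl_cons, ih]
    by_cases he : e.IsDiag
    · simp [he, h' e (Multiset.mem_cons_self e M) he]
    · simp [he, h e (Multiset.mem_cons_self e M) he]

/-- The map identifying all elements of `S` with `s`. -/
def conMap (S : Finset α) (s x : α) : α := if x ∈ S then s else x

/-- Contracting `S` to the vertex `s`. -/
def con (S : Finset α) (s : α) (M : Multiset (Sym2 α)) : Multiset (Sym2 α) :=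
  M.map (Sym2.map (conMap S s))

lemma con_cons (e : Sym2 α) : con S s (e ::ₘ M) = Sym2.map (conMap S s) e ::ₘ con S s M := by
  simp [con]

lemma d_con_of_mem (h : s ∈ X) : d (con S s M) X = d M (X ∪ S) := by
  unfold d con
  rw [wt_map]
  refine wt_congr fun e _ => ?_
  induction e with | _ p q
  simp only [Sym2.map_mk, cr_mk, conMap, Finset.mem_union]
  grind

lemma d_con_of_notMem (h : s ∉ X) : d (con S s M) X = d M (X \ S) := by
  unfold d con
  rw [wt_map]
  refine wt_congr fun e _ => ?_
  induction e with | _ p q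
  simp only [Sym2.map_mk, cr_mk, conMap, Finset.mem_sdiff]
  grind

lemma mu_con_of_notMem (hx : x ∉ S) (hy : y ∉ S) (hs : s ∈ S) :
    mu (con S s M) x y = mu M x y := by
  unfold mu con
  rw [wt_map]
  refine wt_congr fun e _ => ?_
  induction e with | _ p q
  simp only [Sym2.map_mk, conMap, Sym2.eq_iff]
  grind

lemma mu_con_pair (hxy : x ≠ y) (hzx : z ≠ x) (hzy : z ≠ y) :
    mu (con {x, y} y M) z y = mu M z x + mu M z y := by
  unfold mu con
  rw [wt_map, ← wt_add]
  refine wt_congr fun e _ => ?_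
  induction e with | _ p q
  simp only [Sym2.map_mk, conMap, Sym2.eq_iff, Finset.mem_insert, Finset.mem_singleton]
  grind

lemma Sup.con (h : Sup M V) : Sup (con S s M) (insert s (V \ S)) := by
  intro x y hxy hne
  obtain ⟨e, he, heq⟩ := Multiset.mem_map.1 hxy
  induction e with | _ p q
  have hpq : p ≠ q := by rintro rfl; simp only [Sym2.map_mk, Sym2.eq_iff] at heq; grind
  have := h p q he hpq
  simp only [Sym2.map_mk, conMap, Sym2.eq_iff] at heq
  simp only [Finset.mem_insert, Finset.mem_sdiff]
  grind

lemma con_con (hY : Y ⊆ S) : con (insert s (S \ Y)) s (con Y s M) = con S s M := by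
  unfold con
  rw [Multiset.map_map]
  refine Multiset.map_congr rfl fun e _ => ?_
  induction e with | _ p q
  have key : ∀ x, conMap (insert s (S \ Y)) s (conMap Y s x) = conMap S s x := by
    intro x
    have := @hY x
    simp only [conMap, Finset.mem_insert, Finset.mem_sdiff]
    grind
  simp [key]

lemma exists_cons_cons {e f : Sym2 α} (he : e ∈ M) (hf : f ∈ M) (hne : e ≠ f) :
    ∃ R, M = e ::ₘ f ::ₘ R := by
  obtain ⟨R, rfl⟩ := Multiset.exists_cons_of_mem he
  obtain ⟨R, rfl⟩ := Multiset.exists_cons_of_mem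
    ((Multiset.mem_cons.1 hf).resolve_left (Ne.symm hne))
  exact ⟨R, rfl⟩

lemma exists_edge_of_mu_lt (hxy : x ≠ y) (h : mu M x y < d M {x}) :
    ∃ z, z ≠ x ∧ z ≠ y ∧ s(x, z) ∈ M := by
  by_contra hcon
  push Not at hcon
  refine absurd h (not_lt.2 (wt_le fun e he => ?_))
  induction e with | _ p q
  simp only [cr_mk, Finset.mem_singleton, Sym2.eq_iff]
  have h1 := hcon p
  have h2 := hcon q
  by_cases hp : p = x
  · subst hp; grind
  · by_cases hq : q = x
    · subst hq; rw [Sym2.eq_swap] at he; grind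
    · grind

/-- A set `S` containing `s` all of whose subsets containing `s` have at least as many leaving edges
can be contracted to `s` by splitting and deleting. -/
theorem reach_con (hs : s ∈ S) (hmin : ∀ Y ⊆ S, s ∈ Y → d M S ≤ d M Y) :
    Reach M (con S s M) := by
  induction hn : M.card + S.card using Nat.strong_induction_on generalizing M S with
  | _ n ih
  subst hn
  -- Call a subset containing `s` tight if it has as few leaving edges as `S`. A tight set strictly
  -- between `{s}` and `S` is contracted before the rest of `S`.
  by_cases h1 : ∃ Y ⊆ S, s ∈ Y ∧ Y ≠ S ∧ 2 ≤ Y.card ∧ d M Y = d M S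
  · obtain ⟨Y, hYS, hsY, hne, hY2, hdY⟩ := h1
    have hlt : Y.card < S.card := Finset.card_lt_card (hYS.ssubset_of_ne hne)
    have r1 : Reach M (con Y s M) := by
      refine ih _ (by omega) hsY (fun Z hZ hsZ => ?_) rfl
      rw [hdY]; exact hmin Z (hZ.trans hYS) hsZ
    rw [← con_con hYS]
    refine r1.trans (ih _ ?_ (by simp) (fun Z hZ hsZ => ?_) rfl)
    · have := Finset.card_insert_le s (S \ Y)
      have := Finset.card_sdiff_add_card_eq_card hYS
      simp only [con, Multiset.card_map]
      omega
    · rw [d_con_of_mem hsZ, d_con_of_mem (by simp)]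
      have e1 : insert s (S \ Y) ∪ Y = S := by
        ext x; have := @hYS x; simp only [Finset.mem_union, Finset.mem_insert, Finset.mem_sdiff]; grind
      rw [e1]
      refine hmin _ (fun x hx => ?_) (by simp [hsZ])
      have h2 := @hZ x; have := @hYS x
      simp only [Finset.mem_union, Finset.mem_insert, Finset.mem_sdiff] at hx h2; grind
  have h1' : ∀ Y ⊆ S, s ∈ Y → Y ≠ S → Y ≠ {s} → d M S < d M Y := by
    intro Y hY hsY hne hne'
    refine lt_of_le_of_ne (hmin Y hY hsY) fun heq => h1 ⟨Y, hY, hsY, hne, ?_, heq.symm⟩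
    have hpos : 0 < Y.card := Finset.card_pos.2 ⟨s, hsY⟩
    by_contra h
    obtain ⟨t, rfl⟩ := Finset.card_eq_one.1 (by omega : Y.card = 1)
    simp only [Finset.mem_singleton] at hsY
    exact hne' (by rw [hsY])
  -- An edge inside `S` that crosses no tight set can be deleted without violating the hypothesis on
  -- `S`.
  by_cases h2 : ∃ x ∈ S, ∃ y ∈ S, x ≠ y ∧ s(x, y) ∈ M ∧
      ∀ Y ⊆ S, s ∈ Y → cr Y s(x, y) = 1 → d M S < d M Y
  · obtain ⟨x, hx, y, hy, hxy, he, hdel⟩ := h2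
    obtain ⟨R, rfl⟩ := Multiset.exists_cons_of_mem he
    have r1 : Reach (s(x, y) ::ₘ R) R := Reach.of_le (Multiset.le_cons_self _ _)
    have r2 : Reach R (con S s R) := by
      refine ih _ (by simp) hs (fun Y hY hsY => ?_) rfl
      have h3 := hmin Y hY hsY
      have h4 := hdel Y hY hsY
      have h5 : cr S s(x, y) = 0 := by simp [hx, hy]
      have h6 : cr Y s(x, y) = 0 ∨ cr Y s(x, y) = 1 := by rw [cr_mk]; split_ifs <;> simp
      rw [d_cons, d_cons] at h3 h4
      omega
    refine r1.trans (r2.trans (Reach.of_nl_le ?_))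
    rw [con_cons, nl_cons, if_pos (by simp [conMap, hx, hy])]
  -- Only `{s}` and `S` can be tight now, so an undeletable edge inside `S` ends at `s`, and `{s}`
  -- is tight.
  have h2' : ∀ x ∈ S, x ≠ s → ∀ y ∈ S, x ≠ y → s(x, y) ∈ M → y = s ∧ d M {s} ≤ d M S := by
    intro x hx hxs y hy hxy he
    by_contra hcon
    refine h2 ⟨x, hx, y, hy, hxy, he, fun Y hY hsY hcr => ?_⟩
    by_cases hYs : Y = {s}
    · subst hYs
      have : y = s := by simp only [cr_mk, Finset.mem_singleton] at hcr; grind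
      subst this
      exact not_le.1 fun h => hcon ⟨rfl, h⟩
    · refine h1' Y hY hsY ?_ hYs
      rintro rfl
      simp [hx, hy] at hcr
  by_cases h3 : ∃ x ∈ S, x ≠ s ∧ s(x, s) ∈ M
  -- Since `{s, x}` has at least as many leaving edges as `{s}`, at most half of the edges at `x` go
  -- to `s`. Another edge at `x` leaves `S`, and the two can be split off at `x`.
  · obtain ⟨x, hx, hxs, he⟩ := h3
    have hds := (h2' x hx hxs s hs hxs he).2
    have hpair := hmin {x, s} (by intro t; simp only [Finset.mem_insert, Finset.mem_singleton]; grind)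
      (by simp)
    have hp := d_pair (M := M) hxs
    have hmu : 0 < mu M x s := mu_pos_iff.2 he
    obtain ⟨w, hwx, hws, hw⟩ := exists_edge_of_mu_lt (M := M) hxs (by omega)
    have hwS : w ∉ S := fun hwS => hws (h2' x hx hxs w hwS hwx.symm hw).1
    obtain ⟨R, rfl⟩ := exists_cons_cons he hw (by simp only [ne_eq, Sym2.eq_iff]; grind)
    rw [Sym2.eq_swap]
    have r1 := Reach.split R s x w
    have r2 : Reach (s(s, w) ::ₘ R) (con S s (s(s, w) ::ₘ R)) := by
      refine ih _ (by simp) hs (fun Y hY hsY => ?_) rfl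
      have h3 := hmin Y hY hsY
      have hwY : w ∉ Y := fun h => hwS (hY h)
      simp only [d_cons, cr_mk] at h3 ⊢
      simp only [hx, hs, hwS, hsY, hwY] at h3 ⊢
      by_cases hxY : x ∈ Y <;> simp [hxY] at h3 ⊢ <;> omega
    refine r1.trans (r2.trans (Reach.of_nl_le ?_))
    simp only [con_cons, Sym2.map_mk, conMap, hs, hx, hwS, if_true, if_false]
    rw [nl_cons, if_pos (by simp)]
  -- No edge is left inside `S`. Every edge at `s` leaves `S`, and `S` has no more leaving edges
  -- than `{s}`, so the other vertices of `S` are isolated and contraction changes only loops.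
  · push Not at h3
    have hin : ∀ x ∈ S, ∀ y ∈ S, x ≠ y → s(x, y) ∉ M := by
      intro x hx y hy hxy he
      by_cases hxs : x = s
      · subst hxs; exact h3 y hy (Ne.symm hxy) (by rwa [Sym2.eq_swap])
      · have := (h2' x hx hxs y hy hxy he).1
        subst this; exact h3 x hx hxs he
    have hle : ∀ e ∈ M, cr {s} e ≤ cr S e := by
      intro e he
      induction e with | _ p q
      have h5 := hin p; have h6 := hin q
      rw [Sym2.eq_swap] at he
      have h7 := hin q
      simp only [cr_mk, Finset.mem_singleton]
      grind [Sym2.eq_swap]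
    have heq : wt M (fun e => cr S e - cr {s} e) = 0 := by
      have h4 := hmin {s} (by simpa using hs) (by simp)
      have h5 : wt M (fun e => (cr S e - cr {s} e) + cr {s} e) = d M S :=
        wt_congr fun e he => by have := hle e he; omega
      rw [wt_add] at h5
      unfold d at h4 h5
      omega
    rw [wt_eq_zero_iff] at heq
    refine Reach.of_nl_le (le_of_eq (nl_map_eq (fun e he hd => ?_) (fun e he hd => ?_)))
    · induction e with | _ p q
      have h5 := heq _ he
      have h6 : p ∈ S → q ∈ S → False := fun hp hq => hin p hp q hq (by simpa using hd) he
      simp only [cr_mk, Finset.mem_singleton] at h5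
      simp only [Sym2.map_mk, conMap]
      grind
    · induction e with | _ p q
      simp only [Sym2.mk_isDiag_iff] at hd
      simp [hd]

end EdgeMultiset

end

noncomputable section

namespace EdgeMultiset

open scoped Classical

variable {α : Type*} {M N R : Multiset (Sym2 α)} {X Y S V : Finset α} {x y z w a b s : α}

/-! ### Four vertices -/

/-- Bookkeeping for a split at `v k`, stated without subtraction so that each later construction of
`K₄` reduces to linear arithmetic in six multiplicities. -/
lemma exists_split {v : Fin 4 → α} (hv : Function.Injective v) (i j k : Fin 4) (hij : i ≠ j)
    (h1 : 1 ≤ mu M (v i) (v k)) (h2 : 1 ≤ mu M (v k) (v j)) :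
    ∃ M', Reach M M' ∧ ∀ p q, mu M' (v p) (v q) + (if s(i, k) = s(p, q) then 1 else 0) +
      (if s(k, j) = s(p, q) then 1 else 0) =
      mu M (v p) (v q) + (if s(i, j) = s(p, q) then 1 else 0) := by
  have hne : s(v i, v k) ≠ s(v k, v j) := by
    have := hv.eq_iff (a := i) (b := j)
    simp only [ne_eq, Sym2.eq_iff]; grind
  obtain ⟨R, rfl⟩ := exists_cons_cons (mu_pos_iff.1 h1) (mu_pos_iff.1 h2) hne
  refine ⟨_, Reach.split R _ _ _, fun p q => ?_⟩
  have key : ∀ a b : Fin 4, (s(v a, v b) = s(v p, v q)) = (s(a, b) = s(p, q)) := by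
    intro a b; simp only [Sym2.eq_iff, hv.eq_iff]
  simp only [mu_cons, key]
  omega

lemma K4set_of_mem {v : Fin 4 → α} (hv : Function.Injective v) (h01 : 1 ≤ mu M (v 0) (v 1))
    (h02 : 1 ≤ mu M (v 0) (v 2)) (h03 : 1 ≤ mu M (v 0) (v 3)) (h12 : 1 ≤ mu M (v 1) (v 2))
    (h13 : 1 ≤ mu M (v 1) (v 3)) (h23 : 1 ≤ mu M (v 2) (v 3)) :
    K4set M (Finset.univ.image v) := by
  refine ⟨by rw [Finset.card_image_of_injective _ hv]; simp, M, .refl M, ?_⟩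
  simp only [Finset.mem_image, Finset.mem_univ, true_and]
  rintro _ ⟨i, rfl⟩ _ ⟨j, rfl⟩ hij
  rw [← mu_pos_iff]
  have hij : i ≠ j := fun h => hij (by rw [h])
  fin_cases i <;> fin_cases j <;> first | exact absurd rfl hij | assumption | (rw [mu_comm]; assumption)

lemma K4set_of_mu (h : [x, y, z, w].Nodup)
    (H : ∀ v : Fin 4 → α, Function.Injective v → v 0 = x → v 1 = y → v 2 = z → v 3 = w →
      K4set M (Finset.univ.image v)) : K4set M {x, y, z, w} := by
  have h1 := H ![x, y, z, w] ?_ rfl rfl rfl rfl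
  · convert h1
    ext t
    simp [Fin.exists_fin_succ, eq_comm]
  · intro i j hij
    simp at h
    fin_cases i <;> fin_cases j <;> simp at hij ⊢ <;> grind

/-- This and the next six lemmas treat the supports in which `x` and `y`, or another pair, need not
be adjacent; the names describe the support. Every missing pair is produced by splitting off a path
through spare parallel edges, a path of length three taking two splits. -/
lemma K4set_of_cycle_chord (h : [x, y, z, w].Nodup) (hxz : 2 ≤ mu M x z) (hyz : 2 ≤ mu M y z) (hxw : 1 ≤ mu M x w) (hyw : 1 ≤ mu M y w) (hzw : 1 ≤ mu M z w) :
    K4set M {x, y, z, w} := by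
  refine K4set_of_mu h ?_
  rintro v hv rfl rfl rfl rfl
  have hc := fun (N : Multiset (Sym2 α)) (p q : Fin 4) => mu_comm N (v p) (v q)
  have b1 := hc M 0 2; have b2 := hc M 2 1
  obtain ⟨M1, r1, h1⟩ := exists_split (M := M) hv 0 1 2 (by decide) (by omega) (by omega)
  have a1 := h1 0 1; have a2 := h1 0 2; have a3 := h1 0 3
  have a4 := h1 1 2; have a5 := h1 1 3; have a6 := h1 2 3
  simp at a1 a2 a3 a4 a5 a6
  clear h1
  exact .of_reach r1 (K4set_of_mem hv (by omega) (by omega) (by omega) (by omega) (by omega)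
    (by omega))

lemma K4set_of_cycle_zigzag (h : [x, y, z, w].Nodup) (hxz : 2 ≤ mu M x z) (hzw : 2 ≤ mu M z w) (hyw : 2 ≤ mu M y w) (hxw : 1 ≤ mu M x w) (hyz : 1 ≤ mu M y z) :
    K4set M {x, y, z, w} := by
  refine K4set_of_mu h ?_
  rintro v hv rfl rfl rfl rfl
  have hc := fun (N : Multiset (Sym2 α)) (p q : Fin 4) => mu_comm N (v p) (v q)
  have b1 := hc M 0 2; have b2 := hc M 2 3
  obtain ⟨M1, r1, h1⟩ := exists_split (M := M) hv 0 3 2 (by decide) (by omega) (by omega)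
  have a1 := h1 0 1; have a2 := h1 0 2; have a3 := h1 0 3
  have a4 := h1 1 2; have a5 := h1 1 3; have a6 := h1 2 3
  simp at a1 a2 a3 a4 a5 a6
  clear h1
  have b1 := hc M1 0 3; have b2 := hc M1 3 1
  obtain ⟨M2, r2, h2⟩ := exists_split (M := M1) hv 0 1 3 (by decide) (by omega) (by omega)
  have a1 := h2 0 1; have a2 := h2 0 2; have a3 := h2 0 3
  have a4 := h2 1 2; have a5 := h2 1 3; have a6 := h2 2 3
  simp at a1 a2 a3 a4 a5 a6
  clear h2
  exact .of_reach (r1.trans r2) (K4set_of_mem hv (by omega) (by omega) (by omega) (by omega) (by omega)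
    (by omega))

lemma K4set_of_cycle (h : [x, y, z, w].Nodup) (hxz : 3 ≤ mu M x z) (hyz : 2 ≤ mu M y z) (hxw : 2 ≤ mu M x w) (hyw : 1 ≤ mu M y w) :
    K4set M {x, y, z, w} := by
  refine K4set_of_mu h ?_
  rintro v hv rfl rfl rfl rfl
  have hc := fun (N : Multiset (Sym2 α)) (p q : Fin 4) => mu_comm N (v p) (v q)
  have b1 := hc M 0 2; have b2 := hc M 2 1
  obtain ⟨M1, r1, h1⟩ := exists_split (M := M) hv 0 1 2 (by decide) (by omega) (by omega)
  have a1 := h1 0 1; have a2 := h1 0 2; have a3 := h1 0 3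
  have a4 := h1 1 2; have a5 := h1 1 3; have a6 := h1 2 3
  simp at a1 a2 a3 a4 a5 a6
  clear h1
  have b1 := hc M1 2 0; have b2 := hc M1 0 3
  obtain ⟨M2, r2, h2⟩ := exists_split (M := M1) hv 2 3 0 (by decide) (by omega) (by omega)
  have a1 := h2 0 1; have a2 := h2 0 2; have a3 := h2 0 3
  have a4 := h2 1 2; have a5 := h2 1 3; have a6 := h2 2 3
  simp at a1 a2 a3 a4 a5 a6
  clear h2
  exact .of_reach (r1.trans r2) (K4set_of_mem hv (by omega) (by omega) (by omega) (by omega) (by omega)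
    (by omega))

lemma K4set_of_path (h : [x, y, z, w].Nodup) (hxy : 3 ≤ mu M x y) (hyz : 4 ≤ mu M y z) (hzw : 3 ≤ mu M z w) :
    K4set M {x, y, z, w} := by
  refine K4set_of_mu h ?_
  rintro v hv rfl rfl rfl rfl
  have hc := fun (N : Multiset (Sym2 α)) (p q : Fin 4) => mu_comm N (v p) (v q)
  have b1 := hc M 0 1; have b2 := hc M 1 2
  obtain ⟨M1, r1, h1⟩ := exists_split (M := M) hv 0 2 1 (by decide) (by omega) (by omega)
  have a1 := h1 0 1; have a2 := h1 0 2; have a3 := h1 0 3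
  have a4 := h1 1 2; have a5 := h1 1 3; have a6 := h1 2 3
  simp at a1 a2 a3 a4 a5 a6
  clear h1
  have b1 := hc M1 0 1; have b2 := hc M1 1 2
  obtain ⟨M2, r2, h2⟩ := exists_split (M := M1) hv 0 2 1 (by decide) (by omega) (by omega)
  have a1 := h2 0 1; have a2 := h2 0 2; have a3 := h2 0 3
  have a4 := h2 1 2; have a5 := h2 1 3; have a6 := h2 2 3
  simp at a1 a2 a3 a4 a5 a6
  clear h2
  have b1 := hc M2 0 2; have b2 := hc M2 2 3
  obtain ⟨M3, r3, h3⟩ := exists_split (M := M2) hv 0 3 2 (by decide) (by omega) (by omega)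
  have a1 := h3 0 1; have a2 := h3 0 2; have a3 := h3 0 3
  have a4 := h3 1 2; have a5 := h3 1 3; have a6 := h3 2 3
  simp at a1 a2 a3 a4 a5 a6
  clear h3
  have b1 := hc M3 1 2; have b2 := hc M3 2 3
  obtain ⟨M4, r4, h4⟩ := exists_split (M := M3) hv 1 3 2 (by decide) (by omega) (by omega)
  have a1 := h4 0 1; have a2 := h4 0 2; have a3 := h4 0 3
  have a4 := h4 1 2; have a5 := h4 1 3; have a6 := h4 2 3
  simp at a1 a2 a3 a4 a5 a6
  clear h4
  exact .of_reach (((r1.trans r2).trans r3).trans r4) (K4set_of_mem hv (by omega) (by omega) (by omega) (by omega) (by omega)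
    (by omega))

lemma K4set_of_pendant (h : [x, y, z, w].Nodup) (hxw : 3 ≤ mu M x w) (hyw : 2 ≤ mu M y w) (hzw : 2 ≤ mu M z w) (hyz : 1 ≤ mu M y z) :
    K4set M {x, y, z, w} := by
  refine K4set_of_mu h ?_
  rintro v hv rfl rfl rfl rfl
  have hc := fun (N : Multiset (Sym2 α)) (p q : Fin 4) => mu_comm N (v p) (v q)
  have b1 := hc M 0 3; have b2 := hc M 3 1
  obtain ⟨M1, r1, h1⟩ := exists_split (M := M) hv 0 1 3 (by decide) (by omega) (by omega)
  have a1 := h1 0 1; have a2 := h1 0 2; have a3 := h1 0 3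
  have a4 := h1 1 2; have a5 := h1 1 3; have a6 := h1 2 3
  simp at a1 a2 a3 a4 a5 a6
  clear h1
  have b1 := hc M1 0 3; have b2 := hc M1 3 2
  obtain ⟨M2, r2, h2⟩ := exists_split (M := M1) hv 0 2 3 (by decide) (by omega) (by omega)
  have a1 := h2 0 1; have a2 := h2 0 2; have a3 := h2 0 3
  have a4 := h2 1 2; have a5 := h2 1 3; have a6 := h2 2 3
  simp at a1 a2 a3 a4 a5 a6
  clear h2
  exact .of_reach (r1.trans r2) (K4set_of_mem hv (by omega) (by omega) (by omega) (by omega) (by omega)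
    (by omega))

lemma K4set_of_pendant_skew (h : [x, y, z, w].Nodup) (hxw : 3 ≤ mu M x w) (hzw : 3 ≤ mu M z w) (hyz : 2 ≤ mu M y z) (hyw : 1 ≤ mu M y w) :
    K4set M {x, y, z, w} := by
  refine K4set_of_mu h ?_
  rintro v hv rfl rfl rfl rfl
  have hc := fun (N : Multiset (Sym2 α)) (p q : Fin 4) => mu_comm N (v p) (v q)
  have b1 := hc M 0 3; have b2 := hc M 3 2
  obtain ⟨M1, r1, h1⟩ := exists_split (M := M) hv 0 2 3 (by decide) (by omega) (by omega)
  have a1 := h1 0 1; have a2 := h1 0 2; have a3 := h1 0 3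
  have a4 := h1 1 2; have a5 := h1 1 3; have a6 := h1 2 3
  simp at a1 a2 a3 a4 a5 a6
  clear h1
  have b1 := hc M1 0 3; have b2 := hc M1 3 2
  obtain ⟨M2, r2, h2⟩ := exists_split (M := M1) hv 0 2 3 (by decide) (by omega) (by omega)
  have a1 := h2 0 1; have a2 := h2 0 2; have a3 := h2 0 3
  have a4 := h2 1 2; have a5 := h2 1 3; have a6 := h2 2 3
  simp at a1 a2 a3 a4 a5 a6
  clear h2
  have b1 := hc M2 0 2; have b2 := hc M2 2 1
  obtain ⟨M3, r3, h3⟩ := exists_split (M := M2) hv 0 1 2 (by decide) (by omega) (by omega)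
  have a1 := h3 0 1; have a2 := h3 0 2; have a3 := h3 0 3
  have a4 := h3 1 2; have a5 := h3 1 3; have a6 := h3 2 3
  simp at a1 a2 a3 a4 a5 a6
  clear h3
  exact .of_reach ((r1.trans r2).trans r3) (K4set_of_mem hv (by omega) (by omega) (by omega) (by omega) (by omega)
    (by omega))

lemma K4set_of_star (h : [x, y, z, w].Nodup) (hxw : 3 ≤ mu M x w) (hyw : 3 ≤ mu M y w) (hzw : 3 ≤ mu M z w) :
    K4set M {x, y, z, w} := by
  refine K4set_of_mu h ?_
  rintro v hv rfl rfl rfl rfl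
  have hc := fun (N : Multiset (Sym2 α)) (p q : Fin 4) => mu_comm N (v p) (v q)
  have b1 := hc M 0 3; have b2 := hc M 3 1
  obtain ⟨M1, r1, h1⟩ := exists_split (M := M) hv 0 1 3 (by decide) (by omega) (by omega)
  have a1 := h1 0 1; have a2 := h1 0 2; have a3 := h1 0 3
  have a4 := h1 1 2; have a5 := h1 1 3; have a6 := h1 2 3
  simp at a1 a2 a3 a4 a5 a6
  clear h1
  have b1 := hc M1 0 3; have b2 := hc M1 3 2
  obtain ⟨M2, r2, h2⟩ := exists_split (M := M1) hv 0 2 3 (by decide) (by omega) (by omega)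
  have a1 := h2 0 1; have a2 := h2 0 2; have a3 := h2 0 3
  have a4 := h2 1 2; have a5 := h2 1 3; have a6 := h2 2 3
  simp at a1 a2 a3 a4 a5 a6
  clear h2
  have b1 := hc M2 1 3; have b2 := hc M2 3 2
  obtain ⟨M3, r3, h3⟩ := exists_split (M := M2) hv 1 2 3 (by decide) (by omega) (by omega)
  have a1 := h3 0 1; have a2 := h3 0 2; have a3 := h3 0 3
  have a4 := h3 1 2; have a5 := h3 1 3; have a6 := h3 2 3
  simp at a1 a2 a3 a4 a5 a6
  clear h3
  exact .of_reach ((r1.trans r2).trans r3) (K4set_of_mem hv (by omega) (by omega) (by omega) (by omega) (by omega)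
    (by omega))

lemma nodup_four : [x, y, z, w].Nodup ↔ x ≠ y ∧ x ≠ z ∧ x ≠ w ∧ y ≠ z ∧ y ≠ w ∧ z ≠ w := by
  simp; tauto

lemma K4set_of_perm {T : Finset α} (h : K4set M {x, y, z, w})
    (hT : T = {x, y, z, w}) : K4set M T := hT ▸ h

/-- The inequalities say that degrees are at least three and that the cuts of `{x, z}` and `{x, w}`
have at least four edges. The set of adjacent pairs among the remaining five decides which
construction applies; the only failure is the square with all four sides exactly double. -/
lemma K4set_or_of_mu_eq_zero (h : [x, y, z, w].Nodup) (hxy : mu M x y = 0)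
    (hx : 3 ≤ mu M x z + mu M x w) (hy : 3 ≤ mu M y z + mu M y w)
    (hz : 3 ≤ mu M x z + mu M y z + mu M z w) (hw : 3 ≤ mu M x w + mu M y w + mu M z w)
    (hxz : 4 ≤ mu M x w + mu M y z + mu M z w) (hxw : 4 ≤ mu M x z + mu M y w + mu M z w) :
    K4set M {x, y, z, w} ∨
      (mu M z w = 0 ∧ mu M x z = 2 ∧ mu M x w = 2 ∧ mu M y z = 2 ∧ mu M y w = 2) := by
  by_contra! hcon
  obtain ⟨hK, hD⟩ := hcon
  obtain ⟨c1, c2, c3, c4, c5⟩ : mu M z x = mu M x z ∧ mu M w x = mu M x w ∧ mu M z y = mu M y z ∧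
    mu M w y = mu M y w ∧ mu M w z = mu M z w :=
    ⟨mu_comm .., mu_comm .., mu_comm .., mu_comm .., mu_comm ..⟩
  have P : ∀ {p q r s : α}, K4set M {p, q, r, s} → ({x, y, z, w} : Finset α) = {p, q, r, s} →
      False := fun hp he => hK (K4set_of_perm hp he)
  have n1 : [y, x, z, w].Nodup := by grind
  have n2 : [x, y, w, z].Nodup := by grind
  have n3 : [y, x, w, z].Nodup := by grind
  generalize hA : mu M x z = A at *
  generalize hB : mu M x w = B at *
  generalize hC : mu M y z = C at *
  generalize hD' : mu M y w = D at *
  generalize hE : mu M z w = E at *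
  rcases Nat.eq_zero_or_pos E with rfl | hE0
  · rcases Nat.eq_zero_or_pos A with rfl | hA0
    · exact P (K4set_of_path (x := x) (y := w) (z := y) (w := z) (by grind) (by omega) (by omega)
        (by omega)) (by grind)
    rcases Nat.eq_zero_or_pos B with rfl | hB0
    · exact P (K4set_of_path (x := x) (y := z) (z := y) (w := w) (by grind) (by omega) (by omega)
        (by omega)) (by grind)
    rcases Nat.eq_zero_or_pos C with rfl | hC0
    · exact P (K4set_of_path (x := y) (y := w) (z := x) (w := z) (by grind) (by omega) (by omega)
        (by omega)) (by grind)
    rcases Nat.eq_zero_or_pos D with rfl | hD0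
    · exact P (K4set_of_path (x := y) (y := z) (z := x) (w := w) (by grind) (by omega) (by omega)
        (by omega)) (by grind)
    by_cases s1 : 3 ≤ A ∧ 2 ≤ C ∧ 2 ≤ B
    · exact P (K4set_of_cycle h (by omega) (by omega) (by omega) (by omega)) rfl
    by_cases s2 : 3 ≤ C ∧ 2 ≤ A ∧ 2 ≤ D
    · exact P (K4set_of_cycle n1 (by omega) (by omega) (by omega) (by omega)) (by grind)
    by_cases s3 : 3 ≤ B ∧ 2 ≤ D ∧ 2 ≤ A
    · exact P (K4set_of_cycle n2 (by omega) (by omega) (by omega) (by omega)) (by grind)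
    by_cases s4 : 3 ≤ D ∧ 2 ≤ B ∧ 2 ≤ C
    · exact P (K4set_of_cycle n3 (by omega) (by omega) (by omega) (by omega)) (by grind)
    omega
  rcases Nat.eq_zero_or_pos A with rfl | hA0
  · rcases Nat.eq_zero_or_pos C with rfl | hC0
    · exact P (K4set_of_star h (by omega) (by omega) (by omega)) rfl
    rcases Nat.eq_zero_or_pos D with rfl | hD0
    · exact P (K4set_of_path (x := x) (y := w) (z := z) (w := y) (by grind) (by omega) (by omega)
        (by omega)) (by grind)
    by_cases s1 : 2 ≤ D ∧ 2 ≤ E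
    · exact P (K4set_of_pendant h (by omega) (by omega) (by omega) (by omega)) rfl
    by_cases s2 : 3 ≤ E
    · exact P (K4set_of_pendant_skew h (by omega) (by omega) (by omega) (by omega)) rfl
    · exact P (K4set_of_pendant_skew (x := x) (y := z) (z := y) (w := w) (by grind) (by omega)
        (by omega) (by omega) (by omega)) (by grind)
  rcases Nat.eq_zero_or_pos B with rfl | hB0
  · rcases Nat.eq_zero_or_pos D with rfl | hD0
    · exact P (K4set_of_star n2 (by omega) (by omega) (by omega)) (by grind)
    rcases Nat.eq_zero_or_pos C with rfl | hC0
    · exact P (K4set_of_path (x := x) (y := z) (z := w) (w := y) (by grind) (by omega) (by omega)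
        (by omega)) (by grind)
    by_cases s1 : 2 ≤ C ∧ 2 ≤ E
    · exact P (K4set_of_pendant n2 (by omega) (by omega) (by omega) (by omega)) (by grind)
    by_cases s2 : 3 ≤ E
    · exact P (K4set_of_pendant_skew n2 (by omega) (by omega) (by omega) (by omega)) (by grind)
    · exact P (K4set_of_pendant_skew (x := x) (y := w) (z := y) (w := z) (by grind) (by omega)
        (by omega) (by omega) (by omega)) (by grind)
  rcases Nat.eq_zero_or_pos C with rfl | hC0
  · by_cases s1 : 2 ≤ B ∧ 2 ≤ E
    · exact P (K4set_of_pendant n1 (by omega) (by omega) (by omega) (by omega)) (by grind)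
    by_cases s2 : 3 ≤ E
    · exact P (K4set_of_pendant_skew n1 (by omega) (by omega) (by omega) (by omega)) (by grind)
    · exact P (K4set_of_pendant_skew (x := y) (y := z) (z := x) (w := w) (by grind) (by omega)
        (by omega) (by omega) (by omega)) (by grind)
  rcases Nat.eq_zero_or_pos D with rfl | hD0
  · by_cases s1 : 2 ≤ A ∧ 2 ≤ E
    · exact P (K4set_of_pendant n3 (by omega) (by omega) (by omega) (by omega)) (by grind)
    by_cases s2 : 3 ≤ E
    · exact P (K4set_of_pendant_skew n3 (by omega) (by omega) (by omega) (by omega)) (by grind)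
    · exact P (K4set_of_pendant_skew (x := y) (y := w) (z := x) (w := z) (by grind) (by omega)
        (by omega) (by omega) (by omega)) (by grind)
  by_cases s1 : 2 ≤ A ∧ 2 ≤ C
  · exact P (K4set_of_cycle_chord h (by omega) (by omega) (by omega) (by omega) (by omega)) rfl
  by_cases s2 : 2 ≤ B ∧ 2 ≤ D
  · exact P (K4set_of_cycle_chord n2 (by omega) (by omega) (by omega) (by omega) (by omega))
      (by grind)
  by_cases s3 : 2 ≤ A
  · exact P (K4set_of_cycle_zigzag h (by omega) (by omega) (by omega) (by omega) (by omega)) rfl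
  · exact P (K4set_of_cycle_zigzag n2 (by omega) (by omega) (by omega) (by omega) (by omega))
      (by grind)

/-- The local description of doubled cycles: all degrees are four, and every vertex is joined to
each of two neighbours by two parallel edges. -/
def Dbl (M : Multiset (Sym2 α)) (V : Finset α) : Prop :=
  ∀ v ∈ V, d M {v} = 4 ∧ ∃ y ∈ V, ∃ z ∈ V, y ≠ z ∧ v ≠ y ∧ v ≠ z ∧ mu M v y = 2 ∧ mu M v z = 2

lemma d_singleton_of_sup (h : [x, y, z, w].Nodup) (hM : Sup M {x, y, z, w}) :
    d M {x} = mu M x y + mu M x z + mu M x w := by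
  unfold mu d
  rw [← wt_add, ← wt_add]
  refine wt_congr fun e he => ?_
  induction e with | _ p q
  have h1 := hM p q he
  simp only [Finset.mem_insert, Finset.mem_singleton] at h1
  simp only [cr_mk, Finset.mem_singleton, Sym2.eq_iff]
  by_cases hpq : p = q
  · subst hpq; grind
  · grind

lemma Dbl_of_square {p q r s : α} (hn : [p, q, r, s].Nodup)
    (h1 : mu M p r = 2) (h2 : mu M p s = 2) (h3 : mu M q r = 2) (h4 : mu M q s = 2)
    (k1 : d M {p} = 4) (k2 : d M {q} = 4) (k3 : d M {r} = 4) (k4 : d M {s} = 4) :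
    Dbl M {p, q, r, s} := by
  obtain ⟨m1, m2, m3, m4, m5, m6⟩ := nodup_four.1 hn
  intro v hv
  simp only [Finset.mem_insert, Finset.mem_singleton] at hv
  rcases hv with rfl | rfl | rfl | rfl
  · exact ⟨k1, r, by simp, s, by simp, m6, m2, m3, h1, h2⟩
  · exact ⟨k2, r, by simp, s, by simp, m6, m4, m5, h3, h4⟩
  · exact ⟨k3, p, by simp, q, by simp, m1, m2.symm, m4.symm, by rwa [mu_comm],
      by rwa [mu_comm]⟩
  · exact ⟨k4, p, by simp, q, by simp, m1, m3.symm, m5.symm, by rwa [mu_comm],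
      by rwa [mu_comm]⟩

/-- If all six pairs are adjacent, `K₄` is already present. Otherwise a non-adjacent pair is renamed
to be the first two vertices and `K4set_or_of_mu_eq_zero` applies. -/
theorem K4set_or_Dbl_of_card_four (h : [x, y, z, w].Nodup) (hM : Sup M {x, y, z, w})
    (hx : 3 ≤ d M {x}) (hy : 3 ≤ d M {y}) (hz : 3 ≤ d M {z}) (hw : 3 ≤ d M {w})
    (hxy : 4 ≤ d M {x, y}) (hxz : 4 ≤ d M {x, z}) (hxw : 4 ≤ d M {x, w}) :
    K4set M {x, y, z, w} ∨ Dbl M {x, y, z, w} := by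
  obtain ⟨ny, nz, nw, n1, n2, n3⟩ := nodup_four.1 h
  have e1 := d_pair (M := M) ny
  have e2 := d_pair (M := M) nz
  have e3 := d_pair (M := M) nw
  have d1 := d_singleton_of_sup h hM
  have d2 := d_singleton_of_sup (M := M) (x := y) (y := x) (z := z) (w := w)
    (nodup_four.2 (by refine ⟨?_, ?_, ?_, ?_, ?_, ?_⟩ <;> first | assumption | (apply Ne.symm; assumption)))
    (by convert hM using 1; clear * -; ext t; simp only [Finset.mem_insert, Finset.mem_singleton]; tauto)
  have d3 := d_singleton_of_sup (M := M) (x := z) (y := x) (z := y) (w := w)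
    (nodup_four.2 (by refine ⟨?_, ?_, ?_, ?_, ?_, ?_⟩ <;> first | assumption | (apply Ne.symm; assumption)))
    (by convert hM using 1; clear * -; ext t; simp only [Finset.mem_insert, Finset.mem_singleton]; tauto)
  have d4 := d_singleton_of_sup (M := M) (x := w) (y := x) (z := y) (w := z)
    (nodup_four.2 (by refine ⟨?_, ?_, ?_, ?_, ?_, ?_⟩ <;> first | assumption | (apply Ne.symm; assumption)))
    (by convert hM using 1; clear * -; ext t; simp only [Finset.mem_insert, Finset.mem_singleton]; tauto)
  obtain ⟨c0, c1, c2, c3, c4, c5⟩ : mu M y x = mu M x y ∧ mu M z x = mu M x z ∧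
    mu M w x = mu M x w ∧ mu M z y = mu M y z ∧ mu M w y = mu M y w ∧ mu M w z = mu M z w :=
    ⟨mu_comm .., mu_comm .., mu_comm .., mu_comm .., mu_comm .., mu_comm ..⟩
  by_contra! hcon
  obtain ⟨hK, hD⟩ := hcon
  have P : ∀ {p q r s : α}, K4set M {p, q, r, s} → ({x, y, z, w} : Finset α) = {p, q, r, s} →
      False := fun hp he => hK (K4set_of_perm hp he)
  have Z : ∀ {p q r s : α}, [p, q, r, s].Nodup → ({x, y, z, w} : Finset α) = {p, q, r, s} →
      mu M p q = 0 → d M {p} = mu M p r + mu M p s → d M {q} = mu M q r + mu M q s →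
      d M {r} = mu M p r + mu M q r + mu M r s → d M {s} = mu M p s + mu M q s + mu M r s →
      3 ≤ d M {p} → 3 ≤ d M {q} → 3 ≤ d M {r} → 3 ≤ d M {s} →
      4 ≤ mu M p s + mu M q r + mu M r s → 4 ≤ mu M p r + mu M q s + mu M r s → False := by
    intro p q r s hn he h0 k1 k2 k3 k4 l1 l2 l3 l4 m1 m2
    rcases K4set_or_of_mu_eq_zero hn h0 (by omega) (by omega) (by omega) (by omega) m1 m2 with
      h | ⟨g0, g1, g2, g3, g4⟩
    · exact P h he
    · exact hD (he ▸ Dbl_of_square hn g1 g2 g3 g4 (by omega) (by omega) (by omega) (by omega))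
  by_cases z1 : mu M x y = 0
  · exact Z h rfl z1 (by omega) (by omega) (by omega) (by omega) hx hy hz hw (by omega) (by omega)
  by_cases z2 : mu M x z = 0
  · exact Z (p := x) (q := z) (r := y) (s := w) 
      (nodup_four.2 (by refine ⟨?_, ?_, ?_, ?_, ?_, ?_⟩ <;> first | assumption | (apply Ne.symm; assumption)))
      (by clear * -; ext t; simp only [Finset.mem_insert, Finset.mem_singleton]; tauto) z2 (by omega) (by omega)
      (by omega) (by omega) hx hz hy hw (by omega) (by omega)
  by_cases z3 : mu M x w = 0
  · exact Z (p := x) (q := w) (r := z) (s := y) 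
      (nodup_four.2 (by refine ⟨?_, ?_, ?_, ?_, ?_, ?_⟩ <;> first | assumption | (apply Ne.symm; assumption)))
      (by clear * -; ext t; simp only [Finset.mem_insert, Finset.mem_singleton]; tauto) z3 (by omega) (by omega)
      (by omega) (by omega) hx hw hz hy (by omega) (by omega)
  by_cases z4 : mu M y z = 0
  · exact Z (p := y) (q := z) (r := x) (s := w) 
      (nodup_four.2 (by refine ⟨?_, ?_, ?_, ?_, ?_, ?_⟩ <;> first | assumption | (apply Ne.symm; assumption)))
      (by clear * -; ext t; simp only [Finset.mem_insert, Finset.mem_singleton]; tauto) z4 (by omega) (by omega)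
      (by omega) (by omega) hy hz hx hw (by omega) (by omega)
  by_cases z5 : mu M y w = 0
  · exact Z (p := y) (q := w) (r := x) (s := z) 
      (nodup_four.2 (by refine ⟨?_, ?_, ?_, ?_, ?_, ?_⟩ <;> first | assumption | (apply Ne.symm; assumption)))
      (by clear * -; ext t; simp only [Finset.mem_insert, Finset.mem_singleton]; tauto) z5 (by omega) (by omega)
      (by omega) (by omega) hy hw hx hz (by omega) (by omega)
  by_cases z6 : mu M z w = 0
  · exact Z (p := z) (q := w) (r := x) (s := y) 
      (nodup_four.2 (by refine ⟨?_, ?_, ?_, ?_, ?_, ?_⟩ <;> first | assumption | (apply Ne.symm; assumption)))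
      (by clear * -; ext t; simp only [Finset.mem_insert, Finset.mem_singleton]; tauto) z6 (by omega) (by omega)
      (by omega) (by omega) hz hw hx hy (by omega) (by omega)
  refine hK (K4set_of_mu h ?_)
  rintro v hv rfl rfl rfl rfl
  exact K4set_of_mem hv (by omega) (by omega) (by omega) (by omega) (by omega) (by omega)

end EdgeMultiset

end

noncomputable section

namespace EdgeMultiset

open scoped Classical

variable {α : Type*} {M N R : Multiset (Sym2 α)} {X Y Z S V : Finset α} {x y z w a b s p : α}

/-! ### Chains of cuts of constant size -/

/-- One vertex is added to `S` without changing the number of leaving edges. -/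
def ChainStep (M : Multiset (Sym2 α)) (S S' : Finset α) : Prop :=
  ∃ p, p ∉ S ∧ S' = insert p S ∧ d M (insert p S) = d M S

/-- `Y` is obtained from `Z` by adding vertices one at a time, with a constant number of leaving
edges. -/
def Chain (M : Multiset (Sym2 α)) : Finset α → Finset α → Prop := Relation.ReflTransGen (ChainStep M)

lemma Chain.refl (M : Multiset (Sym2 α)) (Z : Finset α) : Chain M Z Z := Relation.ReflTransGen.refl

lemma Chain.trans (h : Chain M X Y) (h' : Chain M Y Z) : Chain M X Z :=
  Relation.ReflTransGen.trans h h'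

lemma Chain.single (hp : p ∉ S) (h : d M (insert p S) = d M S) : Chain M S (insert p S) :=
  Relation.ReflTransGen.single ⟨p, hp, rfl, h⟩

lemma Chain.subset (h : Chain M Z Y) : Z ⊆ Y := by
  induction h with
  | refl => exact subset_rfl
  | tail _ h ih =>
    obtain ⟨p, _, rfl, _⟩ := h
    exact ih.trans (Finset.subset_insert _ _)

lemma Chain.d_eq (h : Chain M Z Y) : d M Y = d M Z := by
  induction h with
  | refl => rfl
  | tail _ h ih =>
    obtain ⟨p, _, rfl, h⟩ := h
    rw [h, ih]

lemma Chain.compl (hM : Sup M V) (h : Chain M Z Y) (hY : Y ⊆ V) : Chain M (V \ Y) (V \ Z) := by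
  induction h with
  | refl => exact .refl _ _
  | @tail S S' h1 h ih =>
    obtain ⟨p, hp, rfl, h⟩ := h
    refine Chain.trans ?_ (ih ((Finset.subset_insert _ _).trans hY))
    have e : V \ S = insert p (V \ insert p S) := by
      ext x
      have : p ∈ V := hY (Finset.mem_insert_self _ _)
      simp only [Finset.mem_sdiff, Finset.mem_insert]; grind
    rw [e]
    refine Chain.single (by simp) ?_
    rw [← e, hM.d_compl, hM.d_compl, h]

lemma Chain.exists_step (h : Chain M Z Y) (hp : p ∈ Y) (hpZ : p ∉ Z) :
    ∃ S, Chain M Z S ∧ p ∉ S ∧ d M (insert p S) = d M S ∧ Chain M (insert p S) Y := by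
  induction h with
  | refl => exact absurd hp hpZ
  | @tail S S' h3 h ih =>
    by_cases hk : p ∈ S
    · obtain ⟨T, hT1, hT2, hT3, hT4⟩ := ih hk
      exact ⟨T, hT1, hT2, hT3, hT4.tail h⟩
    · obtain ⟨q, hq, rfl, h⟩ := h
      obtain rfl : p = q := by simpa [hk] using hp
      exact ⟨S, h3, hk, h, .refl _ _⟩

/-- The cut stays constant exactly when the edges from `p` into `S` balance those going elsewhere.
So the vertices added by a chain have even degree, and a vertex of odd degree lies in one of the two
end sets. -/
lemma d_eq_two_mul (hp : p ∉ S) (h : d M (insert p S) = d M S) : d M {p} = 2 * btw M {p} S := by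
  have := d_insert (M := M) hp
  omega

lemma Chain.even (h : Chain M Z Y) (hp : p ∈ Y) (hpZ : p ∉ Z) : ∃ k, d M {p} = 2 * k := by
  obtain ⟨S, _, h1, h2, _⟩ := h.exists_step hp hpZ
  exact ⟨_, d_eq_two_mul h1 h2⟩

/-- Used with `c = 1` when `N` has one more edge, joining `Z` to the complement of `Y`, and with `c
= 0` when no set of the chain notices the change. -/
lemma Chain.congr {c : ℕ} (h : Chain M Z Y) (hN : ∀ X, Z ⊆ X → X ⊆ Y → d N X = d M X + c) :
    Chain N Z Y := by
  induction h with
  | refl => exact .refl _ _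
  | @tail S S' h1 h ih =>
    obtain ⟨p, hp, rfl, h⟩ := h
    have hSp := Finset.subset_insert p S
    refine (ih fun X h2 h3 => hN X h2 (h3.trans hSp)).trans (.single hp ?_)
    rw [hN _ (Chain.subset h1) hSp, hN _ ((Chain.subset h1).trans hSp) subset_rfl, h]

lemma exists_edge_of_btw_pos (h : 0 < btw M {p} S) : ∃ x ∈ S, s(x, p) ∈ M := by
  by_contra! hcon
  refine h.ne' (wt_eq_zero_iff.2 fun e he => ?_)
  induction e with | _ x y
  have h1 := hcon x; have h2 := hcon y
  rw [Sym2.eq_swap] at h2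
  simp only [bt_mk, Finset.mem_singleton]
  grind [Sym2.eq_swap]

lemma exists_edge_of_btw_lt (h : btw M {p} S < d M {p}) :
    ∃ z, z ∉ S ∧ z ≠ p ∧ s(p, z) ∈ M := by
  by_contra! hcon
  refine absurd h (not_lt.2 (wt_le fun e he => ?_))
  induction e with | _ x y
  have h1 := hcon x; have h2 := hcon y
  simp only [bt_mk, cr_mk, Finset.mem_singleton]
  grind [Sym2.eq_swap]

/-- The edges at `p` can be split off in pairs when half of them go to `S`. -/
lemma exists_isolate (hp : p ∉ S) (h : d M (insert p S) = d M S) :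
    ∃ M', Reach M M' ∧ d M' {p} = 0 ∧ (∀ X ⊆ S, d M' X = d M X) ∧
      (∀ X, Disjoint X (insert p S) → d M' X = d M X) ∧
      (∀ x ∈ S, ∀ y ∈ S, mu M' x y = mu M x y) ∧ ∀ V, Sup M V → Sup M' V := by
  induction hn : M.card using Nat.strong_induction_on generalizing M with
  | _ n ih
  subst hn
  by_cases h0 : d M {p} = 0
  · exact ⟨M, .refl M, h0, by simp⟩
  have h2 := d_eq_two_mul hp h
  -- An edge from `S` is paired with an edge leaving `insert p S`. A set inside `S`, or disjoint
  -- from `insert p S`, contains at most one end of the path `x p z` and not its middle, so its cut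
  -- is unchanged.
  obtain ⟨x, hx, hxp⟩ := exists_edge_of_btw_pos (M := M) (p := p) (S := S) (by omega)
  obtain ⟨z, hz, hzp, hpz⟩ := exists_edge_of_btw_lt (M := M) (p := p) (S := S) (by omega)
  have hxp' : x ≠ p := by rintro rfl; exact hp hx
  have hxz : x ≠ z := by rintro rfl; exact hz hx
  obtain ⟨R, rfl⟩ := exists_cons_cons hxp hpz (by simp only [ne_eq, Sym2.eq_iff]; grind)
  have k1 : ∀ X ⊆ S, d (s(x, z) ::ₘ R) X = d (s(x, p) ::ₘ s(p, z) ::ₘ R) X := by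
    intro X hX
    have hz' : z ∉ X := fun h => hz (hX h)
    have hp' : p ∉ X := fun h => hp (hX h)
    simp [hz', hp']
  have k2 : ∀ X, Disjoint X (insert p S) →
      d (s(x, z) ::ₘ R) X = d (s(x, p) ::ₘ s(p, z) ::ₘ R) X := by
    intro X hX
    rw [Finset.disjoint_right] at hX
    have hz' : x ∉ X := hX (by simp [hx])
    have hp' : p ∉ X := hX (by simp)
    simp [hz', hp']
  obtain ⟨M', r, e0, e1, e2, e3, e4⟩ := ih (s(x, z) ::ₘ R).card (by simp) (by
    rw [k1 S subset_rfl, ← h]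
    simp only [d_cons, cr_mk, Finset.mem_insert, hx, hz, hzp]
    simp) rfl
  refine ⟨M', (Reach.split R x p z).trans r, e0, fun X hX => ?_, fun X hX => ?_, fun a ha b hb => ?_,
    fun V hV => e4 V ?_⟩
  · rw [e1 X hX, k1 X hX]
  · rw [e2 X hX, k2 X hX]
  · rw [e3 a ha b hb]
    have n1 : s(x, z) ≠ s(a, b) := by simp only [ne_eq, Sym2.eq_iff]; grind
    have n2 : s(x, p) ≠ s(a, b) := by simp only [ne_eq, Sym2.eq_iff]; grind
    have n3 : s(p, z) ≠ s(a, b) := by simp only [ne_eq, Sym2.eq_iff]; grind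
    simp [n1, n2, n3]
  · have v1 := hV x p (by simp) hxp'
    have v2 := hV p z (by simp) (Ne.symm hzp)
    intro a b hab hne
    rcases Multiset.mem_cons.1 hab with h | h
    · rw [Sym2.eq_iff] at h; grind
    · exact hV a b (by simp [h]) hne

/-- The inner vertices of a chain can be removed by splitting. -/
lemma Chain.exists_isolate (h : Chain M Z Y) :
    ∃ M', Reach M M' ∧ (∀ p ∈ Y, p ∉ Z → d M' {p} = 0) ∧ (∀ X ⊆ Z, d M' X = d M X) ∧
      (∀ X, Disjoint X Y → d M' X = d M X) ∧
      (∀ x ∈ Z, ∀ y ∈ Z, mu M' x y = mu M x y) ∧ ∀ V, Sup M V → Sup M' V := by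
  induction hn : Y.card using Nat.strong_induction_on generalizing M Y with
  | _ n ih
  subst hn
  rcases Relation.ReflTransGen.cases_tail h with rfl | ⟨S, hS, p, hp, rfl, hd⟩
  · exact ⟨M, .refl M, fun p h1 h2 => absurd h1 h2, by simp⟩
  obtain ⟨M1, r1, a0, a1, a2, a3, a4⟩ := EdgeMultiset.exists_isolate hp hd
  have hS1 : Chain M1 Z S := Chain.congr (c := 0) hS fun X _ hX => a1 X hX
  have hZS := hS1.subset
  obtain ⟨M2, r2, b0, b1, b2, b3, b4⟩ := ih _ (by simp [Finset.card_insert_of_notMem hp]) hS1 rfl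
  refine ⟨M2, r1.trans r2, fun q hq hqZ => ?_, fun X hX => ?_, fun X hX => ?_, fun x hx y hy => ?_,
    fun V hV => b4 V (a4 V hV)⟩
  · rcases Finset.mem_insert.1 hq with rfl | hq
    · rw [b2 _ (by simpa using hp), a0]
    · exact b0 q hq hqZ
  · rw [b1 X hX, a1 X (hX.trans hZS)]
  · rw [b2 X (hX.mono_right (Finset.subset_insert _ _)), a2 X hX]
  · rw [b3 x hx y hy, a3 x (hZS hx) y (hZS hy)]

lemma Sup.of_d_eq_zero (h : Sup M V) (hS : ∀ x ∈ V, x ∉ S → d M {x} = 0) : Sup M S := by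
  have key : ∀ x y, s(x, y) ∈ M → x ≠ y → x ∈ S := by
    intro x y hxy hne
    by_contra hx
    have h0 := wt_eq_zero_iff.1 (hS x (h x y hxy hne).1 hx) _ hxy
    simp [hne.symm] at h0
  intro x y hxy hne
  exact ⟨key x y hxy hne, key y x (by rwa [Sym2.eq_swap]) hne.symm⟩

/-- A chain of cuts between two pairs of vertices gives an immersion of `K₄`. -/
theorem K4set_of_chain {t u p q : α} (hM : Sup M V) (h : Chain M {t, u} Y)
    (hW : V \ Y = {p, q}) (htu : t ≠ u) (hpq : p ≠ q) (ht : d M {t} = 3) (hm : 2 ≤ mu M t u)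
    (hu : 3 ≤ d M {u}) (hp : 3 ≤ d M {p}) (hq : 3 ≤ d M {q}) (hZ : 4 ≤ d M {t, u}) :
    K4set M {t, u, p, q} := by
  obtain ⟨M', r, b0, b1, b2, b3, b4⟩ := h.exists_isolate
  have hmem : ∀ x, (x ∈ V ∧ x ∉ Y) ↔ (x = p ∨ x = q) := by
    intro x
    rw [← Finset.mem_sdiff, hW]; simp
  have hpY := (hmem p).2 (Or.inl rfl)
  have hqY := (hmem q).2 (Or.inr rfl)
  have hZY := h.subset
  have ht' : t ∈ Y := hZY (by simp)
  have hu' : u ∈ Y := hZY (by simp)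
  have hS : Sup M' {t, u, p, q} := (b4 V hM).of_d_eq_zero fun x hx hxS => by
    simp only [Finset.mem_insert, Finset.mem_singleton] at hxS
    push Not at hxS
    refine b0 x ?_ (by simp [hxS])
    by_contra hxY
    have := (hmem x).1 ⟨hx, hxY⟩
    grind
  rw [← b1 _ subset_rfl] at hZ
  rw [← b1 _ (by simp)] at ht hu
  rw [← b2 _ (by simpa using hpY.2)] at hp
  rw [← b2 _ (by simpa using hqY.2)] at hq
  rw [← b3 _ (by simp) _ (by simp)] at hm
  have htp : t ≠ p := by rintro rfl; exact hpY.2 ht'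
  have htq : t ≠ q := by rintro rfl; exact hqY.2 ht'
  have hup : u ≠ p := by rintro rfl; exact hpY.2 hu'
  have huq : u ≠ q := by rintro rfl; exact hqY.2 hu'
  -- With the inner vertices isolated, only `t, u, p, q` matter. Since `t` has degree three and at
  -- least two edges to `u`, it sends at most one edge to each of `p` and `q`, whence the cuts of
  -- `{t, p}` and `{t, q}` have at least four edges. The odd degree of `t` excludes the doubled
  -- square.
  have e1 := mu_add_mu_le (M := M') htu htp hup
  have e2 := mu_add_mu_le (M := M') htu htq huq
  have e3 := d_pair (M := M') htp
  have e4 := d_pair (M := M') htq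
  refine K4set.of_reach r ((K4set_or_Dbl_of_card_four (nodup_four.2 ⟨htu, htp, htq, hup, huq, hpq⟩)
    hS (by omega) hu hp hq hZ (by omega) (by omega)).resolve_right fun hD => ?_)
  have := (hD t (by simp)).1
  omega

end EdgeMultiset

end

noncomputable section

namespace EdgeMultiset

open scoped Classical

variable {α : Type*} {M N R : Multiset (Sym2 α)} {X Y Z S V : Finset α} {x y z w a b s p u v : α}

/-! ### The structure theorem for edge multisets -/

/-- `3`-edge-connectivity. -/
def EC (M : Multiset (Sym2 α)) (V : Finset α) : Prop :=
  ∀ X ⊆ V, X.Nonempty → X ≠ V → 3 ≤ d M X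

/-- There are no `3`-edge cuts except around single vertices. -/
def NT (M : Multiset (Sym2 α)) (V : Finset α) : Prop :=
  ∀ X ⊆ V, 2 ≤ X.card → X.card + 2 ≤ V.card → 4 ≤ d M X

/-- A segmentation of width three from `Z` to `V \ Y` obeying the condition on the roots `a` and
`b`, in which both end sets have at least two elements. -/
structure SegOf (M : Multiset (Sym2 α)) (V : Finset α) (a b : α) (Z Y : Finset α) : Prop where
  chain : Chain M Z Y
  sub : Y ⊆ V
  d_eq : d M Z = 3
  two_le : 2 ≤ Z.card
  card_add : Y.card + 2 ≤ V.card
  left : 3 ≤ Z.card → a ∉ Z ∧ b ∉ Z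
  right : Y.card + 3 ≤ V.card → a ∈ Y ∧ b ∈ Y

/-- There is a segmentation of width three obeying the condition on the roots. -/
def Seg (M : Multiset (Sym2 α)) (V : Finset α) (a b : α) : Prop := ∃ Z Y, SegOf M V a b Z Y

lemma SegOf.d_eq' (h : SegOf M V a b Z Y) : d M Y = 3 := h.chain.d_eq.trans h.d_eq

lemma SegOf.between (h : SegOf M V a b Z Y) (h1 : Chain M Z X) (h2 : Chain M X Y) :
    X ⊆ V ∧ d M X = 3 ∧ 2 ≤ X.card ∧ X.card + 2 ≤ V.card := by
  have e1 := Finset.card_le_card h1.subset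
  have e2 := Finset.card_le_card h2.subset
  have e3 := h.two_le; have e4 := h.card_add
  exact ⟨h2.subset.trans h.sub, h1.d_eq.trans h.d_eq, by omega, by omega⟩

lemma SegOf.compl (hM : Sup M V) (ha : a ∈ V) (hb : b ∈ V) (h : SegOf M V a b Z Y) :
    SegOf M V a b (V \ Y) (V \ Z) := by
  have hZV := h.chain.subset.trans h.sub
  have e1 := Finset.card_sdiff_add_card_eq_card hZV
  have e2 := Finset.card_sdiff_add_card_eq_card h.sub
  have e3 := h.two_le; have e4 := h.card_add
  refine ⟨h.chain.compl hM h.sub, Finset.sdiff_subset, ?_, by omega, by omega, fun h1 => ?_,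
    fun h1 => ?_⟩
  · rw [hM.d_compl, h.d_eq']
  · have := h.right (by omega)
    simp [this]
  · have := h.left (by omega)
    simp [this, ha, hb]

/-- The three outcomes of the structure theorem. -/
def Out (M : Multiset (Sym2 α)) (V : Finset α) (a b : α) : Prop :=
  K4r M a b ∨ Dbl M V ∨ Seg M V a b

/-- The structure theorem holds, with roots `a` and `b`, for all instances of size less than `n`. -/
def OutBelow (a b : α) (n : ℕ) : Prop :=
  ∀ (M : Multiset (Sym2 α)) (V : Finset α), M.card + V.card < n → Sup M V → EC M V → 4 ≤ V.card →
    a ∈ V → b ∈ V → Out M V a b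

/-- A minimal counterexample without non-trivial `3`-edge cuts on at least five vertices. -/
structure Ctx (M : Multiset (Sym2 α)) (V : Finset α) (a b : α) : Prop where
  sup : Sup M V
  ec : EC M V
  nt : NT M V
  five : 5 ≤ V.card
  ha : a ∈ V
  hb : b ∈ V
  hab : a ≠ b
  ih : OutBelow a b (M.card + V.card)
  -- Segmentations need no exclusion here: an end set of one would contradict `nt`.
  nk : ¬ K4r M a b
  nd : ¬ Dbl M V

lemma EC.three_le (h : EC M V) (hx : x ∈ V) (hV : 2 ≤ V.card) : 3 ≤ d M {x} := by
  refine h _ (by simpa using hx) (by simp) ?_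
  rintro rfl
  simp at hV

lemma EC.con (h : EC M V) (hS : S ⊆ V) (hs : s ∈ S) : EC (con S s M) (insert s (V \ S)) := by
  intro X hX hne hne'
  by_cases hsX : s ∈ X
  · rw [d_con_of_mem hsX]
    refine h _ (fun x hx => ?_) ⟨s, by simp [hsX]⟩ fun heq => hne' ?_
    · have := @hX x; have := @hS x
      simp only [Finset.mem_union, Finset.mem_insert, Finset.mem_sdiff] at *; grind
    · refine hX.antisymm fun x hx => ?_
      have : x ∈ X ∪ S ↔ x ∈ V := by rw [heq]
      simp only [Finset.mem_union, Finset.mem_insert, Finset.mem_sdiff] at *; grind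
  · have e : X \ S = X := by
      ext x; have := @hX x
      simp only [Finset.mem_insert, Finset.mem_sdiff] at *; grind
    rw [d_con_of_notMem hsX, e]
    refine h _ (fun x hx => ?_) hne fun heq => ?_
    · have := @hX x; have := @hS x
      simp only [Finset.mem_insert, Finset.mem_sdiff] at *; grind
    · exact hsX (heq ▸ hS hs)

lemma card_con (hS : S ⊆ V) (hs : s ∈ S) : (insert s (V \ S)).card + S.card = V.card + 1 := by
  rw [Finset.card_insert_of_notMem (by simp [hs])]
  have := Finset.card_sdiff_add_card_eq_card hS
  omega

/-! ### Consequences of contraction in a minimal counterexample -/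

/-- Contractible sets yield doubled cycles. -/
lemma Ctx.dbl_con (c : Ctx M V a b) (hs : s ∈ S) (hS : S ⊆ V) (h2 : 2 ≤ S.card)
    (h3 : S.card + 3 ≤ V.card) (ha : a ∈ S → a = s) (hb : b ∈ S → b = s)
    (hmin : ∀ Y ⊆ S, s ∈ Y → d M S ≤ d M Y) : Dbl (con S s M) (insert s (V \ S)) := by
  have hc := card_con hS hs
  have hroot : ∀ x ∈ V, (x ∈ S → x = s) → x ∈ insert s (V \ S) := by
    intro x hx h
    simp only [Finset.mem_insert, Finset.mem_sdiff]; tauto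
  -- Contraction turns edges inside `S` into loops and keeps their number, so the measure drops
  -- through the vertices alone.
  rcases c.ih (con S s M) (insert s (V \ S)) (by simp only [con, Multiset.card_map]; omega)
    c.sup.con (c.ec.con hS hs) (by omega) (hroot a c.ha ha) (hroot b c.hb hb) with h | h | h
  · exact absurd (h.of_reach (reach_con hs hmin)) c.nk
  · exact h
  · exfalso
    -- The end set `Z` pulls back to a non-trivial cut of size three in `M`.
    obtain ⟨Z, Y, hZY, hYV, hd, hZ2, hY2, -, -⟩ := h
    have hZV := hZY.subset.trans hYV
    have hZc := Finset.card_le_card hZY.subset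
    have hVS : ∀ x, x ∈ Z → x ∈ V := by
      intro x hx
      have := hZV hx; have := @hS s hs
      simp only [Finset.mem_insert, Finset.mem_sdiff] at *; grind
    by_cases hsZ : s ∈ Z
    · rw [d_con_of_mem hsZ] at hd
      have e : Z ∪ S = (Z.erase s) ∪ S := by ext x; simp only [Finset.mem_union, Finset.mem_erase]; grind
      have hdis : Disjoint (Z.erase s) S := by
        rw [Finset.disjoint_left]
        intro x hx
        have := @hZV x
        simp only [Finset.mem_insert, Finset.mem_sdiff, Finset.mem_erase] at *; grind
      have hcard : (Z ∪ S).card = Z.card - 1 + S.card := by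
        rw [e, Finset.card_union_of_disjoint hdis, Finset.card_erase_of_mem hsZ]
      have := c.nt (Z ∪ S) (Finset.union_subset hVS hS) (by omega) (by omega)
      omega
    · have e : Z \ S = Z := by
        ext x; have := @hZV x
        simp only [Finset.mem_insert, Finset.mem_sdiff] at *; grind
      rw [d_con_of_notMem hsZ, e] at hd
      have := c.nt Z hVS hZ2 (by omega)
      omega

/-- A vertex of degree four in a doubled cycle has only two neighbours. -/
lemma mu_eq_zero_of_two (hxy : x ≠ y) (hxz : x ≠ z) (hyz : y ≠ z) (hd : d M {x} = 4)
    (hy : mu M x y = 2) (hz : mu M x z = 2) (hw : w ≠ x) (hwy : w ≠ y) (hwz : w ≠ z) :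
    mu M x w = 0 := by
  have := mu_add_mu_add_mu_le (M := M) hxy hxz hw.symm hyz hwy.symm hwz.symm
  omega

/-- Contracting `{x, y}` to `y` gives a doubled cycle, in which `y` has neighbours `z` and some `w`.
Each of `x`, `y` has only two edges leaving the pair, and `z` takes both edges of one of them; so
`w` takes both edges of the other, and `M` is itself a doubled cycle. -/
lemma Ctx.not_double_pair (c : Ctx M V a b) (hx : x ∈ V) (hy : y ∈ V) (hr : z ∈ V) (hxa : x ≠ a)
    (hxb : x ≠ b) (hxy : x ≠ y) (hzx : z ≠ x) (hzy : z ≠ y) (hm : mu M x y = 2)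
    (hdx : d M {x} = 4) (hdy : d M {y} = 4) (hz : mu M z x = 2 ∨ mu M z y = 2) : False := by
  have hS : ({x, y} : Finset α) ⊆ V := by
    intro t; simp only [Finset.mem_insert, Finset.mem_singleton]; grind
  have hcard : ({x, y} : Finset α).card = 2 := Finset.card_pair hxy
  have hpair := d_pair (M := M) hxy
  have hD := c.dbl_con (S := {x, y}) (s := y) (by simp) hS (by omega) (by have := c.five; omega)
    (by simp; tauto) (by simp; tauto) (fun Y hY hyY => by
      by_cases hxY : x ∈ Y
      · have : Y = {x, y} := hY.antisymm (by
          intro t; simp only [Finset.mem_insert, Finset.mem_singleton]; grind)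
        rw [this]
      · have : Y = {y} := by
          ext t; have := @hY t
          simp only [Finset.mem_insert, Finset.mem_singleton] at *; grind
        rw [this]; omega)
  have hV' : ∀ t, t ∈ insert y (V \ {x, y}) ↔ t ∈ V ∧ t ≠ x := by
    intro t
    simp only [Finset.mem_insert, Finset.mem_sdiff, Finset.mem_singleton]; grind
  have hd' : ∀ t, t ≠ x → t ≠ y → d (con {x, y} y M) {t} = d M {t} := by
    intro t h1 h2
    rw [d_con_of_notMem (by simpa using h2.symm)]
    congr 1
    ext u; simp only [Finset.mem_sdiff, Finset.mem_insert, Finset.mem_singleton]; grind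
  have hm' : ∀ t t', t ≠ x → t ≠ y → t' ≠ x → t' ≠ y → mu (con {x, y} y M) t t' = mu M t t' := by
    intro t t' h1 h2 h3 h4
    exact mu_con_of_notMem (by simp [h1, h2]) (by simp [h3, h4]) (by simp)
  have hmy : ∀ t, t ≠ x → t ≠ y → mu (con {x, y} y M) y t = mu M t x + mu M t y := by
    intro t h1 h2
    rw [mu_comm]; exact mu_con_pair hxy h1 h2
  obtain ⟨hy4, p, hp, q, hq, hpq, hyp, hyq, hmp, hmq⟩ := hD y ((hV' y).2 ⟨hy, hxy.symm⟩)
  rw [hV'] at hp hq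
  obtain ⟨w, hw, hwx, hwy, hwz, hmw⟩ : ∃ w ∈ V, w ≠ x ∧ w ≠ y ∧ w ≠ z ∧
      mu (con {x, y} y M) y w = 2 := by
    have hzpos := hmy z hzx hzy
    by_cases h1 : z = p
    · subst h1; exact ⟨q, hq.1, hq.2, hyq.symm, hpq.symm, hmq⟩
    · by_cases h2 : z = q
      · subst h2; exact ⟨p, hp.1, hp.2, hyp.symm, hpq, hmp⟩
      · have := mu_eq_zero_of_two hyp hyq hpq hy4 hmp hmq hzy h1 h2
        omega
  have hmz : mu (con {x, y} y M) y z = 2 := by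
    have hzpos := hmy z hzx hzy
    by_cases h1 : z = p
    · rw [h1]; exact hmp
    by_cases h2 : z = q
    · rw [h2]; exact hmq
    have := mu_eq_zero_of_two hyp hyq hpq hy4 hmp hmq hzy h1 h2
    omega
  have hno : ∀ t ∈ V, t ≠ x → t ≠ y → t ≠ z → t ≠ w → mu (con {x, y} y M) y t = 0 := by
    intro t _ h1 h2 h3 h4
    exact mu_eq_zero_of_two hzy.symm hwy.symm hwz.symm hy4 hmz hmw h2 h3 h4
  have hwy' := hmy w hwx hwy
  have hzy' := hmy z hzx hzy
  -- the other neighbour outside the pair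
  have other : ∀ t ∈ V, t ≠ x → t ≠ y → ∃ t' ∈ V, t' ≠ x ∧ t' ≠ y ∧ t ≠ t' ∧ mu M t t' = 2 := by
    intro t ht htx hty
    obtain ⟨-, p', hp', q', hq', hpq', htp, htq, hmp', hmq'⟩ := hD t ((hV' t).2 ⟨ht, htx⟩)
    rw [hV'] at hp' hq'
    by_cases h1 : p' = y
    · have h2 : q' ≠ y := fun h => hpq' (h1.trans h.symm)
      exact ⟨q', hq'.1, hq'.2, h2, htq, by rw [← hm' t q' htx hty hq'.2 h2]; exact hmq'⟩
    · exact ⟨p', hp'.1, hp'.2, h1, htp, by rw [← hm' t p' htx hty hp'.2 h1]; exact hmp'⟩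
  have two : mu M z x = 2 ∧ mu M z y = 0 ∧ mu M w x = 0 ∧ mu M w y = 2 ∨
      mu M z x = 0 ∧ mu M z y = 2 ∧ mu M w x = 2 ∧ mu M w y = 0 := by
    have e1 := mu_add_mu_add_mu_le (M := M) hxy hzx.symm hwx.symm hzy.symm hwy.symm hwz.symm
    have e2 := mu_add_mu_add_mu_le (M := M) hxy.symm hzy.symm hwy.symm hzx.symm hwx.symm hwz.symm
    rw [mu_comm M x z, mu_comm M x w] at e1
    rw [mu_comm M y z, mu_comm M y w, mu_comm M y x] at e2
    omega
  refine c.nd fun t ht => ?_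
  by_cases htx : t = x
  · subst htx
    refine ⟨hdx, y, hy, ?_⟩
    rcases two with h | h
    · exact ⟨z, hr, hzy.symm, hxy, hzx.symm, hm, by rw [mu_comm]; exact h.1⟩
    · exact ⟨w, hw, hwy.symm, hxy, hwx.symm, hm, by rw [mu_comm]; exact h.2.2.1⟩
  by_cases hty : t = y
  · subst hty
    refine ⟨hdy, x, hx, ?_⟩
    rw [mu_comm] at hm
    rcases two with h | h
    · exact ⟨w, hw, hwx.symm, hxy.symm, hwy.symm, hm, by rw [mu_comm]; exact h.2.2.2⟩
    · exact ⟨z, hr, hzx.symm, hxy.symm, hzy.symm, hm, by rw [mu_comm]; exact h.2.1⟩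
  obtain ⟨ht4, p', hp', q', hq', hpq', htp, htq, hmp', hmq'⟩ := hD t ((hV' t).2 ⟨ht, htx⟩)
  rw [hd' t htx hty] at ht4
  refine ⟨ht4, ?_⟩
  obtain ⟨t', ht', htx', hty', htt', hmt'⟩ := other t ht htx hty
  by_cases htz : t = z
  · subst htz
    rcases two with h | h
    · exact ⟨x, hx, t', ht', htx'.symm, htx, htt', h.1, hmt'⟩
    · exact ⟨y, hy, t', ht', hty'.symm, hty, htt', h.2.1, hmt'⟩
  by_cases htw : t = w
  · subst htw
    rcases two with h | h
    · exact ⟨y, hy, t', ht', hty'.symm, hty, htt', h.2.2.2, hmt'⟩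
    · exact ⟨x, hx, t', ht', htx'.symm, htx, htt', h.2.2.1, hmt'⟩
  rw [hV'] at hp' hq'
  have h0 := hno t ht htx hty htz htw
  have hpy : p' ≠ y := by rintro rfl; rw [mu_comm] at hmp'; omega
  have hqy : q' ≠ y := by rintro rfl; rw [mu_comm] at hmq'; omega
  rw [hm' t p' htx hty hp'.2 hpy] at hmp'
  rw [hm' t q' htx hty hq'.2 hqy] at hmq'
  exact ⟨p', hp'.1, q', hq'.1, hpq', htp, htq, hmp', hmq'⟩

/-- In a minimal counterexample, a set whose only root can be `s` has more leaving edges than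
`s`. -/
lemma Ctx.d_lt (c : Ctx M V a b) (hs : s ∈ S) (hS : S ⊆ V) (h2 : 2 ≤ S.card)
    (h3 : S.card + 3 ≤ V.card) (ha : a ∈ S → a = s) (hb : b ∈ S → b = s) :
    d M {s} < d M S := by
  by_contra hlt
  push Not at hlt
  -- If `{s}` minimises the cut, then so does `S` by the assumption to be refuted; hence a minimiser
  -- with at least two elements exists. Contracting it gives a doubled cycle.
  obtain ⟨T, hTS, hsT, hT2, hTmin⟩ : ∃ T ⊆ S, s ∈ T ∧ 2 ≤ T.card ∧
      ∀ Y ⊆ S, s ∈ Y → d M T ≤ d M Y := by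
    obtain ⟨T, hT, hmin⟩ := Finset.exists_min_image (S.powerset.filter (s ∈ ·)) (d M)
      ⟨S, by simp [hs]⟩
    simp only [Finset.mem_filter, Finset.mem_powerset] at hT hmin
    by_cases hc : 2 ≤ T.card
    · exact ⟨T, hT.1, hT.2, hc, fun Y h1 h2 => hmin Y ⟨h1, h2⟩⟩
    · have : T = {s} := by
        have hpos : 0 < T.card := Finset.card_pos.2 ⟨s, hT.2⟩
        obtain ⟨t, rfl⟩ := Finset.card_eq_one.1 (by omega : T.card = 1)
        have := hT.2
        simp only [Finset.mem_singleton] at this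
        rw [this]
      subst this
      exact ⟨S, subset_rfl, hs, h2, fun Y h1 h2 => hlt.trans (hmin Y ⟨h1, h2⟩)⟩
  have hTV := hTS.trans hS
  have hTc := Finset.card_le_card hTS
  have hD := c.dbl_con hsT hTV hT2 (by omega) (fun h => ha (hTS h)) (fun h => hb (hTS h))
    (fun Y hY => hTmin Y (hY.trans hTS))
  have hec := c.ec.con hTV hsT
  have hsup := c.sup.con (S := T) (s := s)
  have hcc := card_con hTV hsT
  -- a vertex outside which is not a root
  obtain ⟨x, hx, hxa, hxb⟩ : ∃ x ∈ V \ T, x ≠ a ∧ x ≠ b := by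
    have h4 : ({a, b} : Finset α).card < (V \ T).card := by
      have := Finset.card_sdiff_add_card_eq_card hTV
      have := Finset.card_le_two (a := a) (b := b)
      omega
    obtain ⟨x, hx, hx'⟩ := Finset.exists_mem_notMem_of_card_lt_card h4
    simp only [Finset.mem_insert, Finset.mem_singleton, not_or] at hx'
    exact ⟨x, hx, hx'⟩
  rw [Finset.mem_sdiff] at hx
  have hV' : ∀ t, t ∈ insert s (V \ T) ↔ t = s ∨ (t ∈ V ∧ t ∉ T) := by
    intro t; simp
  have hne : ∀ t, t ∉ T → t ≠ s := by rintro t ht rfl; exact ht hsT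
  have hd' : ∀ t ∉ T, d (con T s M) {t} = d M {t} := by
    intro t ht
    rw [d_con_of_notMem (by simpa using (hne t ht).symm), Finset.sdiff_eq_self_of_disjoint]
    simpa using ht
  have hm' : ∀ t ∉ T, ∀ t' ∉ T, mu (con T s M) t t' = mu M t t' :=
    fun t h1 t' h2 => mu_con_of_notMem h1 h2 hsT
  -- every vertex outside has a doubled neighbour outside
  have nb : ∀ t ∈ V, t ∉ T → ∃ y ∈ V, y ∉ T ∧ t ≠ y ∧ mu M t y = 2 ∧ ∃ z, (z = s ∨ (z ∈ V ∧ z ∉ T)) ∧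
      y ≠ z ∧ t ≠ z ∧ mu (con T s M) t z = 2 := by
    intro t ht htT
    obtain ⟨-, p, hp, q, hq, hpq, htp, htq, hmp, hmq⟩ := hD t ((hV' t).2 (Or.inr ⟨ht, htT⟩))
    have hp' := (hV' p).1 hp; have hq' := (hV' q).1 hq
    rcases hp' with rfl | hp'
    · rcases hq' with rfl | hq'
      · exact absurd rfl hpq
      · exact ⟨q, hq'.1, hq'.2, htq, by rw [← hm' t htT q hq'.2]; exact hmq, p, Or.inl rfl, hpq.symm,
          htp, hmp⟩
    · exact ⟨p, hp'.1, hp'.2, htp, by rw [← hm' t htT p hp'.2]; exact hmp, q, hq', hpq, htq, hmq⟩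
  have hd4 : ∀ t ∈ V, t ∉ T → d M {t} = 4 := by
    intro t ht htT
    rw [← hd' t htT]; exact (hD t ((hV' t).2 (Or.inr ⟨ht, htT⟩))).1
  obtain ⟨y, hy, hyT, hxy, hmxy, z, hz, hyz, hxz, hmz⟩ := nb x hx.1 hx.2
  -- `not_double_pair` needs three consecutive vertices of the doubled cycle that avoid the
  -- contracted vertex. If the second neighbour of `x` is that vertex, the path is continued beyond
  -- `y` instead.
  rcases hz with rfl | hz
  · obtain ⟨-, p, hp, q, hq, hpq, hyp, hyq, hmp, hmq⟩ := hD y ((hV' y).2 (Or.inr ⟨hy, hyT⟩))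
    obtain ⟨r, hr, hrx, hyr, hmr⟩ : ∃ r, r ∈ insert z (V \ T) ∧ r ≠ x ∧ y ≠ r ∧
        mu (con T z M) y r = 2 := by
      by_cases h : p = x
      · exact ⟨q, hq, fun h' => hpq (h.trans h'.symm), hyq, hmq⟩
      · exact ⟨p, hp, h, hyp, hmp⟩
    have hr' := (hV' r).1 hr
    rcases hr' with rfl | hr'
    · -- then `{x, y, s}` is closed
      have hxy' := mu_comm (con T r M) x y
      have e1 := hm' x hx.2 y hyT
      have hx4 := (hD x ((hV' x).2 (Or.inr hx))).1
      have hy4 := (hD y ((hV' y).2 (Or.inr ⟨hy, hyT⟩))).1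
      have hr4 := (hD r hr).1
      have hne : x ∉ ({y, r} : Finset α) := by simp [hxy, hxz]
      have e2 := d_insert (M := con T r M) hne
      have e3 := d_pair (M := con T r M) hyz
      have e4 : btw (con T r M) {x} {y, r} = mu (con T r M) x y + mu (con T r M) x r := by
        rw [← btw_singleton hxy, ← btw_singleton hxz]
        exact btw_union_right (X := {y}) (Y := {r}) (by simpa using hyz) {x} (by simpa using hxy)
          (by simpa using hxz)
      have hcard : ({x, y, r} : Finset α).card ≤ 3 := Finset.card_le_three
      have hsub : ({x, y, r} : Finset α) ⊆ insert r (V \ T) := by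
        intro t; simp only [Finset.mem_insert, Finset.mem_singleton, Finset.mem_sdiff]
        have := hx.1; have := hx.2; grind
      have := hec {x, y, r} hsub ⟨x, by simp⟩ (by intro h; rw [← h] at hcc; omega)
      omega
    · refine c.not_double_pair hx.1 hy hr'.1 hxa hxb hxy hrx hyr.symm hmxy (hd4 x hx.1 hx.2)
        (hd4 y hy hyT) (Or.inr ?_)
      rw [← hm' r hr'.2 y hyT, mu_comm]; exact hmr
  · refine c.not_double_pair hx.1 hy hz.1 hxa hxb hxy hxz.symm hyz.symm hmxy (hd4 x hx.1 hx.2)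
      (hd4 y hy hyT) (Or.inl ?_)
    rw [← hm' z hz.2 x hx.2, mu_comm]; exact hmz

/-- Two-element sets and stars decide `3`-edge-connectivity. -/
lemma EC.of_two (hM : Sup M V) (h1 : ∀ x ∈ V, 3 ≤ d M {x})
    (h2 : ∀ X ⊆ V, 2 ≤ X.card → X.card + 2 ≤ V.card → 3 ≤ d M X) : EC M V := by
  intro X hX hne hne'
  have hc := Finset.card_sdiff_add_card_eq_card hX
  have hpos := hne.card_pos
  have hlt := Finset.card_lt_card (hX.ssubset_of_ne hne')
  by_cases e1 : X.card = 1
  · obtain ⟨x, rfl⟩ := Finset.card_eq_one.1 e1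
    exact h1 x (by simpa using hX)
  by_cases e2 : (V \ X).card = 1
  · obtain ⟨x, hx⟩ := Finset.card_eq_one.1 e2
    rw [← hM.d_compl, hx]
    have : x ∈ V \ X := by rw [hx]; simp
    exact h1 x (Finset.mem_sdiff.1 this).1
  · exact h2 X hX (by omega) (by omega)

lemma Ctx.three_le (c : Ctx M V a b) (hx : x ∈ V) : 3 ≤ d M {x} :=
  c.ec.three_le hx (by have := c.five; omega)

/-- In a minimal counterexample, less than half of the edges at a vertex that is not a root are
parallel. -/
lemma Ctx.two_mul_mu_lt (c : Ctx M V a b) (hx : x ∈ V) (hy : y ∈ V) (hxy : x ≠ y) (hxa : x ≠ a)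
    (hxb : x ≠ b) : 2 * mu M x y < d M {x} := by
  have h5 := c.five
  -- Here `y` is the distinguished vertex of the pair, as it may be a root, and `d {y} < d {x, y}`
  -- unfolds to the claim.
  have h1 := c.d_lt (s := y) (S := {x, y}) (by simp)
    (by intro t; simp only [Finset.mem_insert, Finset.mem_singleton]; grind)
    (by rw [Finset.card_pair hxy]) (by rw [Finset.card_pair hxy]; omega)
    (by simp only [Finset.mem_insert, Finset.mem_singleton]; tauto)
    (by simp only [Finset.mem_insert, Finset.mem_singleton]; tauto)
  have := d_pair (M := M) hxy
  omega

lemma Ctx.exists_not_root (c : Ctx M V a b) (u v : α) :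
    ∃ x ∈ V, x ≠ a ∧ x ≠ b ∧ x ≠ u ∧ x ≠ v := by
  have h4 : ({a, b, u, v} : Finset α).card < V.card := by
    have := Finset.card_le_four (a := a) (b := b) (c := u) (d := v)
    have := c.five
    omega
  obtain ⟨x, hx, hx'⟩ := Finset.exists_mem_notMem_of_card_lt_card h4
  simp only [Finset.mem_insert, Finset.mem_singleton, not_or] at hx'
  exact ⟨x, hx, hx'⟩

/-- A set with small boundary in a minimal counterexample contains a root besides any given
vertex of large degree. -/
lemma Ctx.exists_root (c : Ctx M V a b) (hX : X ⊆ V) (h2 : 2 ≤ X.card) (h3 : X.card + 3 ≤ V.card)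
    (hu : u ∈ X) (hd : d M X ≤ d M {u}) : ∃ t ∈ X, t ≠ u ∧ (t = a ∨ t = b) := by
  by_contra! hcon
  have := c.d_lt hu hX h2 h3 (fun h => by_contra fun h' => (hcon a h h').1 rfl)
    (fun h => by_contra fun h' => (hcon b h h').2 rfl)
  omega

/-- If a set is the boundary of exactly one root, then this root has degree three. -/
lemma Ctx.d_root (c : Ctx M V a b) (hX : X ⊆ V) (h2 : 2 ≤ X.card) (h3 : X.card + 3 ≤ V.card)
    (hd : d M X = 4) {t t' : α} (ht : t ∈ X) (ht' : t' ∉ X) (hr : t = a ∧ t' = b ∨ t = b ∧ t' = a) :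
    d M {t} = 3 := by
  have h1 := c.d_lt ht hX h2 h3 (by rintro h; grind) (by rintro h; grind)
  have := c.three_le (hX ht)
  omega

lemma eq_pair_of_card_eq_two (h : S.card = 2) (hx : x ∈ S) (hy : y ∈ S) (hxy : x ≠ y) : S = {x, y} := by
  symm
  refine Finset.eq_of_subset_of_card_le ?_ (by rw [h, Finset.card_pair hxy])
  intro t; simp only [Finset.mem_insert, Finset.mem_singleton]; rintro (rfl | rfl) <;> assumption

end EdgeMultiset

end

/-! ### Edges between vertices of large degree, and cubic vertices -/

noncomputable section

namespace EdgeMultiset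

open scoped Classical

variable {α : Type*} {M N R : Multiset (Sym2 α)} {X Y Z S V : Finset α} {x y z w a b s p u v : α}

/-- An edge between two vertices of degree at least four in a minimal counterexample. -/
lemma Ctx.of_high_edge (c : Ctx M V a b) (he : s(u, v) ∈ M) (huv : u ≠ v) (hu : 4 ≤ d M {u})
    (hv : 4 ≤ d M {v}) : d M {a, b} = 4 ∧ ((u = a ∨ u = b) ∨ (v = a ∨ v = b)) := by
  obtain ⟨huV, hvV⟩ := c.sup u v he huv
  have h5 := c.five
  obtain ⟨R, hM⟩ := Multiset.exists_cons_of_mem he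
  have hdM : ∀ X, d M X = cr X s(u, v) + d R X := fun X => by rw [hM, d_cons]
  have hRM : R ≤ M := hM ▸ Multiset.le_cons_self _ _
  have hsup : Sup R V := c.sup.mono hRM
  -- Deleting the edge costs each cut at most one edge; non-trivial cuts and the two end vertices
  -- had at least four.
  have hec : EC R V := by
    refine EC.of_two hsup (fun x hx => ?_) (fun X hX h1 h2 => ?_)
    · have h3 := c.three_le hx
      have h4 := hdM {x}
      simp only [cr_mk, Finset.mem_singleton] at h4
      by_cases hxu : u = x
      · subst hxu; simp [huv.symm] at h4; omega
      · by_cases hxv : v = x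
        · subst hxv; simp [huv] at h4; omega
        · simp [hxu, hxv] at h4; omega
    · have h3 := c.nt X hX h1 h2
      have h4 := hdM X
      rw [cr_mk] at h4
      split_ifs at h4 <;> omega
  rcases c.ih R V (by rw [hM]; simp) hsup hec (by omega) c.ha c.hb with h | h | ⟨Z, Y, h⟩
  · exact absurd (h.of_reach (.of_le hRM)) c.nk
  · exfalso
    obtain ⟨x, hx, hxa, hxb, hxu, hxv⟩ := c.exists_not_root u v
    obtain ⟨h4, y, hy, z, hz, hyz, hxy, hxz, hmy, -⟩ := h x hx
    have h1 := c.two_mul_mu_lt hx hy hxy hxa hxb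
    have h2 : mu R x y ≤ mu M x y := wt_mono hRM _
    have h3 := hdM {x}
    simp [hxu.symm, hxv.symm] at h3
    omega
  -- The cuts of the segmentation have three edges in `R` but at least four in `M`, so each
  -- separates `u` from `v`. By symmetry `u` lies in `Z`, and then `v` lies outside `Y`.
  wlog huZ : u ∈ Z generalizing u v
  · have hvZ : v ∈ Z := by
      by_contra hvZ
      obtain ⟨h1, h2, h3, h4⟩ := h.between (.refl _ _) h.chain
      have h5 := hdM Z
      have h6 := c.nt Z h1 h3 h4
      simp [huZ, hvZ] at h5
      omega
    rw [Sym2.eq_swap] at he hM hdM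
    have := this he huv.symm hv hu hvV huV hM hdM hvZ
    tauto
  have hZ := h.between (.refl _ _) h.chain
  have hY := h.between h.chain (.refl _ _)
  have hvZ : v ∉ Z := by
    intro hvZ
    have h6 := c.nt Z hZ.1 hZ.2.2.1 hZ.2.2.2
    have h5 := hdM Z
    simp [huZ, hvZ] at h5
    omega
  have huY := h.chain.subset huZ
  have hvY : v ∉ Y := by
    intro hvY
    have h6 := c.nt Y hY.1 hY.2.2.1 hY.2.2.2
    have h5 := hdM Y
    simp [huY, hvY] at h5
    omega
  have hdZ : d M Z = 4 := by have := hdM Z; simp [huZ, hvZ] at this; omega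
  have hdY : d M Y = 4 := by have := hdM Y; simp [huY, hvY] at this; omega
  have hcZ := Finset.card_sdiff_add_card_eq_card hZ.1
  have hcY := Finset.card_sdiff_add_card_eq_card hY.1
  -- If only two vertices lie outside `Z`, then `Z` is large, hence free of roots, and these two are
  -- `a` and `b`. The case that `Y` has only two elements is dual.
  by_cases hZ3 : Z.card + 3 ≤ V.card
  swap
  · obtain ⟨haZ, hbZ⟩ := h.left (by omega)
    have e := eq_pair_of_card_eq_two (S := V \ Z) (by omega) (by simp [haZ, c.ha]) (by simp [hbZ, c.hb])
      c.hab
    refine ⟨by rw [← e, c.sup.d_compl, hdZ], Or.inr ?_⟩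
    have : v ∈ V \ Z := by simp [hvV, hvZ]
    rw [e] at this
    simpa using this
  by_cases hY3 : 3 ≤ Y.card
  swap
  · obtain ⟨haY, hbY⟩ := h.right (by omega)
    have e := eq_pair_of_card_eq_two (S := Y) (by omega) haY hbY c.hab
    refine ⟨by rw [← e, hdY], Or.inl ?_⟩
    rw [e] at huY
    simpa using huY
  exfalso
  -- Each end set has boundary four, no more than the degree of `u` or `v` in it, so it contains a
  -- further root and therefore just two vertices. The chain joins `{t, u}` to `{t', v}` and yields
  -- a `K₄` containing both roots.
  obtain ⟨t, htZ, htu, htr⟩ := c.exists_root hZ.1 hZ.2.2.1 hZ3 huZ (by omega)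
  have hdYc : d M (V \ Y) = 4 := by rw [c.sup.d_compl, hdY]
  have hvW : v ∈ V \ Y := by simp [hvV, hvY]
  obtain ⟨t', htW, htv, htr'⟩ := c.exists_root (X := V \ Y) Finset.sdiff_subset (by omega) (by omega)
    hvW (by omega)
  have htY := h.chain.subset htZ
  have htt' : t ≠ t' := by rintro rfl; exact (Finset.mem_sdiff.1 htW).2 htY
  have hZ2 : Z.card = 2 := by
    by_contra hne
    have := h.left (by omega)
    rcases htr with rfl | rfl <;> tauto
  have hW2 : (V \ Y).card = 2 := by
    by_contra hne
    have := h.right (by omega)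
    rw [Finset.mem_sdiff] at htW
    rcases htr' with rfl | rfl <;> tauto
  have eZ := eq_pair_of_card_eq_two hZ2 htZ huZ htu
  have eW := eq_pair_of_card_eq_two hW2 htW hvW htv
  have ht'Z : t' ∉ Z := fun hh => (Finset.mem_sdiff.1 htW).2 (h.chain.subset hh)
  have ht3 := c.d_root hZ.1 hZ.2.2.1 hZ3 hdZ htZ ht'Z (by grind)
  have hch : Chain M Z Y := h.chain.congr (c := 1) fun X h1 h2 => by
    rw [hdM, cr_mk]
    have h3 : u ∈ X := h1 huZ
    have h4 : v ∉ X := fun hh => hvY (h2 hh)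
    simp [h3, h4, add_comm]
  rw [eZ] at hch hdZ
  have hp := d_pair (M := M) htu
  have hK := K4set_of_chain c.sup hch eW htu htv ht3 (by omega) (by omega)
    (c.three_le (Finset.mem_sdiff.1 htW).1) (by omega) (by omega)
  exact c.nk ⟨_, by grind, by grind, hK⟩

/-! ### Suppressing a vertex of degree three -/

/-- The edges at the vertex `v` of degree three lead to the distinct vertices `u`, `y`, `z`. -/
structure Cubic (M : Multiset (Sym2 α)) (V : Finset α) (a b v u y z : α)
    (R : Multiset (Sym2 α)) : Prop where
  eq : M = s(u, v) ::ₘ s(v, y) ::ₘ s(v, z) ::ₘ R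
  hv : v ∈ V
  hu : u ∈ V
  hy : y ∈ V
  hz : z ∈ V
  huv : u ≠ v
  hyv : y ≠ v
  hzv : z ≠ v
  huy : u ≠ y
  huz : u ≠ z
  hyz : y ≠ z
  va : v ≠ a
  vb : v ≠ b
  iso : d R {v} = 0

lemma exists_edge_of_pos (h : 0 < d M {v}) : ∃ z, z ≠ v ∧ s(v, z) ∈ M := by
  obtain ⟨z, -, h1, h2⟩ := exists_edge_of_btw_lt (M := M) (p := v) (S := ∅)
    (lt_of_eq_of_lt (wt_eq_zero_iff.2 fun e _ => by induction e with | _ p q; simp) h)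
  exact ⟨z, h1, h2⟩

/-- No two of the three edges at `v` are parallel, by `two_mul_mu_lt`. -/
lemma Ctx.exists_cubic (c : Ctx M V a b) (hd : d M {v} = 3) (va : v ≠ a) (vb : v ≠ b)
    (he : s(u, v) ∈ M) (huv : u ≠ v) : ∃ y z R, Cubic M V a b v u y z R := by
  obtain ⟨huV, hvV⟩ := c.sup u v he huv
  have hmu : ∀ x ∈ V, v ≠ x → mu M v x ≤ 1 := by
    intro x hx hvx
    have := c.two_mul_mu_lt hvV hx hvx va vb
    omega
  have h1 := hmu u huV huv.symm
  obtain ⟨y, hyv, hyu, hy⟩ := exists_edge_of_mu_lt (M := M) huv.symm (by omega)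
  have hyV := (c.sup v y hy hyv.symm).2
  have h2 := hmu y hyV hyv.symm
  obtain ⟨R1, rfl⟩ := exists_cons_cons he hy (by simp only [ne_eq, Sym2.eq_iff]; grind)
  have h3 : d R1 {v} = 1 := by simp [huv, hyv] at hd; omega
  obtain ⟨z, hzv, hz⟩ := exists_edge_of_pos (M := R1) (v := v) (by omega)
  obtain ⟨R, rfl⟩ := Multiset.exists_cons_of_mem hz
  have hzV := (c.sup v z (by simp) hzv.symm).2
  refine ⟨y, z, R, rfl, hvV, huV, hyV, hzV, huv, hyv, hzv, hyu.symm, ?_, ?_, va, vb, ?_⟩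
  · rintro rfl
    simp [Sym2.eq_swap] at h1
  · rintro rfl
    simp at h2
    omega
  · simpa [hzv] using h3

lemma btw_le (h : p ∉ S) : btw M {p} S ≤ d M {p} := by
  refine wt_le fun e _ => ?_
  induction e with | _ x y
  simp only [bt_mk, cr_mk, Finset.mem_singleton]
  grind

lemma d_insert_of_iso (h : d R {v} = 0) (hv : v ∉ X) : d R (insert v X) = d R X := by
  have h1 := d_insert (M := R) hv
  have h2 := btw_le (M := R) hv
  omega

namespace Cubic

lemma swap (k : Cubic M V a b v u y z R) : Cubic M V a b v u z y R where
  eq := by rw [k.eq, Multiset.cons_swap s(v, y)]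
  hv := k.hv
  hu := k.hu
  hy := k.hz
  hz := k.hy
  huv := k.huv
  hyv := k.hzv
  hzv := k.hyv
  huy := k.huz
  huz := k.huy
  hyz := k.hyz.symm
  va := k.va
  vb := k.vb
  iso := k.iso

lemma d_of_notMem (k : Cubic M V a b v u y z R) (hv : v ∉ X) :
    d M X = (if u ∈ X then 1 else 0) + (if y ∈ X then 1 else 0) + (if z ∈ X then 1 else 0) +
      d R X := by
  rw [k.eq]
  by_cases h1 : u ∈ X <;> by_cases h2 : y ∈ X <;> by_cases h3 : z ∈ X <;>
    simp [hv, h1, h2, h3] <;> omega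

lemma d_insert (k : Cubic M V a b v u y z R) (hv : v ∉ X) :
    d M (insert v X) = (if u ∈ X then 0 else 1) + (if y ∈ X then 0 else 1) +
      (if z ∈ X then 0 else 1) + d R X := by
  rw [k.eq]
  by_cases h1 : u ∈ X <;> by_cases h2 : y ∈ X <;> by_cases h3 : z ∈ X <;>
    simp [h1, h2, h3, k.huv, k.hyv, k.hzv, d_insert_of_iso k.iso hv] <;> omega

lemma sup_R (k : Cubic M V a b v u y z R) (hM : Sup M V) : Sup R (V.erase v) := by
  refine Sup.of_d_eq_zero (V := V) (hM.mono ?_) fun x hx hxv => ?_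
  · rw [k.eq]
    exact (Multiset.le_cons_self _ _).trans ((Multiset.le_cons_self _ _).trans
      (Multiset.le_cons_self _ _))
  · obtain rfl : x = v := by simpa [hx] using hxv
    exact k.iso

lemma sup_cons (h : Sup R V) (hy : y ∈ V) (hz : z ∈ V) : Sup (s(y, z) ::ₘ R) V := by
  intro p q hpq hne
  rcases Multiset.mem_cons.1 hpq with h1 | h1
  · rcases Sym2.eq_iff.1 h1 with ⟨rfl, rfl⟩ | ⟨rfl, rfl⟩
    · exact ⟨hy, hz⟩
    · exact ⟨hz, hy⟩
  · exact h p q h1 hne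

lemma reach (k : Cubic M V a b v u y z R) : Reach M (s(y, z) ::ₘ R) := by
  rw [k.eq, Sym2.eq_swap (a := v) (b := y)]
  exact (Reach.of_le (Multiset.le_cons_self _ _)).trans (.split R y v z)

/-- The alternative suppression, which sacrifices the edge to `y` instead of the edge to `u`; it
serves `pinch`. -/
lemma reach' (k : Cubic M V a b v u y z R) : Reach M (s(u, z) ::ₘ R) := by
  rw [k.eq, Multiset.cons_swap s(v, y), Multiset.cons_swap s(u, v), Multiset.cons_swap s(u, v),
    Multiset.cons_swap s(v, z)]
  refine (Reach.of_le (Multiset.le_cons_self _ _)).trans ?_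
  rw [Multiset.cons_swap]
  exact .split R u v z

end Cubic

end EdgeMultiset

end

/-! ### Segmentations after suppressing a cubic vertex -/

noncomputable section

namespace EdgeMultiset

open scoped Classical

variable {α : Type*} {M N R : Multiset (Sym2 α)} {X Y Z S V : Finset α} {x y z w a b s p u v : α}

/-- Among the two roots, one is `x` and the other one is `y`. -/
def AreRoots (a b x y : α) : Prop := x = a ∧ y = b ∨ x = b ∧ y = a

lemma exists_areRoots (h : x = a ∨ x = b) : ∃ y, AreRoots a b x y := by
  rcases h with rfl | rfl
  · exact ⟨b, Or.inl ⟨rfl, rfl⟩⟩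
  · exact ⟨a, Or.inr ⟨rfl, rfl⟩⟩

lemma AreRoots.left (h : AreRoots a b x y) : x = a ∨ x = b := by
  rcases h with h | h <;> simp [h.1]

lemma AreRoots.right (h : AreRoots a b x y) : y = a ∨ y = b := by
  rcases h with h | h <;> simp [h.2]

lemma AreRoots.eq_right (h : AreRoots a b x y) (hz : z = a ∨ z = b) (hzx : z ≠ x) : z = y := by
  rcases h with ⟨rfl, rfl⟩ | ⟨rfl, rfl⟩ <;> tauto

lemma AreRoots.pair (h : AreRoots a b x y) : ({x, y} : Finset α) = {a, b} := by
  rcases h with ⟨rfl, rfl⟩ | ⟨rfl, rfl⟩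
  · rfl
  · exact Finset.pair_comm _ _

lemma AreRoots.ne (h : AreRoots a b x y) (hab : a ≠ b) : x ≠ y := by
  rcases h with ⟨rfl, rfl⟩ | ⟨rfl, rfl⟩
  · exact hab
  · exact hab.symm

lemma AreRoots.symm (h : AreRoots a b x y) : AreRoots a b y x := by
  rcases h with ⟨rfl, rfl⟩ | ⟨rfl, rfl⟩
  · exact Or.inr ⟨rfl, rfl⟩
  · exact Or.inl ⟨rfl, rfl⟩

lemma Ctx.root_mem (c : Ctx M V a b) (h : x = a ∨ x = b) : x ∈ V := by
  rcases h with rfl | rfl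
  · exact c.ha
  · exact c.hb

lemma btw_pair (hxy : x ≠ y) (hxz : x ≠ z) (hyz : y ≠ z) :
    btw M {x} {y, z} = mu M x y + mu M x z := by
  rw [← btw_singleton hxy, ← btw_singleton hxz]
  exact btw_union_right (X := {y}) (Y := {z}) (by simpa using hyz) {x} (by simpa using hxy)
    (by simpa using hxz)

namespace Cubic

lemma u_mem (k : Cubic M V a b v u y z R) : u ∈ V.erase v := by simp [k.hu, k.huv]
lemma y_mem (k : Cubic M V a b v u y z R) : y ∈ V.erase v := by simp [k.hy, k.hyv]
lemma z_mem (k : Cubic M V a b v u y z R) : z ∈ V.erase v := by simp [k.hz, k.hzv]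

lemma root_mem (k : Cubic M V a b v u y z R) (c : Ctx M V a b) (h : x = a ∨ x = b) :
    x ∈ V.erase v := by
  refine Finset.mem_erase.2 ⟨?_, c.root_mem h⟩
  rintro rfl
  rcases h with h | h
  · exact k.va h
  · exact k.vb h

lemma card_erase (k : Cubic M V a b v u y z R) : (V.erase v).card + 1 = V.card :=
  Finset.card_erase_add_one k.hv

lemma R_le (k : Cubic M V a b v u y z R) : R ≤ M := by
  rw [k.eq]
  exact (Multiset.le_cons_self _ _).trans ((Multiset.le_cons_self _ _).trans
      (Multiset.le_cons_self _ _))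

lemma card_lt (k : Cubic M V a b v u y z R) : (s(y, z) ::ₘ R).card + (V.erase v).card <
    M.card + V.card := by
  have := k.card_erase
  rw [k.eq]; simp only [Multiset.card_cons]; omega

lemma sup_N (k : Cubic M V a b v u y z R) (c : Ctx M V a b) : Sup (s(y, z) ::ₘ R) (V.erase v) :=
  sup_cons (k.sup_R c.sup) k.y_mem k.z_mem

lemma d_single (k : Cubic M V a b v u y z R) (hx : x ≠ v) (hxu : x ≠ u) :
    d (s(y, z) ::ₘ R) {x} = d M {x} := by
  rw [k.d_of_notMem (by simpa using hx.symm), d_cons, cr_mk]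
  have h3 := k.hyz
  by_cases h1 : y = x
  · subst h1; simp [hxu.symm, h3.symm]
  · simp [hxu.symm, h1]

/-- Both `X` and `insert v X` have at least four leaving edges in `M`. With `v` on the cheaper side,
the suppression loses at most the edge `uv`, and a cut drops to three only when `u` is the sole
neighbour of `v` in `X`. -/
lemma d_side (k : Cubic M V a b v u y z R) (c : Ctx M V a b) (hX : X ⊆ V.erase v) (hu : u ∈ X)
    (h2 : 2 ≤ X.card) (h3 : X.card + 2 ≤ (V.erase v).card) :
    3 ≤ d (s(y, z) ::ₘ R) X ∧ (d (s(y, z) ::ₘ R) X = 3 → d M X = 4 ∧ y ∉ X ∧ z ∉ X) := by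
  have hvX : v ∉ X := fun h => by simpa using hX h
  have hc := k.card_erase
  have e1 := k.d_of_notMem hvX
  have e2 := k.d_insert hvX
  have n1 := c.nt X (hX.trans (Finset.erase_subset _ _)) h2 (by omega)
  have n2 := c.nt (insert v X) (Finset.insert_subset k.hv (hX.trans (Finset.erase_subset _ _)))
    (by rw [Finset.card_insert_of_notMem hvX]; omega)
    (by rw [Finset.card_insert_of_notMem hvX]; omega)
  rw [d_cons, cr_mk]
  by_cases h1 : y ∈ X <;> by_cases h2 : z ∈ X <;> simp only [hu, h1, h2, if_true, if_false] at e1 e2 ⊢ <;>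
    simp <;> omega

lemma d_side_compl (k : Cubic M V a b v u y z R) (c : Ctx M V a b) (hX : X ⊆ V.erase v)
    (hu : u ∉ X) (h2 : 2 ≤ X.card) (h3 : X.card + 2 ≤ (V.erase v).card) :
    3 ≤ d (s(y, z) ::ₘ R) X ∧ (d (s(y, z) ::ₘ R) X = 3 →
      d M (insert v X) = 4 ∧ d M (V.erase v \ X) = 4 ∧ y ∈ X ∧ z ∈ X) := by
  have hc := Finset.card_sdiff_add_card_eq_card hX
  have h := k.d_side c (X := V.erase v \ X) Finset.sdiff_subset
    (Finset.mem_sdiff.2 ⟨k.u_mem, hu⟩) (by omega) (by omega)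
  rw [(k.sup_N c).d_compl] at h
  refine ⟨h.1, fun h' => ?_⟩
  obtain ⟨h4, h5, h6⟩ := h.2 h'
  have e : V \ insert v X = V.erase v \ X := by
    ext t; simp only [Finset.mem_sdiff, Finset.mem_insert, Finset.mem_erase]; tauto
  refine ⟨by rw [← c.sup.d_compl, e, h4], h4, ?_, ?_⟩
  · by_contra hy; exact h5 (Finset.mem_sdiff.2 ⟨k.y_mem, hy⟩)
  · by_contra hz; exact h6 (Finset.mem_sdiff.2 ⟨k.z_mem, hz⟩)

lemma ec_N (k : Cubic M V a b v u y z R) (c : Ctx M V a b) (hd : 4 ≤ d M {u}) :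
    EC (s(y, z) ::ₘ R) (V.erase v) := by
  refine EC.of_two (k.sup_N c) (fun x hx => ?_) (fun X hX h1 h2 => ?_)
  · rw [Finset.mem_erase] at hx
    by_cases hxu : x = u
    · subst hxu
      have := k.d_of_notMem (X := {x}) (by simpa using hx.1.symm)
      simp only [Finset.mem_singleton, k.huy.symm, k.huz.symm, if_true, if_false] at this
      rw [d_cons, cr_mk]
      simp only [Finset.mem_singleton, k.huy.symm, k.huz.symm, if_true]
      omega
    · rw [k.d_single hx.1 hxu]; exact c.three_le hx.2
  · by_cases hu : u ∈ X
    · exact (k.d_side c hX hu h1 h2).1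
    · exact (k.d_side_compl c hX hu h1 h2).1

/-- A vertex away from `u`, `v` and the roots would have degree four in `M` and a pair of parallel
edges not using the new edge, against `two_mul_mu_lt`. -/
lemma not_dbl (k : Cubic M V a b v u y z R) (c : Ctx M V a b) :
    ¬ Dbl (s(y, z) ::ₘ R) (V.erase v) := by
  intro h
  obtain ⟨x, hx, hxa, hxb, hxu, hxv⟩ := c.exists_not_root u v
  obtain ⟨h4, p, hp, q, hq, hpq, hxp, hxq, hmp, hmq⟩ := h x (by simp [hx, hxv])
  rw [k.d_single hxv hxu] at h4
  obtain ⟨r, hr, hxr, hmr, hne⟩ : ∃ r, r ∈ V.erase v ∧ x ≠ r ∧ mu (s(y, z) ::ₘ R) x r = 2 ∧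
      s(y, z) ≠ s(x, r) := by
    by_cases h1 : s(y, z) = s(x, p)
    · refine ⟨q, hq, hxq, hmq, fun h2 => hpq ?_⟩
      exact Sym2.congr_right.1 (h1.symm.trans h2)
    · exact ⟨p, hp, hxp, hmp, h1⟩
  rw [mu_cons, if_neg hne] at hmr
  have h1 : mu R x r ≤ mu M x r := wt_mono k.R_le _
  have h2 := c.two_mul_mu_lt hx (Finset.mem_erase.1 hr).2 hxr hxa hxb
  omega

/-- A rooted immersion from a segmentation with two ends of size two. -/
lemma pinch (k : Cubic M V a b v u y z R) (c : Ctx M V a b) {t : α} (hch : Chain R {t, u} Y)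
    (hW : V.erase v \ Y = {y, z}) (htu : t ≠ u) (hZ : d R {t, u} = 3) (ht : d M {t} = 3)
    (hu : 4 ≤ d M {u}) (hy : 3 ≤ d R {y}) (hYV : Y ⊆ V.erase v) : K4set M {t, u, y, z} := by
  have hyY : y ∉ Y := by
    have : y ∈ V.erase v \ Y := by rw [hW]; simp
    exact (Finset.mem_sdiff.1 this).2
  have hzY : z ∉ Y := by
    have : z ∈ V.erase v \ Y := by rw [hW]; simp
    exact (Finset.mem_sdiff.1 this).2
  have htY : t ∈ Y := hch.subset (by simp)
  have huY : u ∈ Y := hch.subset (by simp)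
  have hty : y ≠ t := by rintro rfl; exact hyY htY
  have htz : z ≠ t := by rintro rfl; exact hzY htY
  have htv : v ≠ t := by rintro rfl; simpa using hYV htY
  have et := k.d_of_notMem (X := {t}) (by simpa using htv)
  have eu := k.d_of_notMem (X := {u}) (by simpa using k.huv.symm)
  have ez := k.d_of_notMem (X := {z}) (by simpa using k.hzv.symm)
  have hz3 := c.three_le k.hz
  simp only [Finset.mem_singleton, htu.symm, hty, htz, k.huy.symm, k.huz.symm, k.huz, k.hyz, if_true,
    if_false] at et eu ez
  have hN : ∀ X, d (s(u, z) ::ₘ R) X = (if u ∈ X ↔ z ∈ X then 0 else 1) + d R X := fun X => by simp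
  have nt := hN {t}
  have nu := hN {u}
  have ny := hN {y}
  have nz := hN {z}
  have ntu := hN {t, u}
  simp only [Finset.mem_singleton, Finset.mem_insert, htu.symm, htz, k.huy, k.huz.symm, k.huz,
    k.hyz.symm, or_false, or_true, iff_true, iff_false, not_true, if_true, if_false] at nt nu ny nz ntu
  have hp := d_pair (M := s(u, z) ::ₘ R) htu
  -- Keeping the edge `uz` instead of `yz` raises every cut of the chain from three to four, as
  -- `K4set_of_chain` demands.
  have hch' : Chain (s(u, z) ::ₘ R) {t, u} Y := hch.congr (c := 1) fun X h1 h2 => by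
    rw [hN]
    have h3 : u ∈ X := h1 (by simp)
    have h4 : z ∉ X := fun hh => hzY (h2 hh)
    simp [h3, h4, add_comm]
  exact (K4set_of_chain (sup_cons (k.sup_R c.sup) k.u_mem k.z_mem) hch' hW htu k.hyz (by omega)
    (by omega) (by omega) (by omega) (by omega) (by omega)).of_reach k.reach'

/-- The case of a segmentation with a large end set. -/
lemma of_left_large (k : Cubic M V a b v u y z R) (c : Ctx M V a b) (hu : 4 ≤ d M {u})
    (h : SegOf (s(y, z) ::ₘ R) (V.erase v) a b Z Y) (hZ : 3 ≤ Z.card) :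
    d M {a, b} = 4 ∧ (u = a ∨ u = b) := by
  have hc := k.card_erase
  obtain ⟨haZ, hbZ⟩ := h.left hZ
  have hroot : ∀ r, r = a ∨ r = b → r ∉ Z := by rintro r (rfl | rfl) <;> assumption
  have side : ∀ X, X ⊆ V.erase v → u ∈ X → 2 ≤ X.card → X.card + 2 ≤ (V.erase v).card →
      d (s(y, z) ::ₘ R) X = 3 → d M X = 4 ∧ ∃ r ∈ X, r ≠ u ∧ (r = a ∨ r = b) := by
    intro X h1 h2 h3 h4 h5
    have h6 := ((k.d_side c h1 h2 h3 h4).2 h5).1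
    exact ⟨h6, c.exists_root (h1.trans (Finset.erase_subset _ _)) h3 (by omega) h2 (by omega)⟩
  have huZ : u ∉ Z := by
    intro huZ
    obtain ⟨h1, h2, h3, h4⟩ := h.between (.refl _ _) h.chain
    obtain ⟨-, r, hr, -, hr'⟩ := side Z h1 huZ h3 h4 h2
    exact hroot r hr' hr
  -- Roots other than `u` in `Y` are inner vertices of the chain, since `Z` has no roots; their even
  -- degree will clash with degree three.
  have hmid : ∀ r, (r = a ∨ r = b) → r ≠ u → r ∈ Y → ∃ k, d M {r} = 2 * k := by
    intro r hr hru hrY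
    have hrv := (Finset.mem_erase.1 (k.root_mem c hr)).1
    rw [← k.d_single hrv hru]
    exact h.chain.even hrY (hroot r hr)
  by_cases huY : u ∈ Y
  · exfalso
    -- When `u` enters the chain, the sets before and after its insertion both have boundary three.
    -- So there is a root besides `u` on either side, and `d_root` gives degree three to the one
    -- inside, which is an inner vertex of the chain.
    obtain ⟨S, hS1, huS, hdS, hS2⟩ := h.chain.exists_step huY huZ
    have hstep := Chain.single huS hdS
    obtain ⟨i1, i2, i3, i4⟩ := h.between hS1 (hstep.trans hS2)
    obtain ⟨j1, j2, j3, j4⟩ := h.between (hS1.trans hstep) hS2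
    obtain ⟨hd4, r, hr, hru, hr'⟩ := side _ j1 (by simp) j3 j4 j2
    have e1 := Finset.card_sdiff_add_card_eq_card i1
    obtain ⟨-, r2, hr2, hru2, hr2'⟩ := side (V.erase v \ S) Finset.sdiff_subset
      (Finset.mem_sdiff.2 ⟨k.u_mem, huS⟩) (by omega) (by omega) (by rw [(k.sup_N c).d_compl, i2])
    have hrS : r ∈ S := (Finset.mem_insert.1 hr).resolve_left hru
    have hr2S := (Finset.mem_sdiff.1 hr2).2
    have hrr : r ≠ r2 := by rintro rfl; exact hr2S hrS
    obtain ⟨m, hm⟩ := hmid r hr' hru (hS2.subset hr)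
    have h3 := c.d_root (j1.trans (Finset.erase_subset _ _)) j3 (by omega) hd4 hr (t' := r2)
      (by simp [hru2, hr2S]) (by
        rcases hr' with rfl | rfl <;> rcases hr2' with rfl | rfl <;> simp_all)
    omega
  · have e1 := Finset.card_sdiff_add_card_eq_card h.sub
    have e2 := h.card_add
    have hYc := Finset.card_le_card h.chain.subset
    have huW : u ∈ V.erase v \ Y := Finset.mem_sdiff.2 ⟨k.u_mem, huY⟩
    obtain ⟨hd4, r', hr', hru', hrr'⟩ := side (V.erase v \ Y) Finset.sdiff_subset huW (by omega)
      (by omega) (by rw [(k.sup_N c).d_compl, h.d_eq'])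
    have hr'Y := (Finset.mem_sdiff.1 hr').2
    have hW2 : (V.erase v \ Y).card = 2 := by
      by_contra hne
      have := h.right (by omega)
      rcases hrr' with rfl | rfl <;> tauto
    have eW := eq_pair_of_card_eq_two hW2 hr' huW hru'
    obtain ⟨r, hr⟩ := exists_areRoots hrr'
    by_cases hur : u = a ∨ u = b
    · refine ⟨?_, hur⟩
      obtain rfl := hr.eq_right hur hru'.symm
      rw [← hr.pair, ← eW, hd4]
    exfalso
    have hru : r ≠ u := by rintro rfl; exact hur hr.right
    have hrV := k.root_mem c hr.right
    have hrne := hr.ne c.hab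
    have hrW : r ∉ V.erase v \ Y := by
      rw [eW]; simp [hrne.symm, hru]
    have hrY : r ∈ Y := by
      by_contra hcon
      exact hrW (Finset.mem_sdiff.2 ⟨hrV, hcon⟩)
    have hr3 : d M {r'} = 3 := by
      refine c.d_root (Finset.sdiff_subset.trans (Finset.erase_subset _ _)) (by omega) (by omega) hd4 hr'
        hrW hr
    obtain ⟨m, hm⟩ := hmid r hr.right hru hrY
    have hrV' := Finset.mem_erase.1 hrV
    have h3 := c.three_le hrV'.2
    obtain ⟨S, hS1, hrS, hdS, hS2⟩ := h.chain.exists_step hrY (hroot r hr.right)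
    have hstep := Chain.single hrS hdS
    obtain ⟨i1, i2, i3, i4⟩ := h.between hS1 (hstep.trans hS2)
    obtain ⟨j1, j2, j3, j4⟩ := h.between (hS1.trans hstep) hS2
    have huS : u ∉ insert r S := fun hh => huY (hS2.subset hh)
    have hvS : v ∉ insert r S := fun hh => by simpa using j1 hh
    -- Were `r` not the last vertex of the chain, `insert v (insert r S)` would have boundary four,
    -- contain no other root and leave out at least three vertices; so `d {r} < 4`, although this
    -- degree is even and at least three.
    have hYeq : insert r S = Y := by
      refine Finset.eq_of_subset_of_card_le hS2.subset ?_
      by_contra hlt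
      push Not at hlt
      have h4 := ((k.d_side_compl c j1 huS j3 j4).2 j2).1
      have hcard := Finset.card_insert_of_notMem hvS
      have hr'v : r' ≠ v := (Finset.mem_erase.1 (Finset.mem_sdiff.1 hr').1).1
      have hr'S : r' ∉ insert v (insert r S) := by
        rw [Finset.mem_insert, not_or]
        exact ⟨hr'v, fun hh => hr'Y (hS2.subset hh)⟩
      have h5 := c.d_lt (s := r) (S := insert v (insert r S)) (by simp)
        (Finset.insert_subset k.hv (j1.trans (Finset.erase_subset _ _))) (by omega) (by omega)
        (fun hh => ?_) (fun hh => ?_)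
      · omega
      · by_contra hne
        have := hr.symm.eq_right (Or.inl rfl) hne
        rw [this] at hh; exact hr'S hh
      · by_contra hne
        have := hr.symm.eq_right (Or.inr rfl) hne
        rw [this] at hh; exact hr'S hh
    -- the edges from `r` to the other end set
    have hdr := d_eq_two_mul hrS hdS
    rw [k.d_single hrV'.1 hru] at hdr
    have hsplit := (k.sup_N c).btw_compl {r}
    have eV : V.erase v \ {r} = S ∪ {r', u} := by
      rw [← eW, ← hYeq]
      ext t
      have := @i1 t
      simp only [Finset.mem_sdiff, Finset.mem_singleton, Finset.mem_union, Finset.mem_insert]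
      by_cases htr : t = r
      · subst htr; simp [hrS]
      · tauto
    have hSW : Disjoint S {r', u} := by
      rw [← eW, ← hYeq, Finset.disjoint_left]
      intro t ht; simp [ht]
    rw [eV, btw_union_right hSW _ (by simpa using hrS) (by simp [hrne.symm, hru]),
      k.d_single hrV'.1 hru, btw_pair hrne.symm hru hru'] at hsplit
    have hyz := (k.d_side_compl c h.sub huY (by omega) h.card_add).2 h.d_eq'
    have hy := hyz.2.2.1; have hz := hyz.2.2.2
    have m1 : mu (s(y, z) ::ₘ R) r u = mu R r u := by
      rw [mu_cons, if_neg, zero_add]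
      intro hh
      rcases Sym2.eq_iff.1 hh with ⟨-, rfl⟩ | ⟨rfl, -⟩ <;> exact huY (by assumption)
    have m2 : mu (s(y, z) ::ₘ R) r r' = mu R r r' := by
      rw [mu_cons, if_neg, zero_add]
      intro hh
      rcases Sym2.eq_iff.1 hh with ⟨-, rfl⟩ | ⟨rfl, -⟩ <;> exact hr'Y (by assumption)
    rw [m1, m2] at hsplit
    have l1 : mu R r r' ≤ mu M r r' := wt_mono k.R_le _
    -- Half of the edges at `r` lead to `{r', u}`. An edge `ru` would give `d M {a, b} = 4`, which
    -- fails by parity, as `r'` has degree three and `r` even degree. Without it, `r'` has at least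
    -- two edges to each of `r` and `u`, too many for degree three.
    by_cases hpos : 0 < mu R r u
    · have := (c.of_high_edge (Multiset.mem_of_le k.R_le (mu_pos_iff.1 hpos)) hru (by omega) hu).1
      rw [← hr.symm.pair] at this
      have := d_pair (M := M) hrne.symm
      omega
    · have p1 := d_pair (M := M) hru'
      rw [← eW] at p1
      have p2 := mu_add_mu_le (M := M) hru' hrne hru.symm
      rw [mu_comm M r' r] at p2
      omega

/-- The case of a segmentation with two small end sets. -/
lemma of_small (k : Cubic M V a b v u y z R) (c : Ctx M V a b) (hu : 4 ≤ d M {u})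
    (h : SegOf (s(y, z) ::ₘ R) (V.erase v) a b Z Y) (hZ : Z.card = 2)
    (hY : Y.card + 2 = (V.erase v).card) (huZ : u ∈ Z) : d M {a, b} = 4 ∧ (u = a ∨ u = b) := by
  have hc := k.card_erase
  have h5 := c.five
  obtain ⟨i1, i2, i3, i4⟩ := h.between (.refl _ _) h.chain
  obtain ⟨j1, j2, j3, j4⟩ := h.between h.chain (.refl _ _)
  have huY := h.chain.subset huZ
  obtain ⟨hd4, hyZ, hzZ⟩ := (k.d_side c i1 huZ i3 i4).2 i2
  obtain ⟨hdY, hyY, hzY⟩ := (k.d_side c j1 huY j3 j4).2 j2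
  obtain ⟨t, htZ, htu, htr⟩ := c.exists_root (i1.trans (Finset.erase_subset _ _)) i3 (by omega) huZ
    (by omega)
  have eZ := eq_pair_of_card_eq_two hZ htZ huZ htu
  obtain ⟨t', ht'⟩ := exists_areRoots htr
  by_cases hur : u = a ∨ u = b
  · refine ⟨?_, hur⟩
    obtain rfl := ht'.eq_right hur htu.symm
    rw [← ht'.pair, ← eZ, hd4]
  exfalso
  have htt' := ht'.ne c.hab
  have ht'u : t' ≠ u := by rintro rfl; exact hur ht'.right
  have ht'Z : t' ∉ Z := by rw [eZ]; simp [htt'.symm, ht'u]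
  have ht3 : d M {t} = 3 :=
    c.d_root (i1.trans (Finset.erase_subset _ _)) i3 (by omega) hd4 htZ ht'Z ht'
  have hW2 : (V.erase v \ Y).card = 2 := by
    have := Finset.card_sdiff_add_card_eq_card h.sub; omega
  have eW := eq_pair_of_card_eq_two hW2 (Finset.mem_sdiff.2 ⟨k.y_mem, hyY⟩)
    (Finset.mem_sdiff.2 ⟨k.z_mem, hzY⟩) k.hyz
  have hdR : d R Y = 3 := by rw [d_cons] at j2; simpa [hyY, hzY] using j2
  have hdRW : d R {y, z} = 3 := by rw [← eW, (k.sup_R c.sup).d_compl, hdR]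
  have ey := k.d_of_notMem (X := {y}) (by simpa using k.hyv.symm)
  have ez := k.d_of_notMem (X := {z}) (by simpa using k.hzv.symm)
  simp only [Finset.mem_singleton, k.huy, k.huz, k.hyz, k.hyz.symm, if_true, if_false] at ey ez
  have hy3 := c.three_le k.hy
  have hz3 := c.three_le k.hz
  have hp := d_pair (M := R) k.hyz
  -- Otherwise `{v, y, z}` contains no root and has boundary four, so `y` and `z` have degree three
  -- by `d_lt`. Then both have degree two in `R`, which contradicts `d R {y, z} = 3` by parity.
  have ht'W : t' ∈ ({y, z} : Finset α) := by
    by_contra hcon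
    have ht'Y : t' ∈ Y := by
      by_contra h1
      rw [← eW] at hcon
      exact hcon (Finset.mem_sdiff.2 ⟨k.root_mem c ht'.right, h1⟩)
    have hY3 : 3 ≤ Y.card := by
      have := Finset.card_lt_card (Finset.ssubset_iff_subset_ne.2
        ⟨h.chain.subset, fun hh => ht'Z (hh ▸ ht'Y)⟩)
      omega
    have hroot : ∀ r, r = a ∨ r = b → r ∉ insert v ({y, z} : Finset α) := by
      intro r hr hmem
      have hrY : r ∈ Y := by
        by_cases hrt : r = t
        · rw [hrt]; exact h.chain.subset htZ
        · rw [ht'.eq_right hr hrt]; exact ht'Y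
      rcases Finset.mem_insert.1 hmem with rfl | hmem
      · simpa using j1 hrY
      · rw [← eW] at hmem; exact (Finset.mem_sdiff.1 hmem).2 hrY
    have hv : v ∉ ({y, z} : Finset α) := by simp [k.hyv.symm, k.hzv.symm]
    have hdW := k.d_insert hv
    simp only [Finset.mem_insert, Finset.mem_singleton, k.huy, k.huz, or_self, if_false, true_or,
      or_true, if_true] at hdW
    have hcW := Finset.card_insert_of_notMem hv
    rw [Finset.card_pair k.hyz] at hcW
    have hsub : insert v ({y, z} : Finset α) ⊆ V := by
      intro t; simp only [Finset.mem_insert, Finset.mem_singleton]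
      rintro (rfl | rfl | rfl)
      exacts [k.hv, k.hy, k.hz]
    have l1 := c.d_lt (s := y) (S := insert v {y, z}) (by simp) hsub (by omega) (by omega)
      (fun hh => absurd hh (hroot _ (Or.inl rfl))) (fun hh => absurd hh (hroot _ (Or.inr rfl)))
    have l2 := c.d_lt (s := z) (S := insert v {y, z}) (by simp) hsub (by omega) (by omega)
      (fun hh => absurd hh (hroot _ (Or.inl rfl))) (fun hh => absurd hh (hroot _ (Or.inr rfl)))
    omega
  have hch : Chain R {t, u} Y := by
    rw [← eZ]
    refine h.chain.congr (c := 0) fun X h1 h2 => ?_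
    have h3 : y ∉ X := fun hh => hyY (h2 hh)
    have h4 : z ∉ X := fun hh => hzY (h2 hh)
    simp [h3, h4]
  have hdRZ : d R {t, u} = 3 := by rw [← hch.d_eq, hdR]
  have fin : ∀ T : Finset α, t ∈ T → t' ∈ T → ¬ K4set M T := by
    intro T h1 h2 hK
    rcases ht' with ⟨rfl, rfl⟩ | ⟨rfl, rfl⟩
    · exact c.nk ⟨T, h1, h2, hK⟩
    · exact c.nk ⟨T, h2, h1, hK⟩
  rw [Finset.mem_insert, Finset.mem_singleton] at ht'W
  -- In `R` the degrees of `y` and `z` are at least two with odd sum, so one of them is at least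
  -- three, as `pinch` requires.
  by_cases hy : 3 ≤ d R {y}
  · exact fin _ (by simp) (by simp; tauto) (k.pinch c hch eW htu hdRZ ht3 hu hy h.sub)
  · refine fin _ (by simp) (by simp; tauto)
      (k.swap.pinch c hch (by rw [eW, Finset.pair_comm]) htu hdRZ ht3 hu (by omega) h.sub)

end Cubic

/-- A vertex of degree three that is not a root and a neighbour of larger degree in a minimal
counterexample. -/
lemma Ctx.of_cubic (c : Ctx M V a b) (k : Cubic M V a b v u y z R) (hu : 4 ≤ d M {u}) :
    d M {a, b} = 4 ∧ (u = a ∨ u = b) := by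
  have ha := k.root_mem c (Or.inl rfl)
  have hb := k.root_mem c (Or.inr rfl)
  have hc := k.card_erase
  have h5 := c.five
  rcases c.ih _ _ k.card_lt (k.sup_N c) (k.ec_N c hu) (by omega) ha hb with h | h | ⟨Z, Y, h⟩
  · exact absurd (h.of_reach k.reach) c.nk
  · exact absurd h (k.not_dbl c)
  have h' := h.compl (k.sup_N c) ha hb
  have e1 := Finset.card_sdiff_add_card_eq_card h.sub
  have e2 := Finset.card_sdiff_add_card_eq_card (h.chain.subset.trans h.sub)
  have e3 := h.two_le; have e4 := h.card_add
  by_cases hZ : 3 ≤ Z.card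
  · exact k.of_left_large c hu h hZ
  by_cases hY : 3 ≤ (V.erase v \ Y).card
  · exact k.of_left_large c hu h' hY
  by_cases huZ : u ∈ Z
  · exact k.of_small c hu h (by omega) (by omega) huZ
  by_cases huY : u ∈ Y
  -- A cut of size three without `u` contains `y` and one with `u` does not, so `u` cannot be added
  -- along the chain.
  · exfalso
    obtain ⟨i1, i2, i3, i4⟩ := h.between (.refl _ _) h.chain
    obtain ⟨j1, j2, j3, j4⟩ := h.between h.chain (.refl _ _)
    exact ((k.d_side c j1 huY j3 j4).2 j2).2.1
      (h.chain.subset ((k.d_side_compl c i1 huZ i3 i4).2 i2).2.2.1)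
  · exact k.of_small c hu h' (by omega) (by omega) (Finset.mem_sdiff.2 ⟨k.u_mem, huY⟩)

end EdgeMultiset

end

noncomputable section

namespace EdgeMultiset

open scoped Classical

variable {α : Type*} {M N R : Multiset (Sym2 α)} {X Y Z S V : Finset α} {x y z w a b s p u v : α}

/-! ### Suppressing two adjacent vertices of degree three -/

lemma d_mod_two (h : ∀ x ∈ X, d M {x} = 3) : d M X % 2 = X.card % 2 := by
  induction X using Finset.induction with
  | empty =>
    have : d M ∅ = 0 := wt_eq_zero_iff.2 fun e _ => by induction e with | _ p q; simp
    simp [this]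
  | insert x X hx ih =>
    have h1 := ih fun t ht => h t (Finset.mem_insert_of_mem ht)
    have h2 := h x (Finset.mem_insert_self _ _)
    have h3 := d_insert (M := M) hx
    rw [Finset.card_insert_of_notMem hx]
    omega

/-- Less than half of the edges at `x` go to `a` and less than half to `b`. -/
lemma Ctx.exists_nbr (c : Ctx M V a b) (hx : x ∈ V) (hxa : x ≠ a) (hxb : x ≠ b) :
    ∃ w, w ≠ x ∧ w ≠ a ∧ w ≠ b ∧ s(x, w) ∈ M := by
  have h1 := c.two_mul_mu_lt hx c.ha hxa hxa hxb
  have h2 := c.two_mul_mu_lt hx c.hb hxb hxa hxb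
  have h3 := btw_pair (M := M) hxa hxb c.hab
  obtain ⟨w, hw, hwx, he⟩ := exists_edge_of_btw_lt (M := M) (p := x) (S := {a, b}) (by omega)
  simp only [Finset.mem_insert, Finset.mem_singleton, not_or] at hw
  exact ⟨w, hwx, hw.1, hw.2, he⟩

/-- In a minimal counterexample, all vertices except for the roots have degree three. -/
lemma Ctx.d_eq_three (c : Ctx M V a b) (hx : x ∈ V) (hxa : x ≠ a) (hxb : x ≠ b) :
    d M {x} = 3 := by
  by_contra hne
  have h3 := c.three_le hx
  obtain ⟨w, hwx, hwa, hwb, he⟩ := c.exists_nbr hx hxa hxb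
  have hw3 := c.three_le (c.sup x w he hwx.symm).2
  -- For an edge `xw` between vertices that are not roots, with `x` of degree at least four, either
  -- reduction would make `x` or `w` a root.
  by_cases hw : d M {w} = 3
  · obtain ⟨y, z, R, k⟩ := c.exists_cubic hw hwa hwb he hwx.symm
    have := (c.of_cubic k (by omega)).2
    tauto
  · have := (c.of_high_edge he hwx.symm (by omega) (by omega)).2
    tauto

lemma Ctx.d_roots_of_high (c : Ctx M V a b) (hxy : AreRoots a b x y) (hx : 4 ≤ d M {x})
    (h : mu M x y < d M {x}) : d M {a, b} = 4 := by
  obtain ⟨w, hwx, hwy, he⟩ := exists_edge_of_mu_lt (hxy.ne c.hab) h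
  have hwV := (c.sup x w he hwx.symm).2
  have hr : ¬ (w = a ∨ w = b) := fun hr => hwy (hxy.eq_right hr hwx)
  rw [not_or] at hr
  obtain ⟨y, z, R, k⟩ := c.exists_cubic (c.d_eq_three hwV hr.1 hr.2) hr.1 hr.2 he hwx.symm
  exact (c.of_cubic k hx).1

/-- A root of large degree with a neighbour other than the second root falls under `of_cubic`. If
all its edges go to the second root, that one has large degree too, and further neighbours, because
`{a, b}` has at least four leaving edges. -/
lemma Ctx.d_roots (c : Ctx M V a b) : (∀ x ∈ V, d M {x} = 3) ∨ d M {a, b} = 4 := by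
  by_contra! hcon
  obtain ⟨⟨x, hxV, hx⟩, hab⟩ := hcon
  have hxr : x = a ∨ x = b := by
    by_contra hr
    rw [not_or] at hr
    exact hx (c.d_eq_three hxV hr.1 hr.2)
  obtain ⟨y, hxy⟩ := exists_areRoots hxr
  have h3 := c.three_le hxV
  have hne := hxy.ne c.hab
  have h5 := c.five
  have hp := d_pair (M := M) hne
  have h4 := c.nt {x, y} (by
    intro t; simp only [Finset.mem_insert, Finset.mem_singleton]
    rintro (rfl | rfl)
    exacts [hxV, c.root_mem hxy.right]) (by rw [Finset.card_pair hne])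
    (by rw [Finset.card_pair hne]; omega)
  by_cases h : mu M x y < d M {x}
  · exact hab (c.d_roots_of_high hxy (by omega) h)
  · refine hab (c.d_roots_of_high hxy.symm (by omega) ?_)
    rw [mu_comm]; omega

/-- Five vertices are excluded by parity: either all five are cubic, or three cubic vertices have
boundary four. Hence at least four vertices remain after two are suppressed. -/
lemma Ctx.six_le (c : Ctx M V a b) : 6 ≤ V.card := by
  have h5 := c.five
  rcases c.d_roots with h | h
  · have := d_mod_two h
    rw [c.sup.d_self] at this
    omega
  · have hsub : ({a, b} : Finset α) ⊆ V := by
      intro t; simp only [Finset.mem_insert, Finset.mem_singleton]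
      rintro (rfl | rfl)
      exacts [c.ha, c.hb]
    have h1 : d M (V \ {a, b}) % 2 = (V \ {a, b}).card % 2 := d_mod_two fun x hx => by
      simp only [Finset.mem_sdiff, Finset.mem_insert, Finset.mem_singleton, not_or] at hx
      exact c.d_eq_three hx.1 hx.2.1 hx.2.2
    rw [c.sup.d_compl, h] at h1
    have h2 := Finset.card_sdiff_add_card_eq_card hsub
    rw [Finset.card_pair c.hab] at h2
    omega

/-- The adjacent vertices `u` and `v` of degree three have further neighbours `p`, `q` and `y`,
`z`, respectively. -/
structure CubicPair (M : Multiset (Sym2 α)) (V : Finset α) (a b u v p q y z : α)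
    (R : Multiset (Sym2 α)) : Prop where
  left : Cubic M V a b u v p q (s(v, y) ::ₘ s(v, z) ::ₘ R)
  right : Cubic M V a b v u y z (s(u, p) ::ₘ s(u, q) ::ₘ R)
  iso : d R {u} = 0

lemma Ctx.exists_cubicPair (c : Ctx M V a b) : ∃ u v p q y z R, CubicPair M V a b u v p q y z R := by
  obtain ⟨u, hu, hua, hub, -, -⟩ := c.exists_not_root a a
  obtain ⟨v, hvu, hva, hvb, he⟩ := c.exists_nbr hu hua hub
  have hv := (c.sup u v he hvu.symm).2
  obtain ⟨y, z, R, k⟩ := c.exists_cubic (c.d_eq_three hv hva hvb) hva hvb he hvu.symm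
  rw [Sym2.eq_swap] at he
  obtain ⟨p, q, R', k'⟩ := c.exists_cubic (c.d_eq_three hu hua hub) hua hub he hvu
  have hmem : ∀ t, s(u, t) ∈ M → t ≠ v → s(u, t) ∈ R := by
    intro t ht htv
    rw [k.eq] at ht
    simp only [Multiset.mem_cons, Sym2.eq_iff] at ht
    have h1 := k.huv; have h2 := k.huy; have h3 := k.huz
    tauto
  obtain ⟨R2, rfl⟩ := exists_cons_cons (hmem p (by rw [k'.eq]; simp) k'.huy.symm)
    (hmem q (by rw [k'.eq]; simp) k'.huz.symm) fun h => k'.hyz (Sym2.congr_right.1 h)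
  have hiso : d R2 {u} = 0 := by
    have h3 := c.d_eq_three hu hua hub
    have h1 := k.d_of_notMem (X := {u}) (by simpa using hvu)
    simp only [d_cons, cr_mk, Finset.mem_singleton, k.huy.symm, k.huz.symm, k'.hyv, k'.hzv, if_true,
      if_false, iff_false, not_true] at h1
    omega
  refine ⟨u, v, p, q, y, z, R2, ⟨?_, hu, hv, k'.hy, k'.hz, hvu, k'.hyv, k'.hzv, k'.huy, k'.huz,
    k'.hyz, hua, hub, ?_⟩, k, hiso⟩
  · rw [k.eq, Sym2.eq_swap (a := u) (b := v)]
    congr 1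
    simp only [← Multiset.singleton_add]
    abel
  · simp [hiso, k.huy.symm, k.huz.symm, hvu]

namespace CubicPair

variable {q : α}

lemma y_mem (k : CubicPair M V a b u v p q y z R) : y ∈ (V.erase u).erase v := by
  simp [k.right.hy, k.right.hyv, k.right.huy.symm]
lemma z_mem (k : CubicPair M V a b u v p q y z R) : z ∈ (V.erase u).erase v := by
  simp [k.right.hz, k.right.hzv, k.right.huz.symm]
lemma p_mem (k : CubicPair M V a b u v p q y z R) : p ∈ (V.erase u).erase v := by
  simp [k.left.hy, k.left.hyv, k.left.huy.symm]
lemma q_mem (k : CubicPair M V a b u v p q y z R) : q ∈ (V.erase u).erase v := by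
  simp [k.left.hz, k.left.hzv, k.left.huz.symm]

lemma root_mem (k : CubicPair M V a b u v p q y z R) (c : Ctx M V a b) (h : x = a ∨ x = b) :
    x ∈ (V.erase u).erase v := by
  have h1 := k.left.root_mem c h
  have h2 := k.right.root_mem c h
  simp only [Finset.mem_erase] at *
  tauto

lemma card_erase (k : CubicPair M V a b u v p q y z R) : ((V.erase u).erase v).card + 2 = V.card := by
  have h1 := Finset.card_erase_add_one (s := V.erase u) (a := v) (by simp [k.left.hu, k.left.huv])
  have h2 := Finset.card_erase_add_one k.left.hv
  omega

lemma sup (k : CubicPair M V a b u v p q y z R) (c : Ctx M V a b) :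
    Sup (s(y, z) ::ₘ s(p, q) ::ₘ R) ((V.erase u).erase v) := by
  refine Cubic.sup_cons (Cubic.sup_cons ?_ k.p_mem k.q_mem) k.y_mem k.z_mem
  refine Sup.of_d_eq_zero (V := V) (c.sup.mono ?_) fun x hx hxv => ?_
  · rw [k.right.eq]
    iterate 4 refine le_trans ?_ (Multiset.le_cons_self _ _)
    exact Multiset.le_cons_self _ _
  · simp only [Finset.mem_erase, not_and_or, not_not] at hxv
    rcases hxv with rfl | rfl | h
    · have := k.right.iso
      simp only [d_cons] at this
      omega
    · exact k.iso
    · exact absurd hx h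

lemma reach (k : CubicPair M V a b u v p q y z R) : Reach M (s(y, z) ::ₘ s(p, q) ::ₘ R) := by
  refine k.right.reach.trans ?_
  rw [Multiset.cons_swap, Multiset.cons_swap s(y, z), Multiset.cons_swap s(y, z),
    Sym2.eq_swap (a := u) (b := p)]
  exact .split _ p u q

lemma card_lt (k : CubicPair M V a b u v p q y z R) : (s(y, z) ::ₘ s(p, q) ::ₘ R).card +
    ((V.erase u).erase v).card < M.card + V.card := by
  have := k.card_erase
  rw [k.right.eq]; simp only [Multiset.card_cons]; omega

lemma d_single (k : CubicPair M V a b u v p q y z R) (hx : x ∈ (V.erase u).erase v) :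
    d (s(y, z) ::ₘ s(p, q) ::ₘ R) {x} = d M {x} := by
  simp only [Finset.mem_erase] at hx
  have h1 := k.right.hyz
  have h2 := k.left.hyz
  rw [k.right.d_of_notMem (by simpa using hx.1.symm)]
  simp only [d_cons, cr_mk, Finset.mem_singleton, hx.2.1.symm, if_false, false_iff]
  by_cases e1 : y = x
  · subst e1
    by_cases e2 : p = y
    · subst e2; simp [h1.symm, h2.symm]
    · simp [e2, h1.symm]
  · by_cases e2 : p = x
    · subst e2; simp [e1, h2.symm]
    · simp [e1, e2]

/-- Adding `u`, `v`, both or neither to `X` gives cuts of at least four edges in `M`. Putting each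
of the two vertices on its cheaper side loses at most the edge `uv`, and loses it only if they are
put on different sides. -/
lemma d_nontrivial (k : CubicPair M V a b u v p q y z R) (c : Ctx M V a b)
    (hX : X ⊆ (V.erase u).erase v) (h2 : 2 ≤ X.card) (h3 : X.card + 2 ≤ ((V.erase u).erase v).card) :
    3 ≤ d (s(y, z) ::ₘ s(p, q) ::ₘ R) X ∧ (d (s(y, z) ::ₘ s(p, q) ::ₘ R) X = 3 →
      d M (insert u X) = 4 ∨ d M (insert v X) = 4) := by
  have huX : u ∉ X := fun h => by simpa using hX h
  have hvX : v ∉ X := fun h => by simpa using hX h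
  have hc := k.card_erase
  have hXV := hX.trans ((Finset.erase_subset _ _).trans (Finset.erase_subset _ _))
  have hne := k.right.huv
  have hvX' : v ∉ insert u X := by simp [hne.symm, hvX]
  have c1 := Finset.card_insert_of_notMem huX
  have c2 := Finset.card_insert_of_notMem hvX
  have c3 := Finset.card_insert_of_notMem hvX'
  have n1 := c.nt X hXV h2 (by omega)
  have n2 := c.nt _ (Finset.insert_subset k.left.hv hXV) (by omega) (by omega)
  have n3 := c.nt _ (Finset.insert_subset k.right.hv hXV) (by omega) (by omega)
  have n4 := c.nt _ (Finset.insert_subset k.right.hv (Finset.insert_subset k.left.hv hXV)) (by omega)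
    (by omega)
  have e1 := k.right.d_of_notMem hvX
  have e2 := k.right.d_of_notMem hvX'
  have e3 := k.right.d_insert hvX
  have e4 := k.right.d_insert hvX'
  have i := d_insert_of_iso k.iso huX
  simp only [Finset.mem_insert, k.right.huy.symm, k.right.huz.symm, k.left.hyv, k.left.hzv, false_or,
    true_or, true_iff, d_cons, cr_mk, huX, if_true, if_false, false_iff, i] at e1 e2 e3 e4 ⊢
  by_cases f1 : p ∈ X <;> by_cases f2 : q ∈ X <;> by_cases f3 : y ∈ X <;> by_cases f4 : z ∈ X <;>
    simp only [f1, f2, f3, f4, not_true, not_false_iff, if_true, if_false, iff_true, iff_false] at e1 e2 e3 e4 ⊢ <;> omega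

lemma ec (k : CubicPair M V a b u v p q y z R) (c : Ctx M V a b) :
    EC (s(y, z) ::ₘ s(p, q) ::ₘ R) ((V.erase u).erase v) := by
  refine EC.of_two (k.sup c) (fun x hx => ?_) (fun X hX h1 h2 => (k.d_nontrivial c hX h1 h2).1)
  rw [k.d_single hx]
  simp only [Finset.mem_erase] at hx
  exact c.three_le hx.2.2

lemma not_dbl (k : CubicPair M V a b u v p q y z R) (c : Ctx M V a b) :
    ¬ Dbl (s(y, z) ::ₘ s(p, q) ::ₘ R) ((V.erase u).erase v) := by
  intro h
  obtain ⟨x, hx, hxa, hxb, hxu, hxv⟩ := c.exists_not_root u v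
  have hx' : x ∈ (V.erase u).erase v := by simp [hx, hxu, hxv]
  have h4 := (h x hx').1
  rw [k.d_single hx', c.d_eq_three hx hxa hxb] at h4
  omega

/-- A vertex set with three leaving edges extends to one with four leaving edges. -/
lemma exists_extension (k : CubicPair M V a b u v p q y z R) (c : Ctx M V a b)
    (hX : X ⊆ (V.erase u).erase v) (h2 : 2 ≤ X.card) (h3 : X.card + 2 ≤ ((V.erase u).erase v).card)
    (hd : d (s(y, z) ::ₘ s(p, q) ::ₘ R) X = 3) :
    ∃ w ∈ V, w ∉ X ∧ w ≠ a ∧ w ≠ b ∧ d M (insert w X) = 4 := by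
  rcases (k.d_nontrivial c hX h2 h3).2 hd with h | h
  · exact ⟨u, k.left.hv, fun h => by simpa using hX h, k.left.va, k.left.vb, h⟩
  · exact ⟨v, k.right.hv, fun h => by simpa using hX h, k.right.va, k.right.vb, h⟩

/-- The sets of a segmentation contain none or both of the roots. -/
lemma roots_iff (k : CubicPair M V a b u v p q y z R) (c : Ctx M V a b)
    (h : SegOf (s(y, z) ::ₘ s(p, q) ::ₘ R) ((V.erase u).erase v) a b Z Y)
    (h1 : Chain (s(y, z) ::ₘ s(p, q) ::ₘ R) Z X) (h2 : Chain (s(y, z) ::ₘ s(p, q) ::ₘ R) X Y) :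
    a ∈ X ↔ b ∈ X := by
  by_contra hiff
  obtain ⟨r, r', hr, hrX, hr'X⟩ : ∃ r r', AreRoots a b r r' ∧ r ∈ X ∧ r' ∉ X := by
    by_cases haX : a ∈ X
    · exact ⟨a, b, Or.inl ⟨rfl, rfl⟩, haX, fun hb => hiff (by simp [haX, hb])⟩
    · exact ⟨b, a, Or.inr ⟨rfl, rfl⟩, by_contra fun hb => hiff (by simp [haX, hb]), haX⟩
  have hc := k.card_erase
  obtain ⟨i1, i2, i3, i4⟩ := h.between h1 h2
  obtain ⟨w, hw, hwX, hwa, hwb, hd4⟩ := k.exists_extension c i1 i3 i4 i2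
  have hXV := i1.trans ((Finset.erase_subset _ _).trans (Finset.erase_subset _ _))
  have hsub := Finset.insert_subset hw hXV
  have hcard := Finset.card_insert_of_notMem hwX
  have hcc := Finset.card_sdiff_add_card_eq_card hsub
  have hr'w : r' ≠ w := by
    rintro rfl
    rcases hr.right with h | h <;> contradiction
  have hr'X' : r' ∉ insert w X := by simp [hr'w, hr'X]
  -- The extended set has boundary four and separates the roots, so `d_root` applies to it and to
  -- its complement: all of `M` is cubic.
  have d1 : d M {r} = 3 := c.d_root hsub (by omega) (by omega) hd4 (Finset.mem_insert_of_mem hrX)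
    hr'X' hr
  have d2 : d M {r'} = 3 := c.d_root (X := V \ insert w X) Finset.sdiff_subset (by omega) (by omega)
    (by rw [c.sup.d_compl, hd4]) (Finset.mem_sdiff.2 ⟨c.root_mem hr.right, hr'X'⟩)
    (by simp [hrX]) hr.symm
  have hall : ∀ x ∈ V, d M {x} = 3 := by
    intro x hx
    by_cases hxr : x = a ∨ x = b
    · by_cases hxr' : x = r
      · rw [hxr', d1]
      · rw [hr.eq_right hxr hxr', d2]
    · rw [not_or] at hxr
      exact c.d_eq_three hx hxr.1 hxr.2
  -- Inner vertices of a chain have even degree, so there are none. Then `X` has two elements, and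
  -- the extended set consists of three cubic vertices with boundary four, against parity.
  have hYZ : Y ⊆ Z := by
    intro t ht
    by_contra htZ
    obtain ⟨m, hm⟩ := h.chain.even ht htZ
    have htV := h.sub ht
    rw [k.d_single htV, hall t (Finset.mem_of_mem_erase (Finset.mem_of_mem_erase htV))] at hm
    omega
  have hrZ : r ∈ Z := hYZ (h2.subset hrX)
  have hZ2 : Z.card = 2 := by
    by_contra hne
    have := h.two_le
    have := h.left (by omega)
    rcases hr.left with rfl | rfl <;> tauto
  have hX2 : X.card = 2 := by
    have := Finset.card_le_card (h2.subset.trans hYZ)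
    omega
  have := d_mod_two fun x hx => hall x (hsub hx)
  omega

/-- Otherwise `Z` contains both roots, so `Z = {a, b}`, and adding a suitable cubic vertex gives
boundary four. This violates parity under both alternatives of `d_roots`. -/
lemma not_left (k : CubicPair M V a b u v p q y z R) (c : Ctx M V a b)
    (h : SegOf (s(y, z) ::ₘ s(p, q) ::ₘ R) ((V.erase u).erase v) a b Z Y) : a ∉ Z ∧ b ∉ Z := by
  have hiff := k.roots_iff c h (.refl _ _) h.chain
  by_contra hcon
  have haZ : a ∈ Z := by tauto
  have hbZ := hiff.1 haZ
  have hZ2 : Z.card = 2 := by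
    by_contra hne
    have := h.two_le
    exact (h.left (by omega)).1 haZ
  obtain ⟨i1, i2, i3, i4⟩ := h.between (.refl _ _) h.chain
  obtain ⟨w, hw, hwX, hwa, hwb, hd4⟩ := k.exists_extension c i1 i3 i4 i2
  have hXV := i1.trans ((Finset.erase_subset _ _).trans (Finset.erase_subset _ _))
  have hsub := Finset.insert_subset hw hXV
  have hcard := Finset.card_insert_of_notMem hwX
  rcases c.d_roots with hall | hab
  · have := d_mod_two fun x hx => hall x (hsub hx)
    omega
  · have e := eq_pair_of_card_eq_two hZ2 haZ hbZ c.hab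
    rw [← e] at hab
    have := d_insert (M := M) hwX
    have := c.d_eq_three hw hwa hwb
    omega

end CubicPair

/-- In the segmentation left after suppressing a cubic pair, both roots are inner vertices by
`not_left`, and by `roots_iff` they would have to be added simultaneously. -/
theorem Ctx.false (c : Ctx M V a b) : False := by
  obtain ⟨u, v, p, q, y, z, R, k⟩ := c.exists_cubicPair
  have h6 := c.six_le
  have hc := k.card_erase
  have ha := k.root_mem c (Or.inl rfl)
  have hb := k.root_mem c (Or.inr rfl)
  rcases c.ih _ _ k.card_lt (k.sup c) (k.ec c) (by omega) ha hb with h | h | ⟨Z, Y, h⟩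
  · exact c.nk (h.of_reach k.reach)
  · exact k.not_dbl c h
  have h1 := k.not_left c h
  have h2 := k.not_left c (h.compl (k.sup c) ha hb)
  have haY : a ∈ Y := by
    by_contra hh; exact h2.1 (Finset.mem_sdiff.2 ⟨ha, hh⟩)
  obtain ⟨S, hS1, haS, hdS, hS2⟩ := h.chain.exists_step haY h1.1
  have hstep := Chain.single haS hdS
  have e1 := k.roots_iff c h hS1 (hstep.trans hS2)
  have e2 := k.roots_iff c h (hS1.trans hstep) hS2
  have := c.hab
  simp only [Finset.mem_insert, true_or, true_iff, this.symm, false_or] at e2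
  exact haS (e1.2 e2)

end EdgeMultiset

end

/-! ### Non-trivial cuts of size three and the main induction -/

noncomputable section

namespace EdgeMultiset

open scoped Classical

variable {α : Type*} {M N R : Multiset (Sym2 α)} {X Y Z S V : Finset α} {x y z w a b s p u v : α}

lemma Chain.of_con (h : Chain (con S s M) Z Y) (hs : s ∈ Z) (hY : Y ⊆ insert s (V \ S)) (hsS : s ∈ S) :
    Chain M (Z ∪ S) (Y ∪ S) := by
  induction h with
  | refl => exact .refl _ _
  | @tail T T' h1 h ih =>
    obtain ⟨p, hp, rfl, h⟩ := h
    refine (ih ((Finset.subset_insert _ _).trans hY)).trans ?_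
    have hsT := Chain.subset h1 hs
    rw [d_con_of_mem hsT, d_con_of_mem (Finset.mem_insert_of_mem hsT), Finset.insert_union] at h
    have hpS : p ∉ S := by
      intro hpS
      have := hY (Finset.mem_insert_self p T)
      simp only [Finset.mem_insert, Finset.mem_sdiff] at this
      rcases this with rfl | h
      · exact hp hsT
      · exact h.2 hpS
    rw [Finset.insert_union]
    exact Chain.single (by simp [hp, hpS]) h

lemma card_union_of_con (hX : X ⊆ insert s (V \ S)) (hs : s ∈ X) (hsS : s ∈ S) :
    (X ∪ S).card + 1 = X.card + S.card := by
  have e : X ∩ S = {s} := by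
    ext t
    have := @hX t
    simp only [Finset.mem_inter, Finset.mem_insert, Finset.mem_sdiff, Finset.mem_singleton] at *
    constructor
    · tauto
    · rintro rfl; exact ⟨hs, hsS⟩
  have := Finset.card_union_add_card_inter X S
  rw [e, Finset.card_singleton] at this
  exact this

/-- One half of a segmentation through the `3`-edge cut around `S`. -/
lemma exists_half_chain (hM : Sup M V) (ec : EC M V) (ha : a ∈ V) (hb : b ∈ V)
    (ih : OutBelow a b (M.card + V.card)) (hS : S ⊆ V) (h2 : 2 ≤ S.card) (h3 : S.card + 2 ≤ V.card)
    (hd : d M S = 3) (hs : s ∈ S) (hsa : a ∈ S → a = s) (hsb : b ∈ S → b = s) :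
    K4r M a b ∨ Seg M V a b ∨
      ∃ Y ⊆ V, Chain M S Y ∧ Y.card + 2 ≤ V.card ∧ (Y.card + 3 ≤ V.card → a ∈ Y ∧ b ∈ Y) := by
  by_cases h4 : S.card + 2 = V.card
  · exact Or.inr (Or.inr ⟨S, hS, .refl _ _, by omega, by omega⟩)
  have hc := card_con hS hs
  have hroot : ∀ x ∈ V, (x ∈ S → x = s) → x ∈ insert s (V \ S) := by
    intro x hx h
    simp only [Finset.mem_insert, Finset.mem_sdiff]; tauto
  have ha' := hroot a ha hsa
  have hb' := hroot b hb hsb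
  have hds : d (con S s M) {s} = 3 := by
    rw [d_con_of_mem (by simp), Finset.union_eq_right.2 (by simpa using hs), hd]
  rcases ih (con S s M) (insert s (V \ S)) (by simp only [con, Multiset.card_map]; omega)
    hM.con (ec.con hS hs) (by omega) ha' hb' with h | h | ⟨Z, Y, h⟩
  · refine Or.inl (h.of_reach (reach_con hs fun Y hY hsY => ?_))
    rw [hd]
    have := Finset.card_le_card hY
    exact ec Y (hY.trans hS) ⟨s, hsY⟩ (by rintro rfl; omega)
  · have := (h s (by simp)).1
    omega
  right
  -- The contracted vertex has odd degree three, so it lies in an end set of the chain; passing to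
  -- complements makes it `Z`.
  wlog hsZ : s ∈ Z generalizing Z Y
  · refine this _ _ (h.compl hM.con ha' hb') ?_
    refine Finset.mem_sdiff.2 ⟨by simp, fun hsY => ?_⟩
    obtain ⟨m, hm⟩ := h.chain.even hsY hsZ
    omega
  have hsub : ∀ X, X ⊆ insert s (V \ S) → X ∪ S ⊆ V := by
    intro X hX
    refine Finset.union_subset (hX.trans ?_) hS
    exact Finset.insert_subset (hS hs) Finset.sdiff_subset
  have hch := h.chain.of_con hsZ h.sub hs
  have hsY := h.chain.subset hsZ
  have c1 := card_union_of_con h.sub hsY hs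
  have c2 := card_union_of_con (h.chain.subset.trans h.sub) hsZ hs
  have e1 := h.two_le; have e2 := h.card_add
  have hdZ : d M (Z ∪ S) = 3 := by rw [← d_con_of_mem hsZ, h.d_eq]
  have hYr : (Y ∪ S).card + 3 ≤ V.card → a ∈ Y ∪ S ∧ b ∈ Y ∪ S := fun hh => by
    have := h.right (by omega)
    simp [this]
  -- If `Z = {s, t}`, expanding `s` gives a chain that starts with `S`, `insert t S`. If `Z` is
  -- larger it has no roots, and neither has `Z ∪ S`, which then starts a full segmentation of `M`.
  by_cases hZ : Z.card = 2
  · right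
    refine ⟨Y ∪ S, hsub Y h.sub, ?_, by omega, hYr⟩
    obtain ⟨t, hts, ht⟩ : ∃ t, t ≠ s ∧ Z = {s, t} := by
      obtain ⟨p, q, hpq, rfl⟩ := Finset.card_eq_two.1 hZ
      rcases Finset.mem_insert.1 hsZ with rfl | hh
      · exact ⟨q, hpq.symm, rfl⟩
      · rw [Finset.mem_singleton] at hh
        subst hh
        exact ⟨p, hpq, Finset.pair_comm _ _⟩
    have htS : t ∉ S := by
      have := h.sub (h.chain.subset (show t ∈ Z by rw [ht]; simp))
      simp only [Finset.mem_insert, Finset.mem_sdiff] at this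
      tauto
    have hZS : Z ∪ S = insert t S := by
      rw [ht]; ext x; simp only [Finset.mem_union, Finset.mem_insert, Finset.mem_singleton]
      constructor
      · rintro ((rfl | rfl) | h) <;> tauto
      · tauto
    rw [hZS] at hch hdZ
    exact (Chain.single htS (by rw [hdZ, hd])).trans hch
  · left
    obtain ⟨haZ, hbZ⟩ := h.left (by omega)
    have hn : ∀ x, x ∉ Z → (x ∈ S → x = s) → x ∉ Z ∪ S := by
      intro x h1 h2 h3
      rcases Finset.mem_union.1 h3 with h3 | h3
      · exact h1 h3
      · exact h1 (h2 h3 ▸ hsZ)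
    exact ⟨_, _, hch, hsub Y h.sub, hdZ, by omega, by omega,
      fun _ => ⟨hn a haZ hsa, hn b hbZ hsb⟩, hYr⟩

/-- The structure theorem for edge multisets. -/
theorem out_of_ec (hM : Sup M V) (ec : EC M V) (h4 : 4 ≤ V.card) (ha : a ∈ V) (hb : b ∈ V)
    (hab : a ≠ b) : Out M V a b := by
  induction hn : M.card + V.card using Nat.strong_induction_on generalizing M V with
  | _ n ih
  subst hn
  have ih' : OutBelow a b (M.card + V.card) := fun N W h1 h2 h3 h4 h5 h6 => ih _ h1 h2 h3 h4 h5 h6 rfl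
  by_cases hnt : NT M V
  · by_cases h5 : 5 ≤ V.card
    · by_contra hcon
      simp only [Out, not_or] at hcon
      exact Ctx.false ⟨hM, ec, hnt, h5, ha, hb, hab, ih', hcon.1, hcon.2.1⟩
    · obtain ⟨x, T, hx, rfl, hT⟩ := Finset.card_eq_succ.1 (show V.card = 3 + 1 by omega)
      obtain ⟨y, z, w, hyz, hyw, hzw, rfl⟩ := Finset.card_eq_three.1 hT
      simp only [Finset.mem_insert, Finset.mem_singleton, not_or] at hx
      have h1 : ∀ t ∈ ({x, y, z, w} : Finset α), 3 ≤ d M {t} := fun t ht => ec.three_le ht (by omega)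
      have h2 : ∀ t ∈ ({x, y, z, w} : Finset α), x ≠ t → 4 ≤ d M {x, t} := fun t ht hxt =>
        hnt _ (Finset.insert_subset (by simp) (by simpa using ht)) (by rw [Finset.card_pair hxt])
          (by rw [Finset.card_pair hxt]; omega)
      rcases K4set_or_Dbl_of_card_four (nodup_four.2 ⟨hx.1, hx.2.1, hx.2.2, hyz, hyw, hzw⟩) hM
        (h1 x (by simp)) (h1 y (by simp)) (h1 z (by simp)) (h1 w (by simp)) (h2 y (by simp) hx.1)
        (h2 z (by simp) hx.2.1) (h2 w (by simp) hx.2.2) with h | h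
      · exact Or.inl ⟨_, ha, hb, h⟩
      · exact Or.inr (Or.inl h)
  simp only [NT, not_forall, not_le] at hnt
  obtain ⟨S, hS, h2, h3, hlt⟩ := hnt
  have hd : d M S = 3 := by
    have := ec S hS (Finset.card_pos.1 (by omega)) (by rintro rfl; omega)
    omega
  -- A side without roots may itself be the first set of the segmentation, so one half chain is
  -- enough.
  have rootfree : ∀ S ⊆ V, 2 ≤ S.card → S.card + 2 ≤ V.card → d M S = 3 → a ∉ S → b ∉ S →
      Out M V a b := by
    intro S hS h2 h3 hd haS hbS
    obtain ⟨s, hs⟩ := Finset.card_pos.1 (show 0 < S.card by omega)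
    rcases exists_half_chain hM ec ha hb ih' hS h2 h3 hd hs (by tauto) (by tauto) with
      h | h | ⟨Y, hY, h, hY2, hY3⟩
    · exact Or.inl h
    · exact Or.inr (Or.inr h)
    · exact Or.inr (Or.inr ⟨S, Y, h, hY, hd, h2, hY2, fun _ => ⟨haS, hbS⟩, hY3⟩)
  have hc := Finset.card_sdiff_add_card_eq_card hS
  have hdc : d M (V \ S) = 3 := by rw [hM.d_compl, hd]
  by_cases h0 : a ∉ S ∧ b ∉ S
  · exact rootfree S hS h2 h3 hd h0.1 h0.2
  by_cases h1 : a ∈ S ∧ b ∈ S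
  · exact rootfree (V \ S) Finset.sdiff_subset (by omega) (by omega) hdc (by simp [h1]) (by simp [h1])
  obtain ⟨r, r', hr, hrS, hr'S⟩ : ∃ r r', AreRoots a b r r' ∧ r ∈ S ∧ r' ∉ S := by
    by_cases haS : a ∈ S
    · exact ⟨a, b, Or.inl ⟨rfl, rfl⟩, haS, by tauto⟩
    · exact ⟨b, a, Or.inr ⟨rfl, rfl⟩, by tauto, haS⟩
  have hr'V : r' ∈ V := by rcases hr.right with rfl | rfl <;> assumption
  have key : ∀ t, t = a ∨ t = b → (t ∈ S → t = r) ∧ (t ∈ V \ S → t = r') := by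
    intro t ht
    refine ⟨fun h => ?_, fun h => ?_⟩
    · by_contra hne; exact hr'S (hr.eq_right ht hne ▸ h)
    -- With the roots separated, each side is contracted to its own root; the two half chains are
    -- then glued at `S`.
    · by_contra hne; exact (Finset.mem_sdiff.1 h).2 (hr.symm.eq_right ht hne ▸ hrS)
  rcases exists_half_chain hM ec ha hb ih' hS h2 h3 hd hrS (key a (Or.inl rfl)).1 (key b (Or.inr rfl)).1
    with h | h | ⟨Y, hY, h, hY2, hY3⟩
  · exact Or.inl h
  · exact Or.inr (Or.inr h)
  rcases exists_half_chain hM ec ha hb ih' Finset.sdiff_subset (by omega) (by omega) hdc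
    (Finset.mem_sdiff.2 ⟨hr'V, hr'S⟩) (key a (Or.inl rfl)).2 (key b (Or.inr rfl)).2
    with h' | h' | ⟨Y', hY', h', hY2', hY3'⟩
  · exact Or.inl h'
  · exact Or.inr (Or.inr h')
  have h'' := h'.compl hM hY'
  rw [Finset.sdiff_sdiff_eq_self hS] at h''
  have e := Finset.card_sdiff_add_card_eq_card hY'
  refine Or.inr (Or.inr ⟨V \ Y', Y, h''.trans h, hY, ?_, by omega, hY2, fun hh => ?_, hY3⟩)
  · rw [hM.d_compl, h'.d_eq, hdc]
  · have := hY3' (by omega)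
    simp [this]

end EdgeMultiset

end

noncomputable section

namespace EdgeMultiset

open scoped Classical

variable {α β : Type*} {M N R : Multiset (Sym2 α)} {X Y Z S V : Finset α} {x y z w a b s p u v : α}

/-! ### Edge multisets of graphs -/

/-- The finite set `F` is the edge set of `G`, and `φ` maps its elements to their pairs of ends. -/
structure IsRep (G : Graph α β) (F : Finset β) (φ : β → Sym2 α) : Prop where
  isLink_iff : ∀ e x y, G.IsLink e x y ↔ e ∈ F ∧ φ e = s(x, y)

variable {G G' : Graph α β} {F : Finset β} {φ : β → Sym2 α}

lemma exists_isRep [Nonempty α] (h : E(G).Finite) : ∃ φ, IsRep G h.toFinset φ := by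
  have key : ∀ e, ∃ p : Sym2 α, e ∈ E(G) → ∀ x y, G.IsLink e x y ↔ p = s(x, y) := by
    intro e
    by_cases he : e ∈ E(G)
    · obtain ⟨x, y, hxy⟩ := G.exists_isLink_of_mem_edgeSet he
      exact ⟨s(x, y), fun _ x' y' => hxy.isLink_iff_sym2_eq⟩
    · obtain ⟨x⟩ := ‹Nonempty α›
      exact ⟨s(x, x), fun h => absurd h he⟩
  choose φ hφ using key
  refine ⟨φ, ⟨fun e x y => ?_⟩⟩
  rw [Set.Finite.mem_toFinset]
  exact ⟨fun h => ⟨h.edge_mem, (hφ e h.edge_mem x y).1 h⟩, fun h => (hφ e h.1 x y).2 h.2⟩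

lemma exists_le_of_le_map {ι κ : Type*} {f : ι → κ} {s : Multiset ι} {t : Multiset κ}
    (h : t ≤ s.map f) : ∃ u ≤ s, u.map f = t := by
  induction s using Multiset.induction generalizing t with
  | empty =>
    refine ⟨0, le_rfl, ?_⟩
    rw [Multiset.map_zero] at h
    rw [Multiset.map_zero, Multiset.le_zero.1 h]
  | cons a s ih =>
    rw [Multiset.map_cons] at h
    by_cases ha : f a ∈ t
    · obtain ⟨t, rfl⟩ := Multiset.exists_cons_of_mem ha
      obtain ⟨u, hu, rfl⟩ := ih ((Multiset.cons_le_cons_iff _).1 h)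
      exact ⟨a ::ₘ u, Multiset.cons_le_cons _ hu, Multiset.map_cons _ _ _⟩
    · obtain ⟨u, hu, rfl⟩ := ih ((Multiset.le_cons_of_notMem ha).1 h)
      exact ⟨u, hu.trans (Multiset.le_cons_self _ _), rfl⟩

lemma IsRep.edgeSet_eq (h : IsRep G F φ) : E(G) = F := by
  ext e
  rw [G.edge_mem_iff_exists_isLink]
  constructor
  · rintro ⟨x, y, hxy⟩; exact ((h.isLink_iff e x y).1 hxy).1
  · intro he
    obtain ⟨x, y, hxy⟩ : ∃ x y, φ e = s(x, y) := by
      induction φ e with | _ x y => exact ⟨x, y, rfl⟩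
    exact ⟨x, y, (h.isLink_iff e x y).2 ⟨he, hxy⟩⟩

lemma IsRep.exists_restrict (h : IsRep G F φ) (hN : N ≤ F.val.map φ) :
    ∃ G' F', Graph.ImmersionStep G G' ∧ V(G') = V(G) ∧ IsRep G' F' φ ∧ F'.val.map φ = N := by
  obtain ⟨u, hu, rfl⟩ := exists_le_of_le_map hN
  let F' : Finset β := ⟨u, Multiset.nodup_of_le hu F.nodup⟩
  have hF : ∀ e, e ∈ F' → e ∈ F := fun e he => Multiset.mem_of_le hu he
  refine ⟨G.restrict F', F', Or.inl Graph.restrict_le, rfl, ⟨fun e x y => ?_⟩, rfl⟩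
  rw [Graph.restrict_isLink, h.isLink_iff]
  constructor
  · rintro ⟨h1, h2⟩
    exact ⟨by simpa using h1, h2.2⟩
  · rintro ⟨h1, h2⟩
    exact ⟨by simpa using h1, hF e h1, h2⟩

lemma IsRep.exists_split (h : IsRep G F φ) (hxz : x ≠ z)
    (hF : F.val.map φ = s(x, y) ::ₘ s(y, z) ::ₘ R) :
    ∃ (G' : Graph α β) (F' : Finset β) (φ' : β → Sym2 α), G.IsSplitting G' ∧ V(G') = V(G) ∧
      IsRep G' F' φ' ∧ F'.val.map φ' = s(x, z) ::ₘ R := by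
  obtain ⟨e, he, hex⟩ := Multiset.mem_map.1 (show s(x, y) ∈ F.val.map φ by rw [hF]; simp)
  obtain ⟨t, ht⟩ := Multiset.exists_cons_of_mem he
  have ht' : t.map φ = s(y, z) ::ₘ R := by
    rw [ht, Multiset.map_cons, hex] at hF
    exact (Multiset.cons_inj_right _).1 hF
  obtain ⟨f, hf, hfy⟩ := Multiset.mem_map.1 (show s(y, z) ∈ t.map φ by rw [ht']; simp)
  obtain ⟨t, rfl⟩ := Multiset.exists_cons_of_mem hf
  rw [Multiset.map_cons, hfy] at ht'
  have ht2 := (Multiset.cons_inj_right _).1 ht'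
  have hnd := F.nodup
  rw [ht, Multiset.nodup_cons, Multiset.nodup_cons] at hnd
  obtain ⟨h1, h2, h3⟩ := hnd
  rw [Multiset.mem_cons, not_or] at h1
  have hmem : ∀ g, g ∈ F ↔ g = e ∨ g = f ∨ g ∈ t := by
    intro g; rw [← Finset.mem_val, ht]; simp
  have hxV := ((h.isLink_iff e x y).2 ⟨he, hex⟩).left_mem
  have hfF : f ∈ F := (hmem f).2 (by simp)
  have hzV := ((h.isLink_iff f y z).2 ⟨hfF, hfy⟩).right_mem
  -- The new edge reuses the name `e`, and the name `f` is dropped.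
  let φ' : β → Sym2 α := Function.update φ e s(x, z)
  let F' : Finset β := ⟨e ::ₘ t, Multiset.nodup_cons.2 ⟨h1.2, h3⟩⟩
  have hmem' : ∀ g, g ∈ F' ↔ g = e ∨ g ∈ t := fun g => Multiset.mem_cons
  have key : ∀ g p q, (g ∈ F' ∧ φ' g = s(p, q)) ↔
      (G.IsLink g p q ∧ g ≠ e ∧ g ≠ f) ∨ (g = e ∧ s(p, q) = s(x, z)) := by
    intro g p q
    rw [h.isLink_iff, hmem', hmem]
    by_cases hge : g = e
    · subst hge
      simp only [φ', Function.update_self, ne_eq, not_true, false_and, and_false, true_or, true_and,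
        false_or]
      exact eq_comm
    · by_cases hgf : g = f
      · subst hgf; simp [hge, h2]
      · simp [φ', hge, hgf]
  let G' : Graph α β :=
    { vertexSet := V(G)
      IsLink := fun g p q => g ∈ F' ∧ φ' g = s(p, q)
      isLink_symm := fun g _ => ⟨fun p q hpq => ⟨hpq.1, hpq.2.trans Sym2.eq_swap⟩⟩
      eq_or_eq_of_isLink_of_isLink := by
        rintro g p q p' q' ⟨-, h4⟩ ⟨-, h5⟩
        rw [h4, Sym2.eq_iff] at h5
        tauto
      left_mem_of_isLink := by
        intro g p q hpq
        rcases (key g p q).1 hpq with h4 | ⟨-, h4⟩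
        · exact h4.1.left_mem
        · rcases Sym2.eq_iff.1 h4 with ⟨rfl, -⟩ | ⟨rfl, -⟩
          · exact hxV
          · exact hzV }
  refine ⟨G', F', φ', ⟨x, y, z, e, f, e, h1.1, hxz, (h.isLink_iff e x y).2 ⟨he, hex⟩,
    (h.isLink_iff f y z).2 ⟨hfF, hfy⟩, by simp, rfl, key⟩, rfl, ⟨fun _ _ _ => Iff.rfl⟩, ?_⟩
  change (e ::ₘ t).map φ' = _
  rw [Multiset.map_cons, ← ht2]
  congr 1
  · simp [φ']
  · refine Multiset.map_congr rfl fun g hg => ?_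
    have : g ≠ e := by rintro rfl; exact h1.2 hg
    simp [φ', this]

/-- The graph represents only the non-loop edges, so a degenerate split of the multiset is realised
by a deletion. -/
lemma IsRep.exists_of_step (h : IsRep G F φ) (hM : F.val.map φ = nl M) (hs : Step M N) :
    ∃ (G' : Graph α β) (F' : Finset β) (φ' : β → Sym2 α), Graph.ImmersionStep G G' ∧ V(G') = V(G) ∧
      IsRep G' F' φ' ∧ F'.val.map φ' = nl N := by
  have del : nl N ≤ nl M → ∃ (G' : Graph α β) (F' : Finset β) (φ' : β → Sym2 α),
      Graph.ImmersionStep G G' ∧ V(G') = V(G) ∧ IsRep G' F' φ' ∧ F'.val.map φ' = nl N := by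
    intro hle
    obtain ⟨G', F', h1, h2, h3, h4⟩ := h.exists_restrict (hM ▸ hle)
    exact ⟨G', F', φ, h1, h2, h3, h4⟩
  cases hs with
  | del hle => exact del hle
  | split R x y z =>
    by_cases hxz : x = z
    · refine del ?_
      subst hxz
      rw [nl_cons, if_pos (by simp)]
      exact Multiset.filter_le_filter _ ((Multiset.le_cons_self _ _).trans (Multiset.le_cons_self _ _))
    by_cases hxy : x = y
    · refine del ?_
      subst hxy
      exact Multiset.filter_le_filter _ (Multiset.le_cons_self _ _)
    by_cases hyz : y = z
    · refine del ?_
      subst hyz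
      exact Multiset.filter_le_filter _ (Multiset.cons_le_cons _ (Multiset.le_cons_self _ _))
    rw [nl_cons, if_neg (by simpa using hxy), nl_cons, if_neg (by simpa using hyz)] at hM
    obtain ⟨G', F', φ', h1, h2, h3, h4⟩ := h.exists_split hxz hM
    refine ⟨G', F', φ', Or.inr h1, h2, h3, ?_⟩
    rw [h4, nl_cons, if_neg (by simpa using hxz)]

lemma IsRep.exists_of_reach (h : IsRep G F φ) (hM : F.val.map φ = nl M) (hs : Reach M N) :
    ∃ (G' : Graph α β) (F' : Finset β) (φ' : β → Sym2 α),
      Relation.ReflTransGen Graph.ImmersionStep G G' ∧ V(G') = V(G) ∧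
      IsRep G' F' φ' ∧ F'.val.map φ' = nl N := by
  induction hs with
  | refl => exact ⟨G, F, φ, .refl, rfl, h, hM⟩
  | tail _ hs ih =>
    obtain ⟨G', F', φ', h1, h2, h3, h4⟩ := ih
    obtain ⟨G2, F2, φ2, k1, k2, k3, k4⟩ := h3.exists_of_step h4 hs
    exact ⟨G2, F2, φ2, h1.tail k1, k2.trans h2, k3, k4⟩

/-! ### The complete graph on four vertices -/

end EdgeMultiset

namespace Graph

/-- Isomorphisms of multigraphs can be inverted. -/
def Iso.symm {α β α' β' : Type*} {G : Graph α β} {H : Graph α' β'} (f : Iso G H) : Iso H G where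
  vertexEquiv := f.vertexEquiv.symm
  edgeEquiv := f.edgeEquiv.symm
  isLink_iff e x y := by
    rw [f.isLink_iff]; simp

/-- A graph with distinct edges between four vertices contains a complete graph on these. -/
lemma exists_le_iso_D₃ {α β : Type*} {G : Graph α β} {τ : Fin 4 → α} (hτ : Function.Injective τ)
    (h : ∀ i j, i ≠ j → G.Adj (τ i) (τ j)) :
    ∃ G' ≤ G, ∃ f : Iso G' D₃, ∀ i, ∃ hi : τ i ∈ V(G'), (f.vertexEquiv ⟨τ i, hi⟩ : Fin 4) = i := by
  classical
  have hn : Nonempty β := ⟨(h 0 1 (by decide)).choose⟩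
  have key : ∀ p : Sym2 (Fin 4), ∃ e, ∀ i j, i ≠ j → p = s(i, j) → G.IsLink e (τ i) (τ j) := by
    intro p
    induction p with | _ i j
    by_cases hij : i = j
    · refine ⟨hn.some, fun i' j' hne heq => ?_⟩
      rw [hij, Sym2.eq_iff] at heq
      rcases heq with ⟨rfl, rfl⟩ | ⟨rfl, rfl⟩ <;> exact absurd rfl hne
    · obtain ⟨e, he⟩ := h i j hij
      refine ⟨e, fun i' j' _ heq => ?_⟩
      rcases Sym2.eq_iff.1 heq with ⟨rfl, rfl⟩ | ⟨rfl, rfl⟩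
      · exact he
      · exact he.symm
  choose g hg using key
  have hinj : Set.InjOn g (⊤ : SimpleGraph (Fin 4)).edgeSet := by
    intro p hp q hq heq
    induction p with | _ i j
    induction q with | _ i' j'
    have h1 := hg s(i, j) i j (by simpa using hp) rfl
    have h2 := hg s(i', j') i' j' (by simpa using hq) rfl
    rw [← heq] at h2
    rcases h1.eq_and_eq_or_eq_and_eq h2 with ⟨h3, h4⟩ | ⟨h3, h4⟩
    · rw [hτ h3, hτ h4]
    · rw [hτ h3, hτ h4, Sym2.eq_swap]
  let H : Graph α β :=
    { vertexSet := Set.range τ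
      IsLink := fun e x y => ∃ i j, i ≠ j ∧ e = g s(i, j) ∧ x = τ i ∧ y = τ j
      edgeSet := g '' (⊤ : SimpleGraph (Fin 4)).edgeSet
      isLink_symm := fun e _ => ⟨by
        rintro x y ⟨i, j, h1, h2, h3, h4⟩
        exact ⟨j, i, h1.symm, by rw [h2, Sym2.eq_swap], h4, h3⟩⟩
      eq_or_eq_of_isLink_of_isLink := by
        rintro e x y x' y' ⟨i, j, h1, rfl, rfl, rfl⟩ ⟨i', j', h1', h2', rfl, rfl⟩
        have e1 := hg s(i, j) i j h1 rfl
        have e2 := hg s(i', j') i' j' h1' rfl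
        rw [← h2'] at e2
        exact e1.left_eq_or_eq e2
      edge_mem_iff_exists_isLink := by
        intro e
        constructor
        · rintro ⟨p, hp, rfl⟩
          induction p with | _ i j
          exact ⟨τ i, τ j, i, j, by simpa using hp, rfl, rfl, rfl⟩
        · rintro ⟨x, y, i, j, h1, h2, -, -⟩
          exact ⟨s(i, j), by simpa using h1, h2.symm⟩
      left_mem_of_isLink := by
        rintro e x y ⟨i, j, -, -, rfl, -⟩
        exact ⟨i, rfl⟩ }
  have hle : H ≤ G := by
    refine ⟨?_, ?_⟩
    · rintro _ ⟨i, rfl⟩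
      obtain ⟨j, hj⟩ := exists_ne i
      exact (h i j hj.symm).left_mem
    · rintro e x y ⟨i, j, h1, rfl, rfl, rfl⟩
      exact hg _ i j h1 rfl
  let f : Iso D₃ H :=
    { vertexEquiv := (Equiv.Set.univ (Fin 4)).trans (Equiv.ofInjective τ hτ)
      edgeEquiv := Equiv.Set.imageOfInjOn g _ hinj
      isLink_iff := by
        rintro ⟨p, hp⟩ ⟨i, hi⟩ ⟨j, hj⟩
        change (p = s(i, j) ∧ p ∈ (⊤ : SimpleGraph (Fin 4)).edgeSet) ↔
          ∃ i' j', i' ≠ j' ∧ g p = g s(i', j') ∧ τ i = τ i' ∧ τ j = τ j'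
        constructor
        · rintro ⟨rfl, h2⟩
          exact ⟨i, j, by simpa using h2, rfl, rfl, rfl⟩
        · rintro ⟨i', j', h1, h2, h3, h4⟩
          rw [hτ h3, hτ h4]
          exact ⟨hinj hp (by simpa using h1) h2, hp⟩ }
  refine ⟨H, hle, f.symm, fun i => ⟨⟨i, rfl⟩, ?_⟩⟩
  change ((f.vertexEquiv.symm ⟨τ i, _⟩ : V(D₃)) : Fin 4) = i
  have : f.vertexEquiv ⟨i, trivial⟩ = ⟨τ i, ⟨i, rfl⟩⟩ := rfl
  rw [← this, Equiv.symm_apply_apply]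

end Graph

namespace EdgeMultiset

variable {α β : Type*} {M : Multiset (Sym2 α)} {a b : α} {G : Graph α β} {F : Finset β} {φ : β → Sym2 α}

lemma IsRep.hasRootedImmersion (h : IsRep G F φ) (hM : F.val.map φ = nl M) (hab : a ≠ b)
    (hK : K4r M a b) : G.HasRootedImmersion ![a, b] Graph.D₃ ![0, 1] := by
  classical
  obtain ⟨T, ha, hb, hT, N, hN, hadj⟩ := hK
  obtain ⟨G', F', φ', h1, -, h3, h4⟩ := h.exists_of_reach hM hN
  obtain ⟨c, d, hcd, hTe⟩ : ∃ c d, c ≠ d ∧ (T.erase a).erase b = {c, d} := by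
    refine Finset.card_eq_two.1 ?_
    rw [Finset.card_erase_of_mem (by simp [hab.symm, hb]), Finset.card_erase_of_mem ha, hT]
  have hc : c ∈ (T.erase a).erase b := by rw [hTe]; simp
  have hd : d ∈ (T.erase a).erase b := by rw [hTe]; simp
  simp only [Finset.mem_erase] at hc hd
  have hadj' : ∀ x ∈ T, ∀ y ∈ T, x ≠ y → G'.Adj x y := by
    intro x hx y hy hxy
    have : s(x, y) ∈ F'.val.map φ' := by
      rw [h4, nl, Multiset.mem_filter]
      exact ⟨hadj x hx y hy hxy, by simpa using hxy⟩
    obtain ⟨e, he, hxy⟩ := Multiset.mem_map.1 this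
    exact ⟨e, (h3.isLink_iff e x y).2 ⟨he, hxy⟩⟩
  have hinj : Function.Injective ![a, b, c, d] := by
    intro i j
    fin_cases i <;> fin_cases j <;> simp [hab, hab.symm, hc.1, hc.2.1, hd.1, hd.2.1, hcd, hcd.symm,
      hc.1.symm, hc.2.1.symm, hd.1.symm, hd.2.1.symm]
  have hmem : ∀ i, ![a, b, c, d] i ∈ T := by
    intro i; fin_cases i <;> simp [ha, hb, hc, hd]
  obtain ⟨H, hH, f, hf⟩ := Graph.exists_le_iso_D₃ (G := G') hinj fun i j hij =>
    hadj' _ (hmem i) _ (hmem j) (hinj.ne hij)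
  refine ⟨H, h1.tail (Or.inl hH), f, fun i => ?_⟩
  fin_cases i
  · exact hf 0
  · exact hf 1

end EdgeMultiset

end

noncomputable section

namespace EdgeMultiset

open scoped Classical

variable {α β : Type*} {M N R : Multiset (Sym2 α)} {X Y Z S V : Finset α} {x y z w a b s p u v : α}
  {G G' : Graph α β} {F : Finset β} {φ : β → Sym2 α}

/-! ### Cuts and segmentations of graphs -/

lemma cr_eq_one_iff (X : Finset α) (x y : α) :
    cr X s(x, y) = 1 ↔ (x ∈ X ∧ y ∉ X) ∨ (y ∈ X ∧ x ∉ X) := by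
  rw [cr_mk]; by_cases hx : x ∈ X <;> by_cases hy : y ∈ X <;> simp [hx, hy]

lemma cr_le_one (X : Finset α) (e : Sym2 α) : cr X e = 0 ∨ cr X e = 1 := by
  unfold cr; split_ifs <;> simp

lemma d_map (F : Finset β) (φ : β → Sym2 α) (X : Finset α) :
    d (F.val.map φ) X = ∑ e ∈ F, cr X (φ e) := by
  simp only [d, wt, Multiset.map_map]; rfl

lemma exists_eq_mk (p : Sym2 α) : ∃ x y, p = s(x, y) := by
  induction p with | _ x y
  exact ⟨x, y, rfl⟩

lemma IsRep.cutSize_eq (h : IsRep G F φ) {A : Set α} (hA : ∀ x ∈ V(G), x ∈ A ↔ x ∈ X) :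
    G.cutSize A = d (F.val.map φ) X := by
  have e : G.cut A = (F.filter fun e => cr X (φ e) = 1 : Finset β) := by
    ext e
    simp only [Graph.cut, Set.mem_ofPred_eq, Finset.coe_filter]
    constructor
    · rintro ⟨x, y, hxy, hx, hy⟩
      obtain ⟨h1, h2⟩ := (h.isLink_iff e x y).1 hxy
      rw [hA _ hxy.left_mem] at hx
      rw [hA _ hxy.right_mem] at hy
      exact ⟨h1, by rw [h2, cr_eq_one_iff]; exact Or.inl ⟨hx, hy⟩⟩
    · rintro ⟨h1, h2⟩
      obtain ⟨x, y, hxy⟩ : ∃ x y, φ e = s(x, y) := exists_eq_mk _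
      have hl := (h.isLink_iff e x y).2 ⟨h1, hxy⟩
      rw [hxy, cr_eq_one_iff, ← hA _ hl.left_mem, ← hA _ hl.right_mem] at h2
      rcases h2 with h2 | h2
      · exact ⟨x, y, hl, h2⟩
      · exact ⟨y, x, hl.symm, h2⟩
  rw [Graph.cutSize, e, Set.ncard_coe_finset, Finset.card_filter, d_map]
  refine Finset.sum_congr rfl fun e _ => ?_
  rcases cr_le_one X (φ e) with h | h <;> simp [h]

lemma IsRep.sup (h : IsRep G F φ) (hV : (V : Set α) = V(G)) : Sup (F.val.map φ) V := by
  intro x y hxy _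
  obtain ⟨e, he, hxy⟩ := Multiset.mem_map.1 hxy
  have hl := (h.isLink_iff e x y).2 ⟨he, hxy⟩
  exact ⟨by rw [← Finset.mem_coe, hV]; exact hl.left_mem,
    by rw [← Finset.mem_coe, hV]; exact hl.right_mem⟩

lemma IsRep.ec (h : IsRep G F φ) (hV : (V : Set α) = V(G)) (hG : G.EdgeConnected 3) :
    EC (F.val.map φ) V := by
  intro X hX hne hne'
  rw [← h.cutSize_eq (A := X) (fun _ _ => Iff.rfl)]
  refine hG X (by rw [← hV]; exact_mod_cast hX) (by simpa using hne) ?_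
  rw [← hV, ← Finset.coe_sdiff, Finset.coe_nonempty, Finset.sdiff_nonempty]
  exact fun hh => hne' (hX.antisymm hh)

lemma IsRep.nl_eq (h : IsRep G F φ) (hG : G.Loopless) : nl (F.val.map φ) = F.val.map φ := by
  refine Multiset.filter_eq_self.2 fun p hp hd => ?_
  obtain ⟨e, he, rfl⟩ := Multiset.mem_map.1 hp
  obtain ⟨x, y, hxy⟩ : ∃ x y, φ e = s(x, y) := exists_eq_mk _
  rw [hxy, Sym2.mk_isDiag_iff] at hd
  subst hd
  exact hG.not_isLoopAt e x ((h.isLink_iff e x x).2 ⟨he, hxy⟩)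

lemma Chain.exists_seq (h : Chain M Z Y) : ∃ (l : ℕ) (S : ℕ → Finset α), S 0 = Z ∧ S l = Y ∧
    (∀ i < l, ∃ p, p ∉ S i ∧ S (i + 1) = insert p (S i)) ∧ ∀ i ≤ l, d M (S i) = d M Z ∧ S i ⊆ Y := by
  induction h with
  | refl => exact ⟨0, fun _ => Z, rfl, rfl, by simp, by simp⟩
  | tail _ h ih =>
    obtain ⟨p, hp, rfl, hd⟩ := h
    obtain ⟨l, S, h0, hl, hS, hd'⟩ := ih
    refine ⟨l + 1, fun i => if i ≤ l then S i else insert p (S l), by simp [h0], by simp [hl], ?_, ?_⟩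
    · intro i hi
      rcases Nat.lt_succ_iff_lt_or_eq.1 hi with hi | rfl
      · simpa [hi.le, Nat.succ_le_of_lt hi] using hS i hi
      · exact ⟨p, by simpa [hl] using hp, by simp⟩
    · intro i hi
      by_cases hil : i ≤ l
      · simp only [hil, if_true]
        exact ⟨(hd' i hil).1, (hd' i hil).2.trans (Finset.subset_insert _ _)⟩
      · simp only [hil, if_false, hl]
        exact ⟨by rw [hd, ← hl, (hd' l le_rfl).1], subset_rfl⟩

lemma IsRep.hasSegmentation (h : IsRep G F φ) (hV : (V : Set α) = V(G))
    (hS : SegOf (F.val.map φ) V a b Z Y) :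
    G.HasSegmentation 3 (Z : Set α) ((V \ Y : Finset α) : Set α) := by
  obtain ⟨l, S, h0, hl, hS1, hS2⟩ := hS.chain.exists_seq
  have hZY := hS.chain.subset
  refine ⟨l, fun i => S i, ⟨?_, ?_, ?_, fun i hi => ?_, by rw [h0], ?_, fun i hi => ?_, fun i hi => ?_⟩,
    fun i hi => ?_⟩
  · rw [← hV]; exact_mod_cast hZY.trans hS.sub
  · rw [← hV]; exact_mod_cast Finset.sdiff_subset
  · rw [Finset.disjoint_coe, Finset.disjoint_left]
    intro t ht; simp [hZY ht]
  · rw [← hV]; exact_mod_cast (hS2 i hi).2.trans hS.sub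
  · rw [hl, ← hV, Finset.coe_sdiff]
  · obtain ⟨p, hp, he⟩ := hS1 i hi
    rw [he, Finset.coe_ssubset]; exact Finset.ssubset_insert hp
  · obtain ⟨p, hp, he⟩ := hS1 i hi
    rw [he, ← Finset.coe_sdiff, Set.ncard_coe_finset, Finset.insert_sdiff_cancel hp,
      Finset.card_singleton]
  · rw [h.cutSize_eq (X := S i) (fun _ _ => Iff.rfl), (hS2 i hi).1, hS.d_eq]

lemma IsRep.exists_segmentation (h : IsRep G F φ) (hV : (V : Set α) = V(G))
    (hS : SegOf (F.val.map φ) V a b Z Y) :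
    ∃ X₀ X₁ : Set α, G.HasSegmentation 3 X₀ X₁ ∧ (3 ≤ X₀.ncard → a ∉ X₀ ∧ b ∉ X₀) ∧
      (3 ≤ X₁.ncard → a ∉ X₁ ∧ b ∉ X₁) := by
  have e := Finset.card_sdiff_add_card_eq_card hS.sub
  refine ⟨_, _, h.hasSegmentation hV hS, fun hc => ?_, fun hc => ?_⟩
  · rw [Set.ncard_coe_finset] at hc
    simpa using hS.left hc
  · rw [Set.ncard_coe_finset] at hc
    have := hS.right (by omega)
    simp [this]

/-! ### Segmentations exclude rooted immersions -/

lemma d_step_le (h : Step M N) (X : Finset α) : d N X ≤ d M X := by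
  cases h with
  | del h => rw [← d_nl (M := N), ← d_nl (M := M)]; exact d_mono h X
  | split R x y z =>
    simp only [d_cons, cr_mk]
    by_cases h1 : x ∈ X <;> by_cases h2 : y ∈ X <;> by_cases h3 : z ∈ X <;> simp [h1, h2, h3] <;> omega

lemma d_reach_le (h : Reach M N) (X : Finset α) : d N X ≤ d M X := by
  induction h with
  | refl => exact le_rfl
  | tail _ h ih => exact (d_step_le h X).trans ih

lemma IsRep.step (h : IsRep G F φ) (hs : Graph.ImmersionStep G G') :
    V(G') ⊆ V(G) ∧ ∃ F' φ', IsRep G' F' φ' ∧ Step (F.val.map φ) (F'.val.map φ') := by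
  rcases hs with hle | ⟨x, y, z, e, f, g, hef, -, he, hf, hg, hV, hl⟩
  · refine ⟨hle.vertexSet_mono, F.filter (· ∈ E(G')), φ, ⟨fun e x y => ?_⟩, .del ?_⟩
    · rw [Finset.mem_filter]
      constructor
      · intro hxy
        obtain ⟨h1, h2⟩ := (h.isLink_iff e x y).1 (hxy.mono hle)
        exact ⟨⟨h1, hxy.edge_mem⟩, h2⟩
      · rintro ⟨⟨h1, h2⟩, h3⟩
        exact (hle.isLink_iff h2).2 ((h.isLink_iff e x y).2 ⟨h1, h3⟩)
    · exact Multiset.filter_le_filter _ (Multiset.map_le_map (Finset.val_le_iff.2 (Finset.filter_subset _ _)))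
  · rw [h.isLink_iff] at he hf
    rw [h.edgeSet_eq] at hg
    have hg' : g ∉ (F.erase e).erase f := by
      simp only [Set.mem_sdiff, Finset.mem_coe, Set.mem_insert_iff, Set.mem_singleton_iff,
        Finset.mem_erase] at hg ⊢
      tauto
    refine ⟨hV.subset, insert g ((F.erase e).erase f), Function.update φ g s(x, z),
      ⟨fun k p q => ?_⟩, ?_⟩
    · rw [hl, h.isLink_iff, Finset.mem_insert]
      by_cases hk : k = g
      · subst hk
        simp only [Finset.mem_erase] at hg'
        simp only [Function.update_self, true_and, true_or]
        rw [eq_comm (a := s(x, z))]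
        tauto
      · simp only [hk, false_and, or_false, false_or, Finset.mem_erase, ne_eq, not_false_iff,
          Function.update_of_ne]
        tauto
    · have e1 : F.val = e ::ₘ f ::ₘ ((F.erase e).erase f).val := by
        rw [Finset.erase_val, Multiset.cons_erase (Finset.mem_erase.2 ⟨hef.symm, hf.1⟩),
          Finset.erase_val, Multiset.cons_erase he.1]
      have e2 : (insert g ((F.erase e).erase f)).val.map (Function.update φ g s(x, z)) =
          s(x, z) ::ₘ ((F.erase e).erase f).val.map φ := by
        rw [Finset.insert_val_of_notMem hg', Multiset.map_cons, Function.update_self]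
        congr 1
        refine Multiset.map_congr rfl fun k hk => Function.update_of_ne ?_ _ _
        rintro rfl
        exact hg' hk
      rw [e2, e1, Multiset.map_cons, Multiset.map_cons, he.2, hf.2]
      exact .split _ _ _ _

lemma IsRep.reach (h : IsRep G F φ) (hs : Relation.ReflTransGen Graph.ImmersionStep G G') :
    V(G') ⊆ V(G) ∧ ∃ F' φ', IsRep G' F' φ' ∧ Reach (F.val.map φ) (F'.val.map φ') := by
  induction hs with
  | refl => exact ⟨subset_rfl, F, φ, h, .refl _⟩
  | tail _ hs ih =>
    obtain ⟨h1, F', φ', h2, h3⟩ := ih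
    obtain ⟨k1, F2, φ2, k2, k3⟩ := h2.step hs
    exact ⟨k1.trans h1, F2, φ2, k2, h3.tail k3⟩

lemma sum_edgeFinset_top (f : Sym2 (Fin 4) → ℕ) :
    ∑ p ∈ (⊤ : SimpleGraph (Fin 4)).edgeFinset, f p =
      f s(0, 1) + f s(0, 2) + f s(0, 3) + f s(1, 2) + f s(1, 3) + f s(2, 3) := by
  have e : (⊤ : SimpleGraph (Fin 4)).edgeFinset =
      {s(0, 1), s(0, 2), s(0, 3), s(1, 2), s(1, 3), s(2, 3)} := by
    ext p
    induction p with | _ i j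
    rw [SimpleGraph.mem_edgeFinset, SimpleGraph.mem_edgeSet, SimpleGraph.top_adj]
    fin_cases i <;> fin_cases j <;> simp
  rw [e, Finset.sum_insert (by simp), Finset.sum_insert (by simp), Finset.sum_insert (by simp),
    Finset.sum_insert (by simp), Finset.sum_insert (by simp), Finset.sum_singleton]
  ring

/-- The number of branch vertices `τ i` in `X`. -/
def branch (τ : Fin 4 → α) (X : Finset α) : ℕ := ∑ i, if τ i ∈ X then 1 else 0

/-- Exactly one edge joins each branch vertex inside `X` to each one outside. -/
lemma IsRep.d_of_iso (h : IsRep G F φ) (f : Graph.Iso G Graph.D₃) (X : Finset α) :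
    d (F.val.map φ) X = branch (fun i => (f.vertexEquiv.symm ⟨i, trivial⟩ : α)) X *
      (4 - branch (fun i => (f.vertexEquiv.symm ⟨i, trivial⟩ : α)) X) := by
  set τ : Fin 4 → α := fun i => (f.vertexEquiv.symm ⟨i, trivial⟩ : α) with hτ
  have hE : ∀ e ∈ F, e ∈ E(G) := fun e he => by rw [h.edgeSet_eq]; exact he
  have hE' : ∀ e ∈ E(G), e ∈ F := fun e he => by rw [h.edgeSet_eq] at he; exact he
  have e1 : d (F.val.map φ) X = ∑ p ∈ (⊤ : SimpleGraph (Fin 4)).edgeFinset, cr X (p.map τ) := by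
    rw [d_map]
    refine Finset.sum_bij (fun e he => (f.edgeEquiv ⟨e, hE e he⟩ : Sym2 (Fin 4))) ?_ ?_ ?_ ?_
    · intro e he
      rw [SimpleGraph.mem_edgeFinset]
      exact (f.edgeEquiv ⟨e, hE e he⟩).2
    · intro e he e' he' heq
      have := f.edgeEquiv.injective (Subtype.ext heq)
      exact congrArg Subtype.val this
    · intro p hp
      rw [SimpleGraph.mem_edgeFinset] at hp
      have hm : (f.edgeEquiv.symm ⟨p, hp⟩ : β) ∈ F := by
        exact hE' _ (f.edgeEquiv.symm ⟨p, hp⟩).2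
      exact ⟨_, hm, by simp⟩
    · intro e he
      obtain ⟨x, y, hxy⟩ := exists_eq_mk (φ e)
      have hl := (h.isLink_iff e x y).2 ⟨he, hxy⟩
      have hl' := (f.isLink_iff ⟨e, hE e he⟩ ⟨x, hl.left_mem⟩ ⟨y, hl.right_mem⟩).1 hl
      have h2 : (f.edgeEquiv ⟨e, hE e he⟩ : Sym2 (Fin 4)) =
        s((f.vertexEquiv ⟨x, hl.left_mem⟩ : Fin 4), (f.vertexEquiv ⟨y, hl.right_mem⟩ : Fin 4)) := hl'.1
      rw [h2, hxy, Sym2.map_mk]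
      have : ∀ v : V(G), τ (f.vertexEquiv v) = v := fun v =>
        congrArg Subtype.val (f.vertexEquiv.symm_apply_apply v)
      rw [this, this]
  rw [e1, sum_edgeFinset_top]
  simp only [Sym2.map_mk, cr_mk, branch, Fin.sum_univ_four]
  by_cases h0 : τ 0 ∈ X <;> by_cases h1 : τ 1 ∈ X <;> by_cases h2 : τ 2 ∈ X <;>
    by_cases h3 : τ 3 ∈ X <;> simp [h0, h1, h2, h3]

/-- The effect of a rooted immersion of `K₄` on the edge multiset. -/
lemma IsRep.of_hasRootedImmersion (h : IsRep G F φ)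
    (hG : G.HasRootedImmersion ![a, b] Graph.D₃ ![0, 1]) :
    ∃ (N : Multiset (Sym2 α)) (τ : Fin 4 → α), Reach (F.val.map φ) N ∧ Function.Injective τ ∧
      τ 0 = a ∧ τ 1 = b ∧ (∀ i, τ i ∈ V(G)) ∧ ∀ X, d N X = branch τ X * (4 - branch τ X) := by
  obtain ⟨G', hs, f, hf⟩ := hG
  obtain ⟨hV, F', φ', h', hr⟩ := h.reach hs
  refine ⟨_, _, hr, ?_, ?_, ?_, fun i => hV (f.vertexEquiv.symm ⟨i, trivial⟩).2, h'.d_of_iso f⟩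
  · intro i j hij
    have := f.vertexEquiv.symm.injective (Subtype.ext hij)
    exact congrArg Subtype.val this
  · obtain ⟨h1, h2⟩ := hf 0
    have : f.vertexEquiv ⟨a, h1⟩ = ⟨0, trivial⟩ := Subtype.ext h2
    simp [← this]
  · obtain ⟨h1, h2⟩ := hf 1
    have : f.vertexEquiv ⟨b, h1⟩ = ⟨1, trivial⟩ := Subtype.ext h2
    simp [← this]

lemma branch_le_card {τ : Fin 4 → α} (hτ : Function.Injective τ) : branch τ X ≤ X.card := by
  rw [branch, ← Finset.card_filter, ← Finset.card_image_of_injective _ hτ]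
  refine Finset.card_le_card fun t ht => ?_
  obtain ⟨i, hi, rfl⟩ := Finset.mem_image.1 ht
  exact (Finset.mem_filter.1 hi).2

lemma branch_insert_le {τ : Fin 4 → α} (hτ : Function.Injective τ) :
    branch τ (insert p X) ≤ branch τ X + 1 := by
  have h1 : branch τ (insert p X) ≤ branch τ X + branch τ {p} := by
    unfold branch
    rw [← Finset.sum_add_distrib]
    refine Finset.sum_le_sum fun i _ => ?_
    simp only [Finset.mem_insert, Finset.mem_singleton]
    by_cases h1 : τ i = p <;> by_cases h2 : τ i ∈ X <;> simp [h1, h2]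
  have h2 := branch_le_card (X := {p}) hτ
  rw [Finset.card_singleton] at h2
  omega

lemma branch_add_compl {τ : Fin 4 → α} (hV : ∀ i, τ i ∈ V) : branch τ X + branch τ (V \ X) = 4 := by
  unfold branch
  rw [← Finset.sum_add_distrib]
  have : ∀ i ∈ Finset.univ, (if τ i ∈ X then 1 else 0) + (if τ i ∈ V \ X then 1 else 0) = 1 := by
    intro i _
    have := hV i
    by_cases h2 : τ i ∈ X <;> simp [h2, this]
  rw [Finset.sum_congr rfl this]; simp

/-- At most two branch vertices fit: a set of three or more elements misses two of the four, and a
smaller one has no room. The value two is excluded. -/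
lemma branch_le_one {τ : Fin 4 → α} (hτ : Function.Injective τ) (h2 : branch τ X ≠ 2)
    (h : 3 ≤ X.card → τ 0 ∉ X ∧ τ 1 ∉ X) : branch τ X ≤ 1 := by
  by_cases h3 : 3 ≤ X.card
  · obtain ⟨h0, h1⟩ := h h3
    have : branch τ X ≤ 2 := by
      simp only [branch, Fin.sum_univ_four, h0, h1, if_false]
      split_ifs <;> omega
    omega
  · have := branch_le_card (X := X) hτ
    omega

lemma IsRep.not_hasRootedImmersion_of_segmentation (h : IsRep G F φ) (hV : (V : Set α) = V(G))
    {A B : Set α} (hS : G.HasSegmentation 3 A B) (hA : 3 ≤ A.ncard → a ∉ A ∧ b ∉ A)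
    (hB : 3 ≤ B.ncard → a ∉ B ∧ b ∉ B) : ¬ G.HasRootedImmersion ![a, b] Graph.D₃ ![0, 1] := by
  intro hG
  obtain ⟨N, τ, hr, hτ, rfl, rfl, hτV, hN⟩ := h.of_hasRootedImmersion hG
  have hτV' : ∀ i, τ i ∈ V := fun i => by rw [← Finset.mem_coe, hV]; exact hτV i
  obtain ⟨l, S, hseg, hcut⟩ := hS
  -- the sets as finite sets
  have hfin : ∀ i ≤ l, ∃ X : Finset α, (X : Set α) = S i := by
    intro i hi
    have : (S i).Finite := (V.finite_toSet.subset (hV ▸ hseg.subset_vertexSet i hi))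
    exact ⟨this.toFinset, by simp⟩
  have hne : ∀ X : Finset α, G.cutSize X = 3 → branch τ X ≠ 2 := by
    intro X hX h2
    rw [h.cutSize_eq (X := X) (fun _ _ => Iff.rfl)] at hX
    have h1 := hN X
    have := d_reach_le hr X
    rw [h2] at h1
    omega
  -- The count grows by at most one per step and never equals two.
  have key : ∀ i ≤ l, ∀ X : Finset α, (X : Set α) = S i → branch τ X ≤ 1 := by
    intro i
    induction i with
    | zero =>
      intro hi X hX
      refine branch_le_one hτ (hne X (by rw [hX, hcut 0 hi])) fun h3 => ?_
      rw [← Set.ncard_coe_finset, hX, hseg.first_eq] at h3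
      have := hA h3
      rwa [← hseg.first_eq, ← hX] at this
    | succ i ih =>
      intro hi X hX
      obtain ⟨X', hX'⟩ := hfin i (by omega)
      have h1 := ih (by omega) X' hX'
      obtain ⟨p, hp⟩ := Set.ncard_eq_one.1 (hseg.ncard_sdiff i (by omega))
      have hins : X = insert p X' := by
        rw [← Finset.coe_inj, hX, Finset.coe_insert, hX', ← Set.sdiff_union_of_subset (hseg.ssubset i (by omega)).subset, hp]
        rfl
      have h2 := branch_insert_le (p := p) (X := X') hτ
      rw [← hins] at h2
      have := hne X (by rw [hX, hcut _ hi])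
      omega
  obtain ⟨X, hX⟩ := hfin l le_rfl
  have h1 := key l le_rfl X hX
  have hXV : ((V \ X : Finset α) : Set α) = B := by
    rw [Finset.coe_sdiff, hV, hX, hseg.compl_last_eq]
  have h4 := branch_add_compl (X := X) hτV'
  have h5 := branch_le_one (X := V \ X) hτ (by
    have := hne X (by rw [hX, hcut l le_rfl]); omega) fun h3 => by
    rw [← Set.ncard_coe_finset, hXV] at h3
    have := hB h3
    rwa [← hXV] at this
  omega

end EdgeMultiset

end

noncomputable section

namespace EdgeMultiset

open scoped Classical

variable {α β : Type*} {M N R D : Multiset (Sym2 α)} {P Q X Y Z S V : Finset α}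
  {x y z w a b s p u v : α} {G G' : Graph α β} {F : Finset β} {φ : β → Sym2 α}

/-! ### Doubled cycles exclude rooted immersions -/

lemma d_add (M D : Multiset (Sym2 α)) (X : Finset α) : d (M + D) X = d M X + d D X :=
  wt_add_left _ _ _

lemma d_sdiff_eq_zero (hP : d D P = 0) (hQ : d D Q = 0) : d D (P \ Q) = 0 := by
  rw [d, wt_eq_zero_iff] at *
  intro e he
  have h1 := hP e he
  have h2 := hQ e he
  induction e with | _ x y
  simp only [cr_mk, Finset.mem_sdiff] at *
  by_cases k1 : x ∈ P <;> by_cases k2 : y ∈ P <;> by_cases k3 : x ∈ Q <;> by_cases k4 : y ∈ Q <;>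
    simp_all

/-- Two sets with at most four leaving edges each. -/
structure Crossing (M : Multiset (Sym2 α)) (P Q : Finset α) : Prop where
  left : d M P ≤ 4
  right : d M Q ≤ 4
  -- Parity is claimed only while both cuts are still full; this makes it invariant under deletions.
  even : d M P = 4 → d M Q = 4 → Even (d M (P \ Q))

lemma Crossing.step (h : Crossing M P Q) (hs : Step M N) : Crossing N P Q := by
  have hP := d_step_le hs P
  have hQ := d_step_le hs Q
  have h1 := h.left
  have h2 := h.right
  refine ⟨by omega, by omega, fun h3 h4 => ?_⟩
  have h5 := h.even (by omega) (by omega)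
  cases hs with
  | del hle =>
    obtain ⟨D, hD⟩ := Multiset.le_iff_exists_add.1 hle
    have key : ∀ X, d M X = d N X + d D X := fun X => by
      rw [← d_nl (M := M), hD, d_add, d_nl]
    -- The deleted edges cross neither `P` nor `Q`, hence not `P \ Q`.
    have h6 := d_sdiff_eq_zero (D := D) (P := P) (Q := Q) (by have := key P; omega)
      (by have := key Q; omega)
    rw [key, h6] at h5
    exact h5
  | split R x y z =>
    -- A split changes every cut by an even number.
    simp only [d_cons, cr_mk] at h5 ⊢
    by_cases k1 : x ∈ P \ Q <;> by_cases k2 : y ∈ P \ Q <;> by_cases k3 : z ∈ P \ Q <;>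
      simp only [k1, k2, k3, if_true, if_false, iff_true, iff_false, not_true, Nat.even_iff] at h5 ⊢ <;> omega

lemma Crossing.reach (h : Crossing M P Q) (hs : Reach M N) : Crossing N P Q := by
  induction hs with
  | refl => exact h
  | tail _ hs ih => exact ih.step hs

/-- The edge multiset of a doubled cycle. -/
lemma IsRep.exists_cycle (h : IsRep G F φ) (hD : G.IsDoubledCycle) :
    ∃ (m : ℕ) (σ : Fin (m + 3) → α), Function.Injective σ ∧ (∀ x ∈ V(G), ∃ i, σ i = x) ∧
      ∀ X, d (F.val.map φ) X =
        2 * ∑ p ∈ (SimpleGraph.cycleGraph (m + 3)).edgeFinset, cr X (p.map σ) := by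
  obtain ⟨n, hn, ⟨f⟩⟩ := hD
  obtain ⟨m, rfl⟩ := Nat.exists_eq_add_of_le' hn
  set σ : Fin (m + 3) → α := fun i => (f.vertexEquiv.symm ⟨i, trivial⟩ : α) with hσ
  have hE : ∀ e ∈ F, e ∈ E(G) := fun e he => by rw [h.edgeSet_eq]; exact he
  have hE' : ∀ e ∈ E(G), e ∈ F := fun e he => by rw [h.edgeSet_eq] at he; exact he
  have hmem : ∀ q : Sym2 (Fin (m + 3)) × Bool,
      q ∈ E((Graph.ofSimpleGraph (SimpleGraph.cycleGraph (m + 3))).double) ↔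
        q.1 ∈ (SimpleGraph.cycleGraph (m + 3)).edgeSet := by
    intro q
    constructor
    · rintro ⟨x, y, h1, h2⟩
      exact h2
    · intro h1
      obtain ⟨x, y, hxy⟩ := exists_eq_mk q.1
      exact ⟨x, y, hxy, h1⟩
  refine ⟨m, σ, ?_, fun x hx => ⟨f.vertexEquiv ⟨x, hx⟩,
    congrArg Subtype.val (f.vertexEquiv.symm_apply_apply ⟨x, hx⟩)⟩, fun X => ?_⟩
  · intro i j hij
    have := f.vertexEquiv.symm.injective (Subtype.ext hij)
    exact congrArg Subtype.val this
  have e1 : d (F.val.map φ) X = ∑ q ∈ (SimpleGraph.cycleGraph (m + 3)).edgeFinset ×ˢ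
      (Finset.univ : Finset Bool), cr X (q.1.map σ) := by
    rw [d_map]
    refine Finset.sum_bij (fun e he => (f.edgeEquiv ⟨e, hE e he⟩ : Sym2 (Fin (m + 3)) × Bool))
      ?_ ?_ ?_ ?_
    · intro e he
      rw [Finset.mem_product, SimpleGraph.mem_edgeFinset, ← hmem]
      exact ⟨(f.edgeEquiv ⟨e, hE e he⟩).2, Finset.mem_univ _⟩
    · intro e he e' he' heq
      have := f.edgeEquiv.injective (Subtype.ext heq)
      exact congrArg Subtype.val this
    · intro q hq
      rw [Finset.mem_product, SimpleGraph.mem_edgeFinset, ← hmem] at hq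
      refine ⟨f.edgeEquiv.symm ⟨q, hq.1⟩, hE' _ (f.edgeEquiv.symm ⟨q, hq.1⟩).2, by simp⟩
    · intro e he
      obtain ⟨x, y, hxy⟩ := exists_eq_mk (φ e)
      have hl := (h.isLink_iff e x y).2 ⟨he, hxy⟩
      have hl' := (f.isLink_iff ⟨e, hE e he⟩ ⟨x, hl.left_mem⟩ ⟨y, hl.right_mem⟩).1 hl
      have h2 : (f.edgeEquiv ⟨e, hE e he⟩ : Sym2 (Fin (m + 3)) × Bool).1 =
        s((f.vertexEquiv ⟨x, hl.left_mem⟩ : Fin (m + 3)),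
          (f.vertexEquiv ⟨y, hl.right_mem⟩ : Fin (m + 3))) := hl'.1
      rw [h2, hxy, Sym2.map_mk]
      have : ∀ v : V(G), σ (f.vertexEquiv v) = v := fun v =>
        congrArg Subtype.val (f.vertexEquiv.symm_apply_apply v)
      rw [this, this]
  rw [e1, Finset.sum_product, Finset.mul_sum]
  simp

/-- The vertices of a cycle at the positions from `i` to `j`. -/
def arc {m : ℕ} (σ : Fin (m + 3) → α) (i j : Fin (m + 3)) : Finset α := (Finset.Ico i j).image σ

lemma mem_arc {m : ℕ} {σ : Fin (m + 3) → α} (hσ : Function.Injective σ) {i j k : Fin (m + 3)} :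
    σ k ∈ arc σ i j ↔ i ≤ k ∧ k < j := by
  rw [arc, hσ.mem_finset_image, Finset.mem_Ico]

/-- The arc is half-open, so only the cycle edges entering position `i` and position `j` can cross
it; subtraction is cyclic. -/
lemma sum_cr_arc_le {m : ℕ} {σ : Fin (m + 3) → α} (hσ : Function.Injective σ) (i j : Fin (m + 3)) :
    ∑ p ∈ (SimpleGraph.cycleGraph (m + 3)).edgeFinset, cr (arc σ i j) (p.map σ) ≤ 2 := by
  have key : ∀ k, cr (arc σ i j) s(σ k, σ (k + 1)) ≤
      (if s(k, k + 1) = s(i - 1, i) then 1 else 0) + if s(k, k + 1) = s(j - 1, j) then 1 else 0 := by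
    intro k
    simp only [cr_mk, mem_arc hσ]
    have hval := Fin.val_add_one k
    by_cases h1 : k + 1 = i
    · have : k = i - 1 := eq_sub_of_add_eq h1
      rw [if_pos (show s(k, k + 1) = s(i - 1, i) by rw [h1, ← this])]
      split_ifs <;> omega
    by_cases h2 : k + 1 = j
    · have : k = j - 1 := eq_sub_of_add_eq h2
      rw [if_pos (show s(k, k + 1) = s(j - 1, j) by rw [h2, ← this])]
      split_ifs <;> omega
    rw [if_pos]
    · omega
    · rw [Fin.ext_iff] at h1 h2
      simp only [Fin.le_def, Fin.lt_def]
      have hj := j.2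
      generalize k + 1 = q at hval h1 h2 ⊢
      split_ifs at hval with hk
      · have hk' : (k : ℕ) = m + 2 := by rw [hk]; rfl
        omega
      · omega
  have key' : ∀ p ∈ (SimpleGraph.cycleGraph (m + 3)).edgeFinset, cr (arc σ i j) (p.map σ) ≤
      (if p = s(i - 1, i) then 1 else 0) + if p = s(j - 1, j) then 1 else 0 := by
    intro p hp
    rw [SimpleGraph.mem_edgeFinset] at hp
    induction p with | _ k l
    rw [SimpleGraph.mem_edgeSet, SimpleGraph.cycleGraph_adj] at hp
    rcases hp with hp | hp
    · obtain rfl : k = l + 1 := by rw [← hp]; abel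
      rw [Sym2.eq_swap]; exact key l
    · obtain rfl : l = k + 1 := by rw [← hp]; abel
      exact key k
  refine (Finset.sum_le_sum key').trans ?_
  rw [Finset.sum_add_distrib, Finset.sum_ite_eq', Finset.sum_ite_eq']
  split_ifs <;> omega

lemma branch_comp {τ : Fin 4 → α} (π : Equiv.Perm (Fin 4)) : branch (τ ∘ π) X = branch τ X :=
  Equiv.sum_comp π fun i => if τ i ∈ X then 1 else 0

lemma IsRep.not_hasRootedImmersion_of_doubledCycle (h : IsRep G F φ) (hD : G.IsDoubledCycle) :
    ¬ G.HasRootedImmersion ![a, b] Graph.D₃ ![0, 1] := by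
  intro hG
  obtain ⟨N, τ, hr, hτ, -, -, hτV, hN⟩ := h.of_hasRootedImmersion hG
  obtain ⟨m, σ, hσ, hV, hd⟩ := h.exists_cycle hD
  choose pos hpos using fun i => hV _ (hτV i)
  have hpi : Function.Injective pos := fun i j hij => hτ (by rw [← hpos, ← hpos, hij])
  -- In cyclic order the arcs contain the first two and the middle two branch vertices, so `P \ Q`
  -- contains only the first, and three edges must leave it.
  set π := Tuple.sort pos
  have hmono : StrictMono (pos ∘ π) :=
    (Tuple.monotone_sort pos).strictMono_of_injective (hpi.comp π.injective)
  have l1 : pos (π 0) < pos (π 1) := hmono (by decide)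
  have l2 : pos (π 1) < pos (π 2) := hmono (by decide)
  have l3 : pos (π 2) < pos (π 3) := hmono (by decide)
  set P := arc σ (pos (π 0)) (pos (π 2))
  set Q := arc σ (pos (π 1)) (pos (π 3))
  have hP : ∀ i, τ i ∈ P ↔ pos (π 0) ≤ pos i ∧ pos i < pos (π 2) := fun i => by
    rw [← hpos i]; exact mem_arc hσ
  have hQ : ∀ i, τ i ∈ Q ↔ pos (π 1) ≤ pos i ∧ pos i < pos (π 3) := fun i => by
    rw [← hpos i]; exact mem_arc hσ
  have hc : Crossing (F.val.map φ) P Q := by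
    have h1 := sum_cr_arc_le hσ (pos (π 0)) (pos (π 2))
    have h2 := sum_cr_arc_le hσ (pos (π 1)) (pos (π 3))
    refine ⟨?_, ?_, fun _ _ => ?_⟩
    · rw [hd]; exact Nat.mul_le_mul_left 2 h1
    · rw [hd]; exact Nat.mul_le_mul_left 2 h2
    · rw [hd]; exact even_two_mul _
  have hc' := hc.reach hr
  have eP : branch τ P = 2 := by
    rw [← branch_comp π, branch, Fin.sum_univ_four]
    simp only [Function.comp_apply, hP]
    rw [if_pos ⟨le_rfl, l1.trans l2⟩, if_pos ⟨l1.le, l2⟩, if_neg (by simp),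
      if_neg (fun hh => (l3.trans hh.2).false)]
  have eQ : branch τ Q = 2 := by
    rw [← branch_comp π, branch, Fin.sum_univ_four]
    simp only [Function.comp_apply, hQ]
    rw [if_neg (fun hh => (l1.trans_le hh.1).false), if_pos ⟨le_rfl, l2.trans l3⟩,
      if_pos ⟨l2.le, l3⟩, if_neg (by simp)]
  have eR : branch τ (P \ Q) = 1 := by
    rw [← branch_comp π, branch, Fin.sum_univ_four]
    simp only [Function.comp_apply, Finset.mem_sdiff, hP, hQ]
    rw [if_pos ⟨⟨le_rfl, l1.trans l2⟩, fun hh => (l1.trans_le hh.1).false⟩,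
      if_neg (fun hh => hh.2 ⟨le_rfl, l2.trans l3⟩), if_neg (fun hh => hh.2 ⟨l2.le, l3⟩),
      if_neg (fun hh => (l3.trans hh.1.2).false)]
  have := hc'.even (by rw [hN, eP]) (by rw [hN, eQ])
  rw [hN, eR] at this
  exact absurd this (by decide)

/-! ### Recognizing doubled cycles -/

lemma mu_map (F : Finset β) (φ : β → Sym2 α) (x y : α) :
    mu (F.val.map φ) x y = (F.filter fun e => φ e = s(x, y)).card := by
  simp only [mu, wt, Multiset.map_map, Finset.card_filter]; rfl

lemma IsRep.adj_iff (h : IsRep G F φ) : G.Adj x y ↔ 0 < mu (F.val.map φ) x y := by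
  rw [mu_map, Finset.card_pos]
  simp only [Graph.Adj, h.isLink_iff, Finset.Nonempty, Finset.mem_filter]

/-- No edge leaves a component, so a proper one would contradict edge-connectivity. -/
lemma IsRep.connected (h : IsRep G F φ) (hV : (V : Set α) = V(G)) (hec : EC (F.val.map φ) V)
    (hG : G.Loopless) (c : G.toSimpleGraph.ConnectedComponent) : c.supp = Set.univ := by
  by_contra hne
  obtain ⟨v, hv⟩ := c.nonempty_supp
  have hmem : ∀ x : V(G), (x : α) ∈ V := fun x => by rw [← Finset.mem_coe, hV]; exact x.2
  set X : Finset α := V.filter fun x => ∃ hx : x ∈ V(G), (⟨x, hx⟩ : V(G)) ∈ c.supp with hX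
  have hiff : ∀ x : V(G), (x : α) ∈ X ↔ x ∈ c.supp := fun x => by
    rw [hX, Finset.mem_filter]
    exact ⟨fun hh => hh.2.2, fun hh => ⟨hmem x, x.2, hh⟩⟩
  have h3 := hec X (Finset.filter_subset _ _) ⟨v, (hiff v).2 hv⟩ fun hh => hne (by
    ext x
    rw [← hiff, hh]
    simpa using hmem x)
  have h0 : d (F.val.map φ) X = 0 := by
    rw [d_map, Finset.sum_eq_zero_iff]
    intro e he
    obtain ⟨x, y, hxy⟩ := exists_eq_mk (φ e)
    have hl := (h.isLink_iff e x y).2 ⟨he, hxy⟩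
    have hadj : G.toSimpleGraph.Adj ⟨x, hl.left_mem⟩ ⟨y, hl.right_mem⟩ := by
      rw [Graph.toSimpleGraph_adj]
      refine ⟨fun hh => ?_, hl.adj⟩
      obtain rfl : x = y := congrArg Subtype.val hh
      exact hG.not_isLoopAt _ _ hl
    have h1 := hiff ⟨x, hl.left_mem⟩
    have h2 := hiff ⟨y, hl.right_mem⟩
    rw [hxy, cr_mk, if_pos]
    rw [h1, h2, SimpleGraph.ConnectedComponent.mem_supp_iff, SimpleGraph.ConnectedComponent.mem_supp_iff,
      SimpleGraph.ConnectedComponent.connectedComponentMk_eq_of_adj hadj]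
  omega

lemma IsRep.neighborSet (h : IsRep G F φ) (hV : (V : Set α) = V(G)) (hD : Dbl (F.val.map φ) V)
    (hG : G.Loopless) (v : V(G)) : ∃ y z : V(G), y ≠ z ∧ G.toSimpleGraph.neighborSet v = {y, z} := by
  have hmem : ∀ x, x ∈ V ↔ x ∈ V(G) := fun x => by rw [← Finset.mem_coe, hV]
  obtain ⟨hd, y, hy, z, hz, hyz, hvy, hvz, my, mz⟩ := hD v ((hmem v).2 v.2)
  rw [hmem] at hy hz
  refine ⟨⟨y, hy⟩, ⟨z, hz⟩, by simpa using hyz, ?_⟩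
  ext w
  rw [SimpleGraph.mem_neighborSet, Graph.toSimpleGraph_adj_iff, h.adj_iff]
  constructor
  · intro hw
    by_contra hcon
    simp only [Set.mem_insert_iff, Set.mem_singleton_iff, not_or, Subtype.ext_iff] at hcon
    have hwv : (w : α) ≠ v := (Graph.Adj.ne (h.adj_iff.2 hw)).symm
    rw [mu_eq_zero_of_two hvy hvz hyz hd my mz hwv hcon.1 hcon.2] at hw
    exact lt_irrefl _ hw
  · rintro (rfl | rfl)
    · change 0 < mu _ _ y
      omega
    · change 0 < mu _ _ z
      omega

/-- A connected graph all of whose vertices have two neighbours is a cycle. -/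
lemma exists_cycleGraph_iso {W : Type*} [Finite W] [Nonempty W] {H : SimpleGraph W}
    (h2 : ∀ v, ∃ y z, y ≠ z ∧ H.neighborSet v = {y, z})
    (hc : ∀ c : H.ConnectedComponent, c.supp = Set.univ) :
    ∃ m, Nonempty (SimpleGraph.cycleGraph (m + 3) ≃g H) := by
  have hcyc : H.IsCycles := by
    intro v _
    obtain ⟨y, z, hyz, he⟩ := h2 v
    rw [he, Set.ncard_pair hyz]
  obtain ⟨v⟩ := ‹Nonempty W›
  obtain ⟨y, z, -, hv⟩ := h2 v
  -- Some cycle covers the whole component, that is, all vertices. Its length is therefore the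
  -- number of vertices, and the embedding of the cycle graph is bijective.
  obtain ⟨p, hp, hverts⟩ := hcyc.exists_cycle_toSubgraph_verts_eq_connectedComponentSupp
    (c := H.connectedComponentMk v) (v := v) rfl ⟨y, by rw [hv]; simp⟩
  have hlen := hp.isCircuit.three_le_length
  obtain ⟨m, hm⟩ := Nat.exists_eq_add_of_le' hlen
  obtain ⟨f⟩ := (SimpleGraph.cycleGraph_isContained_iff (by omega)).2 ⟨v, p, hp, hm⟩
  have hinj : Function.Injective f := f.injective
  have := Fintype.ofFinite W
  have hcard : Fintype.card W ≤ m + 3 := by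
    have h1 : p.support.tail.toFinset = Finset.univ := by
      ext w
      have hw : w ∈ p.toSubgraph.verts := by rw [hverts, hc]; trivial
      rw [SimpleGraph.Walk.mem_verts_toSubgraph, SimpleGraph.Walk.mem_support_iff] at hw
      simp only [List.mem_toFinset, Finset.mem_univ, iff_true]
      rcases hw with rfl | hw
      · exact SimpleGraph.Walk.end_mem_tail_support hp.not_nil
      · exact hw
    rw [← Finset.card_univ, ← h1]
    refine (List.toFinset_card_le _).trans ?_
    rw [List.length_tail, SimpleGraph.Walk.length_support]
    omega
  have hbij : Function.Bijective f := by
    rw [Fintype.bijective_iff_injective_and_card]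
    refine ⟨hinj, le_antisymm (Fintype.card_le_of_injective f hinj) ?_⟩
    simpa using hcard
  refine ⟨m, ⟨⟨Equiv.ofBijective f hbij, fun {i j} => ?_⟩⟩⟩
  change H.Adj (f i) (f j) ↔ _
  refine ⟨fun hadj => ?_, fun hadj => f.toHom.map_adj hadj⟩
  -- There are no chords: the two neighbours in the cycle already exhaust the neighbourhood.
  obtain ⟨y, z, hyz, he⟩ := h2 (f i)
  have h3 : (SimpleGraph.cycleGraph (m + 3)).degree i = 2 :=
    SimpleGraph.cycleGraph_degree_three_le
  have h4 : ((SimpleGraph.cycleGraph (m + 3)).neighborFinset i).image f = {y, z} := by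
    refine Finset.eq_of_subset_of_card_le ?_ ?_
    · intro w hw
      obtain ⟨k, hk, rfl⟩ := Finset.mem_image.1 hw
      rw [SimpleGraph.mem_neighborFinset] at hk
      have : f k ∈ H.neighborSet (f i) := f.toHom.map_adj hk
      rw [he] at this
      simpa using this
    · rw [Finset.card_image_of_injective _ hinj, SimpleGraph.card_neighborFinset_eq_degree, h3,
        Finset.card_pair hyz]
  have h5 : f j ∈ H.neighborSet (f i) := hadj
  rw [he] at h5
  have h6 : f j ∈ ((SimpleGraph.cycleGraph (m + 3)).neighborFinset i).image f := by
    rw [h4]; simpa using h5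
  obtain ⟨k, hk, hkj⟩ := Finset.mem_image.1 h6
  rw [hinj hkj, SimpleGraph.mem_neighborFinset] at hk
  exact hk

lemma IsRep.isDoubledCycle (h : IsRep G F φ) (hV : (V : Set α) = V(G)) (hD : Dbl (F.val.map φ) V)
    (hec : EC (F.val.map φ) V) (hG : G.Loopless) (hne : V(G).Nonempty) : G.IsDoubledCycle := by
  have hfin : Finite V(G) := by rw [← hV]; exact V.finite_toSet
  have hne' : Nonempty V(G) := hne.to_subtype
  obtain ⟨m, ⟨f⟩⟩ := exists_cycleGraph_iso (h.neighborSet hV hD hG) (h.connected hV hec hG)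
  set C := SimpleGraph.cycleGraph (m + 3) with hC
  set σ : Fin (m + 3) → α := fun i => (f i : α) with hσ
  have hσi : Function.Injective σ := fun i j hij => f.injective (Subtype.ext hij)
  have key : ∀ p : Sym2 (Fin (m + 3)), ∃ g : Bool → β, p ∈ C.edgeSet → Function.Injective g ∧
      ∀ e, e ∈ F ∧ φ e = p.map σ ↔ ∃ t, g t = e := by
    intro p
    -- `e₀` is a mere default for pairs that are not edges of the cycle.
    obtain ⟨e₀, -⟩ : F.Nonempty := by
      by_contra hF
      obtain ⟨v, hv⟩ := hne
      have h1 := (hD v (by rwa [← Finset.mem_coe, hV])).1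
      rw [Finset.not_nonempty_iff_eq_empty.1 hF, d_map, Finset.sum_empty] at h1
      omega
    by_cases hp : p ∈ C.edgeSet
    · induction p with | _ i j
      have hadj : G.Adj (f i) (f j) := (f.map_adj_iff.2 hp).2
      have hmu : mu (F.val.map φ) (f i) (f j) = 2 := by
        obtain ⟨hd, y, -, z, -, hyz, hvy, hvz, my, mz⟩ :=
          hD (f i) (by rw [← Finset.mem_coe, hV]; exact (f i).2)
        by_cases h1 : (f j : α) = y
        · rw [h1, my]
        by_cases h2 : (f j : α) = z
        · rw [h2, mz]
        have := mu_eq_zero_of_two hvy hvz hyz hd my mz hadj.ne.symm h1 h2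
        have := h.adj_iff.1 hadj
        omega
      rw [mu_map] at hmu
      obtain ⟨e₁, e₂, hne, he⟩ := Finset.card_eq_two.1 hmu
      refine ⟨fun t => if t then e₁ else e₂, fun _ => ⟨?_, fun e => ?_⟩⟩
      · intro t t'
        cases t <;> cases t' <;> simp [hne, hne.symm]
      · have : e ∈ F.filter (fun e => φ e = s((f i : α), (f j : α))) ↔ e ∈ ({e₁, e₂} : Finset β) := by
          rw [he]
        rw [Finset.mem_filter, Finset.mem_insert, Finset.mem_singleton] at this
        rw [Sym2.map_mk, this]
        simp only [Bool.exists_bool, Bool.false_eq_true, if_true, if_false]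
        rw [or_comm, eq_comm, eq_comm (a := e)]
    · exact ⟨fun _ => e₀, fun h => absurd h hp⟩
  choose g hg using key
  have hmem : ∀ q : Sym2 (Fin (m + 3)) × Bool,
      q ∈ E((Graph.ofSimpleGraph C).double) → q.1 ∈ C.edgeSet := by
    rintro q ⟨x, y, h1, h2⟩
    exact h2
  have hgF : ∀ q : E((Graph.ofSimpleGraph C).double), g q.1.1 q.1.2 ∈ F ∧
      φ (g q.1.1 q.1.2) = q.1.1.map σ := fun q => ((hg _ (hmem _ q.2)).2 _).2 ⟨_, rfl⟩
  have hgE : ∀ q : E((Graph.ofSimpleGraph C).double), g q.1.1 q.1.2 ∈ E(G) := fun q => by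
    rw [h.edgeSet_eq]; exact (hgF q).1
  have hbij : Function.Bijective fun q : E((Graph.ofSimpleGraph C).double) =>
      (⟨g q.1.1 q.1.2, hgE q⟩ : E(G)) := by
    constructor
    · intro q q' heq
      have heq' : g q.1.1 q.1.2 = g q'.1.1 q'.1.2 := congrArg Subtype.val heq
      have h1 : q.1.1 = q'.1.1 := by
        refine Sym2.map.injective hσi ?_
        rw [← (hgF q).2, ← (hgF q').2, heq']
      rw [h1] at heq'
      exact Subtype.ext (Prod.ext h1 ((hg _ (hmem _ q'.2)).1 heq'))
    · rintro ⟨e, he⟩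
      obtain ⟨x, y, hxy⟩ := G.exists_isLink_of_mem_edgeSet he
      obtain ⟨heF, hφ⟩ := (h.isLink_iff e x y).1 hxy
      obtain ⟨i, hi⟩ := f.surjective ⟨x, hxy.left_mem⟩
      obtain ⟨j, hj⟩ := f.surjective ⟨y, hxy.right_mem⟩
      have hadj : C.Adj i j := by
        rw [← f.map_adj_iff, hi, hj, Graph.toSimpleGraph_adj_iff]
        exact hxy.adj
      obtain ⟨t, ht⟩ := ((hg s(i, j) hadj).2 e).1 ⟨heF, by
        rw [hφ, Sym2.map_mk]; simp only [hσ, hi, hj]⟩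
      exact ⟨⟨(s(i, j), t), i, j, rfl, hadj⟩, Subtype.ext ht⟩
  let I : Graph.Iso (Graph.ofSimpleGraph C).double G :=
    { vertexEquiv := (Equiv.Set.univ (Fin (m + 3))).trans f.toEquiv
      edgeEquiv := Equiv.ofBijective _ hbij
      isLink_iff := by
        rintro ⟨⟨p, t⟩, hp⟩ ⟨i, -⟩ ⟨j, -⟩
        change (p = s(i, j) ∧ p ∈ C.edgeSet) ↔ G.IsLink (g p t) (σ i) (σ j)
        have hgp := hgF ⟨(p, t), hp⟩
        rw [h.isLink_iff, hgp.2]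
        constructor
        · rintro ⟨rfl, -⟩
          exact ⟨hgp.1, rfl⟩
        · rintro ⟨-, h2⟩
          exact ⟨Sym2.map.injective hσi h2, hmem _ hp⟩ }
  exact ⟨m + 3, by omega, ⟨I.symm⟩⟩

end EdgeMultiset

end

/-! ### The characterisation for graphs -/

theorem mainTheorem6 {α β : Type*} (G : Graph α β) (hloop : G.Loopless)
    (hV : V(G).Finite) (hE : E(G).Finite)
    (hconn : G.EdgeConnected 3) (hcard : 4 ≤ V(G).ncard)
    (x₀ x₁ : α) (hx₀ : x₀ ∈ V(G)) (hx₁ : x₁ ∈ V(G)) (hne : x₀ ≠ x₁) :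
    ¬ G.HasRootedImmersion ![x₀, x₁] Graph.D₃ ![0, 1] ↔
      G.IsDoubledCycle ∨
      ∃ X₀ X₁ : Set α, G.HasSegmentation 3 X₀ X₁ ∧
        (3 ≤ X₀.ncard → x₀ ∉ X₀ ∧ x₁ ∉ X₀) ∧
        (3 ≤ X₁.ncard → x₀ ∉ X₁ ∧ x₁ ∉ X₁) := by
  obtain ⟨φ, h⟩ := @EdgeMultiset.exists_isRep α β G ⟨x₀⟩ hE
  have hVc : (hV.toFinset : Set α) = V(G) := hV.coe_toFinset
  constructor
  · intro hno
    have h4 : 4 ≤ hV.toFinset.card := by rwa [← Set.ncard_eq_toFinset_card _ hV]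
    have hec := h.ec hVc hconn
    rcases EdgeMultiset.out_of_ec (h.sup hVc) hec h4 (by simpa using hx₀) (by simpa using hx₁) hne
      with hK | hD | ⟨Z, Y, hS⟩
    · exact absurd (h.hasRootedImmersion (h.nl_eq hloop).symm hne hK) hno
    · exact Or.inl (h.isDoubledCycle hVc hD hec hloop ⟨x₀, hx₀⟩)
    · exact Or.inr (h.exists_segmentation hVc hS)
  · rintro (hD | ⟨X₀, X₁, hS, h₀, h₁⟩)
    · exact h.not_hasRootedImmersion_of_doubledCycle hD
    · exact h.not_hasRootedImmersion_of_segmentation hVc hS h₀ h₁
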